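/- All graphs are finite and simple, and $\log$ is the logarithm to base $2$. For a graph $F$, a \emph{subdivision of $F$} is a graph obtained from $F$ by replacing each edge $uv$ of $F$ with a path with ends $u$ and $v$, such that the sets of internal vertices of these paths are pairwise disjoint and disjoint from the vertex set of $F$. A \emph{$\mathrm{T}F$-packing} in a graph $G$ is a collection of pairwise vertex-disjoint subgraphs of $G$, each of which is (isomorphic to) a subdivision of $F$; different members of the collection need not be isomorphic to each other. \textbf{Theorem.} For every graph $F$ with at least one vertex there is an integer $n_0 = n_0(F)$ such that the following holds for all integers $n \ge n_0$ and $d$. Every $d$-regular graph $G$ on $n$ vertices with $d \ge (\log n)^{130}$ contains a $\mathrm{T}F$-packing that covers all but at most $\dfrac{n}{(\log\log n)^{1/30}}$ vertices of $G$. -/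

import Mathlib

/-- The subgraph `K` of `G` is a subdivision of `F` (a copy in `G` of a graph obtained from `F` by
replacing every edge `uv` with a path with ends `u` and `v`, the interiors of these paths being
pairwise disjoint and disjoint from the original vertices).

`b u` is the vertex of `K` playing the role of `u`, and `P u v h` is the path replacing the edge
`uv`, oriented from `u` to `v`; the same path is used, reversed, for the other orientation.
Every such path has length at least one, because `b` is injective. -/
def IsSubdivision {W V : Type*} (F : SimpleGraph W) {G : SimpleGraph V} (K : G.Subgraph) : Prop :=
  ∃ (b : W → V) (P : ∀ u v : W, F.Adj u v → G.Walk (b u) (b v)),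
    Function.Injective b ∧
    (∀ u v h, (P u v h).IsPath) ∧
    (∀ u v h, P v u h.symm = (P u v h).reverse) ∧
    -- an original vertex lies on a path only as one of its ends
    (∀ u v h w, b w ∈ (P u v h).support → w = u ∨ w = v) ∧
    -- paths replacing distinct edges have disjoint interiors
    (∀ u v h u' v' h', s(u, v) ≠ s(u', v') →
      ∀ x, x ∈ (P u v h).support → x ∈ (P u' v' h').support → x ∈ Set.range b) ∧
    -- `K` consists exactly of the original vertices and these paths
    (∀ x, x ∈ K.verts ↔ x ∈ Set.range b ∨ ∃ u v h, x ∈ (P u v h).support) ∧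
    (∀ x y, K.Adj x y ↔ ∃ u v h, s(x, y) ∈ (P u v h).edges)

/-- A packing of subdivisions of `F` in `G`: a collection of pairwise vertex-disjoint subgraphs of
`G`, each of which is a subdivision of `F` (they need not be isomorphic to each other). -/
def IsSubdivisionPacking {W V : Type*} (F : SimpleGraph W) (G : SimpleGraph V)
    (𝒦 : Set G.Subgraph) : Prop :=
  (∀ K ∈ 𝒦, IsSubdivision F K) ∧
    𝒦.Pairwise fun K L => Disjoint K.verts L.verts

/-- The set of vertices covered by a collection of subgraphs. -/
def coveredVertices {V : Type*} {G : SimpleGraph V} (𝒦 : Set G.Subgraph) : Set V :=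
  ⋃ K ∈ 𝒦, K.verts

/-! Write `lam` for the integer part of log n. If `F` has an edge, the proof leaves at most
14n/`lam` vertices uncovered, far fewer than required. An edgeless `F` is packed by cutting the
vertex set into blocks.

Reduction to expanders. As long as a part `C` contains a set `S` of at most half its size sending
fewer than (d/`lam`²)|S| edges to the rest of `C`, split `C` along `S`. The cut edges are charged to
the smaller side, so the potential |C| log |C| pays for them, and the final parts together have
degree deficit Σ (1 - deg/d) at most of order n/`lam`. It therefore suffices to cover an expanding
part up to its deficit plus 10|C|/`lam` vertices (`exists_packing_of_expandsIn`,
`exists_packing_subset`).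

Inside an expander on N vertices, put t = `lam`^20. Sampling gives two small disjoint sets X and Y,
each seen evenly from everywhere. Almost all of X and of Y is grouped into hubs: `lam` base
vertices, and a subdivision of the complete graph on |W| points over each of them, built from short
paths of the expander (`exists_isHubSystem`). The hubs occupy few vertices. What remains is sampled
into t layers. Weighting edges by inverse degrees makes consecutive layers almost regular to each
other on average, so Hall's theorem yields almost perfect matchings. Composed, these form disjoint
paths from X to Y with t interior vertices each, which cover almost everything up to the deficit
(`exists_long_paths`).

Closing up. After giving up at most as many paths as there are hubs, every hub contains an even
number of used ends, and these are paired inside the hubs. Paths and pairs form disjoint cycles.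
Each cycle becomes one subdivision: all branch vertices lie over one end i, and a single edge of `F`
runs around the whole cycle (`IsHubSystem.exists_hasSubdivisionOn`, `exists_packing_of_hubs`).
Different cycles may share a hub, but they use different points and pairs of it.

Only total errors matter, never errors at single vertices, so second moments replace concentration
inequalities (`exists_disjoint_sample`). -/

open Finset

/-! ### Selection by second moments -/

/-- Average over `o`: the cross terms vanish because the increments have mean zero. -/
theorem exists_sum_add_sq_le {κ O : Type*} [Fintype O] (s : Finset κ) (μ : O → ℝ)
    (hμ : ∀ o, 0 ≤ μ o) (hμ1 : ∑ o, μ o = 1) (y : κ → ℝ) (b : O → κ → ℝ)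
    (hb : ∀ x ∈ s, ∑ o, μ o * b o x = 0) :
    ∃ o, ∑ x ∈ s, (y x + b o x) ^ 2 ≤ ∑ x ∈ s, y x ^ 2 + ∑ x ∈ s, ∑ o, μ o * b o x ^ 2 := by
  by_contra! h
  have hpos : ∃ o, 0 < μ o := by
    by_contra! h0
    have : ∑ o, μ o ≤ 0 := Finset.sum_nonpos fun o _ => h0 o
    linarith
  obtain ⟨o₀, ho₀⟩ := hpos
  set c := ∑ x ∈ s, y x ^ 2 + ∑ x ∈ s, ∑ o, μ o * b o x ^ 2 with hc
  have h1 : ∑ o, μ o * c < ∑ o, μ o * ∑ x ∈ s, (y x + b o x) ^ 2 :=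
    Finset.sum_lt_sum (fun o _ => mul_le_mul_of_nonneg_left (h o).le (hμ o))
      ⟨o₀, mem_univ _, mul_lt_mul_of_pos_left (h o₀) ho₀⟩
  rw [← Finset.sum_mul, hμ1, one_mul] at h1
  have h2 : ∑ o, μ o * ∑ x ∈ s, (y x + b o x) ^ 2 = c := by
    simp_rw [Finset.mul_sum]
    rw [Finset.sum_comm, hc, ← Finset.sum_add_distrib]
    refine Finset.sum_congr rfl fun x hx => ?_
    have : ∀ o, μ o * (y x + b o x) ^ 2
        = μ o * y x ^ 2 + 2 * y x * (μ o * b o x) + μ o * b o x ^ 2 := fun o => by ring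
    simp_rw [this, Finset.sum_add_distrib, ← Finset.mul_sum, ← Finset.sum_mul, hb x hx, hμ1]
    ring
  linarith

/-- Method of conditional expectations: the choices are fixed one at a time, and each can be made so
that the sum of squares grows by at most its variance. -/
theorem exists_choice_sum_sq_le {ι κ O : Type*} [Fintype O] [Nonempty O] [DecidableEq ι]
    (r : Finset ι) (s : Finset κ) (μ : ι → O → ℝ)
    (hμ : ∀ i ∈ r, ∀ o, 0 ≤ μ i o) (hμ1 : ∀ i ∈ r, ∑ o, μ i o = 1) (b : ι → O → κ → ℝ)
    (hb : ∀ i ∈ r, ∀ x ∈ s, ∑ o, μ i o * b i o x = 0) :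
    ∃ c : ι → O, ∑ x ∈ s, (∑ i ∈ r, b i (c i) x) ^ 2
      ≤ ∑ i ∈ r, ∑ x ∈ s, ∑ o, μ i o * b i o x ^ 2 := by
  induction r using Finset.induction_on with
  | empty => exact ⟨fun _ => Classical.arbitrary O, by simp⟩
  | insert j r hj ih =>
    obtain ⟨c, hc⟩ := ih (fun i hi => hμ i (mem_insert_of_mem hi))
      (fun i hi => hμ1 i (mem_insert_of_mem hi)) (fun i hi => hb i (mem_insert_of_mem hi))
    obtain ⟨o, ho⟩ := exists_sum_add_sq_le s (μ j) (hμ j (mem_insert_self _ _))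
      (hμ1 j (mem_insert_self _ _)) (fun x => ∑ i ∈ r, b i (c i) x) (b j)
      (hb j (mem_insert_self _ _))
    refine ⟨Function.update c j o, ?_⟩
    rw [Finset.sum_insert hj]
    have h1 : ∀ x, ∑ i ∈ insert j r, b i (Function.update c j o i) x
        = (∑ i ∈ r, b i (c i) x) + b j o x := by
      intro x
      rw [Finset.sum_insert hj, add_comm]
      congr 1
      · refine Finset.sum_congr rfl fun i hi => ?_
        rw [Function.update_of_ne]
        rintro rfl
        exact hj hi
      · simp
    simp_rw [h1]
    linarith

/-- Each `u` independently joins part `j` with probability `σ u / t`, and no part with probability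
`1 - σ u`. A vertex has a single outcome, so the parts are disjoint. The right side bounds the total
variance; summing over the `t` parts removes the factor 1/t. -/
theorem exists_disjoint_sample {V T : Type*} [DecidableEq V] (s : Finset T) (V' : Finset V)
    (t : ℕ) (ht : 0 < t) (σ : V → ℝ) (hσ0 : ∀ u ∈ V', 0 ≤ σ u) (hσ1 : ∀ u ∈ V', σ u ≤ 1)
    (ω : T → V → ℝ) :
    ∃ A : ℕ → Finset V, (∀ j, A j ⊆ V') ∧ (∀ i j, i ≠ j → Disjoint (A i) (A j)) ∧
      ∑ j ∈ range t, ∑ x ∈ s, (∑ u ∈ A j, ω x u - (∑ u ∈ V', σ u * ω x u) / t) ^ 2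
        ≤ ∑ x ∈ s, ∑ u ∈ V', σ u * ω x u ^ 2 := by
  have ht' : (0 : ℝ) < t := by exact_mod_cast ht
  let μ : V → Option (Fin t) → ℝ := fun u o => o.elim (1 - σ u) (fun _ => σ u / t)
  let b : V → Option (Fin t) → Fin t × T → ℝ := fun u o x =>
    ω x.2 u * ((if o = some x.1 then 1 else 0) - σ u / t)
  obtain ⟨c, hc⟩ := exists_choice_sum_sq_le V' (univ ×ˢ s) μ
    (by
      rintro u hu (_ | o)
      · simpa [μ] using hσ1 u hu
      · exact div_nonneg (hσ0 u hu) ht'.le)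
    (by
      intro u hu
      simp only [μ, Fintype.sum_option, Option.elim]
      simp
      field_simp
      ring) b
    (by
      rintro u hu ⟨j, x⟩ -
      simp only [μ, b, Fintype.sum_option, Option.elim, Option.some.injEq, reduceCtorEq, if_false]
      have : ∀ i : Fin t, σ u / t * (ω x u * ((if i = j then 1 else 0) - σ u / t))
          = (if i = j then σ u / t * ω x u else 0) - σ u / t * ω x u * (σ u / t) := by
        intro i; split_ifs <;> ring
      simp_rw [this, Finset.sum_sub_distrib, Finset.sum_ite_eq', mem_univ, if_true]
      simp
      field_simp
      ring)
  refine ⟨fun j => V'.filter (fun u => (c u).map Fin.val = some j), fun j => filter_subset _ _,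
    ?_, ?_⟩
  · intro i j hij
    rw [Finset.disjoint_left]
    intro u hu hu'
    rw [mem_filter] at hu hu'
    exact hij (Option.some_injective _ (hu.2.symm.trans hu'.2))
  · rw [Finset.sum_product] at hc
    rw [Finset.sum_range]
    refine le_trans (le_of_eq ?_) (hc.trans ?_)
    · refine Finset.sum_congr rfl fun j _ => Finset.sum_congr rfl fun x _ => ?_
      congr 1
      simp only [b, mul_sub, Finset.sum_sub_distrib]
      congr 1
      · rw [Finset.sum_filter]
        refine Finset.sum_congr rfl fun u _ => ?_
        have : ((c u).map Fin.val = some (j : ℕ)) ↔ c u = some j := by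
          rcases c u with _ | i
          · simp
          · simp [Fin.ext_iff]
        simp [this]
      · rw [Finset.sum_div]
        exact Finset.sum_congr rfl fun u _ => by ring
    · rw [Finset.sum_comm]
      refine le_of_le_of_eq (b := ∑ x ∈ (univ : Finset (Fin t)) ×ˢ s,
        ∑ u ∈ V', σ u / t * ω x.2 u ^ 2) ?_ ?_
      · refine Finset.sum_le_sum fun x _ => Finset.sum_le_sum fun u hu => ?_
        simp only [μ, b, Fintype.sum_option, Option.elim, Option.some.injEq, reduceCtorEq,
          if_false]
        have : ∀ i : Fin t, σ u / t * (ω x.2 u * ((if i = x.1 then 1 else 0) - σ u / t)) ^ 2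
          = (if i = x.1 then σ u / t * ω x.2 u ^ 2 * (1 - 2 * (σ u / t)) else 0)
            + σ u / t * ω x.2 u ^ 2 * (σ u / t) ^ 2 := by
          intro i; split_ifs <;> ring
        simp_rw [this, Finset.sum_add_distrib, Finset.sum_ite_eq', mem_univ, if_true]
        simp only [sum_const, card_univ, Fintype.card_fin, nsmul_eq_mul]
        -- With p = `σ u / t`, the contributions add up to the exact variance p(1 - p)ω², and `h0`
        -- allows the negative term to be dropped.
        have h0 : 0 ≤ ω x.2 u ^ 2 * (σ u / t) ^ 2 := by positivity
        have : (t : ℝ) * (σ u / t * ω x.2 u ^ 2 * (σ u / t) ^ 2)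
          = σ u * (ω x.2 u ^ 2 * (σ u / t) ^ 2) := by field_simp
        rw [this]
        nlinarith
      · rw [Finset.sum_product]
        simp only [sum_const, card_univ, Fintype.card_fin, nsmul_eq_mul]
        rw [Finset.mul_sum]
        refine Finset.sum_congr rfl fun x _ => ?_
        rw [Finset.mul_sum]
        exact Finset.sum_congr rfl fun u _ => by field_simp

/-- Termwise 2|f| ≤ K f² + 1/K. The free parameter `K` balances the two errors later. -/
theorem sum_abs_le_of_sum_sq_le {κ : Type*} (s : Finset κ) (f : κ → ℝ) {K a : ℝ} (hK : 0 < K)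
    (h : ∑ x ∈ s, f x ^ 2 ≤ a) : ∑ x ∈ s, |f x| ≤ K * a + #s / K := by
  have h1 : ∀ x ∈ s, |f x| ≤ K * f x ^ 2 + 1 / K := by
    intro x _
    have h2 : K * f x ^ 2 + 1 / K - 2 * |f x| = (K * |f x| - 1) ^ 2 / K := by
      field_simp
      rw [← sq_abs (f x)]
      ring
    have h3 : 0 ≤ (K * |f x| - 1) ^ 2 / K := by positivity
    have := abs_nonneg (f x)
    linarith
  calc ∑ x ∈ s, |f x| ≤ ∑ x ∈ s, (K * f x ^ 2 + 1 / K) := Finset.sum_le_sum h1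
    _ = K * ∑ x ∈ s, f x ^ 2 + #s / K := by
      rw [Finset.sum_add_distrib, ← Finset.mul_sum]; simp [div_eq_mul_inv]
    _ ≤ _ := by gcongr

/-! ### Hall's theorem with deficiency -/

/-- Add `k` dummy targets adjacent to every element. Hall's condition then holds, and the at most
`k` elements matched to dummies are discarded. -/
theorem exists_injOn_of_card_le_add {α β : Type*} [DecidableEq α] [DecidableEq β] [Nonempty β]
    (A : Finset α) (nb : α → Finset β) (k : ℕ) (h : ∀ S ⊆ A, #S ≤ #(S.biUnion nb) + k) :
    ∃ (T : Finset α) (f : α → β), T ⊆ A ∧ #A ≤ #T + k ∧ Set.InjOn f T ∧ ∀ x ∈ T, f x ∈ nb x := by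
  let nb' : A → Finset (β ⊕ Fin k) := fun x => (nb x).disjSum univ
  have hall : ∀ s : Finset A, #s ≤ #(s.biUnion nb') := by
    intro s
    rcases s.eq_empty_or_nonempty with rfl | hs
    · simp
    have h1 : s.biUnion nb' = ((s.map (Function.Embedding.subtype _)).biUnion nb).disjSum univ := by
      ext (x | x)
      · simp [nb']
      · simp only [nb', mem_biUnion, inr_mem_disjSum, mem_univ, and_true, iff_true]
        exact hs
    rw [h1, card_disjSum, card_univ, Fintype.card_fin, ← card_map (Function.Embedding.subtype _)]
    refine h _ fun x hx => ?_
    obtain ⟨y, -, rfl⟩ := mem_map.1 hx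
    exact y.2
  obtain ⟨f, hf, hfm⟩ := (Finset.all_card_le_biUnion_card_iff_exists_injective nb').1 hall
  let T : Finset A := univ.filter fun x => (f x).isLeft
  let g : α → β := fun x => if hx : x ∈ A then (f ⟨x, hx⟩).elim id (fun _ => Classical.arbitrary β)
    else Classical.arbitrary β
  have hg : ∀ x ∈ T, f x = Sum.inl (g x) := by
    rintro ⟨x, hxA⟩ hx
    obtain ⟨y, hy⟩ := Sum.isLeft_iff.1 (mem_filter.1 hx).2
    simp [g, hxA, hy]
  refine ⟨T.map (Function.Embedding.subtype _), g, ?_, ?_, ?_, ?_⟩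
  · intro x hx
    obtain ⟨y, -, rfl⟩ := mem_map.1 hx
    exact y.2
  · rw [card_map]
    have h1 : #(univ.filter fun x : A => ¬ (f x).isLeft) ≤ k := by
      refine (Finset.card_le_card_of_injOn (t := (univ : Finset (Fin k)).map
        Function.Embedding.inr) f (fun x hx => ?_) hf.injOn).trans (by simp)
      have := (mem_filter.1 hx).2
      rcases hfx : f x with y | y
      · simp [hfx] at this
      · simp
    have h2 := card_filter_add_card_filter_not (s := (univ : Finset A)) (fun x => (f x).isLeft)
    rw [card_univ, Fintype.card_coe] at h2
    simp only [T]
    omega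
  · intro x hx y hy hxy
    simp only [coe_map, Set.mem_image, mem_coe] at hx hy
    obtain ⟨x, hx, rfl⟩ := hx
    obtain ⟨y, hy, rfl⟩ := hy
    have : f x = f y := by rw [hg x hx, hg y hy]; exact congrArg _ hxy
    rw [hf this]
  · intro x hx
    obtain ⟨y, hy, rfl⟩ := mem_map.1 hx
    have := hfm y
    rw [hg y hy] at this
    simpa [nb'] using this

/-! ### Parity -/

/-- More than |H| vectors over the field with two elements are dependent. A dependency is a nonempty
subfamily of sum zero, which can be dropped without changing the total. -/
theorem exists_subset_card_le_sum_eq {E H : Type*} [Fintype H] [DecidableEq E]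
    (s : Finset E) (f : E → H → ZMod 2) :
    ∃ r ⊆ s, #r ≤ Fintype.card H ∧ ∑ e ∈ r, f e = ∑ e ∈ s, f e := by
  induction s using Finset.strongInduction with
  | H s ih =>
  by_cases hs : #s ≤ Fintype.card H
  · exact ⟨s, subset_rfl, hs, rfl⟩
  have hdep : ¬ LinearIndependent (ZMod 2) (fun e : s => f e) := by
    intro hli
    have := hli.fintype_card_le_finrank
    rw [Module.finrank_fintype_fun_eq_card, Fintype.card_coe] at this
    exact hs this
  obtain ⟨g, hg, x, hgx⟩ := Fintype.not_linearIndependent_iff.1 hdep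
  have key : ∀ z : ZMod 2, z = 0 ∨ z = 1 := by decide
  let g' : E → ZMod 2 := fun e => if he : e ∈ s then g ⟨e, he⟩ else 0
  have hsum : ∑ e ∈ s.filter (fun e => g' e ≠ 0), f e = 0 := by
    rw [← hg, Finset.sum_filter, ← Finset.sum_coe_sort s]
    refine Finset.sum_congr rfl fun e _ => ?_
    have : g' e = g e := by simp [g']
    rw [this]
    rcases key (g e) with h | h <;> simp [h]
  obtain ⟨r, hr, hrc, hrs⟩ := ih (s.filter fun e => ¬ g' e ≠ 0) (by
    refine filter_ssubset.2 ⟨x, x.2, ?_⟩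
    simp [g', hgx])
  refine ⟨r, hr.trans (filter_subset _ _), hrc, ?_⟩
  rw [hrs, ← Finset.sum_filter_add_sum_filter_not s (fun e => g' e ≠ 0), hsum, zero_add]

/-! ### Pairing up an even set -/

theorem exists_involution_of_even {α : Type*} [DecidableEq α] (s : Finset α) (hs : Even #s) :
    ∃ τ : α → α, ∀ x ∈ s, τ x ∈ s ∧ τ x ≠ x ∧ τ (τ x) = x := by
  induction s using Finset.strongInduction with
  | H s ih =>
  rcases s.eq_empty_or_nonempty with rfl | ⟨a, ha⟩
  · exact ⟨id, by simp⟩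
  have hcard : 1 < #s := by
    have : 0 < #s := card_pos.2 ⟨a, ha⟩
    rcases hs with ⟨m, hm⟩
    omega
  obtain ⟨b, hb, hba⟩ := exists_mem_ne hcard a
  have hb' : b ∈ s.erase a := mem_erase.2 ⟨hba, hb⟩
  obtain ⟨τ, hτ⟩ := ih ((s.erase a).erase b)
    ((erase_subset _ _).trans_ssubset (erase_ssubset ha)) (by
      rw [card_erase_of_mem hb', card_erase_of_mem ha]
      rcases hs with ⟨m, hm⟩
      exact ⟨m - 1, by omega⟩)
  refine ⟨fun x => if x = a then b else if x = b then a else τ x, fun x hx => ?_⟩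
  by_cases hxa : x = a
  · subst hxa; simp [hb, hba]
  by_cases hxb : x = b
  · subst hxb; simp [ha, hba, Ne.symm hba]
  have h := hτ x (by simp [hxa, hxb, hx])
  simp only [mem_erase] at h
  simp [hxa, hxb, h.1.1, h.1.2.1, h.1.2.2, h.2.1, h.2.2]

/-! ### Degrees into a set and edge expansion -/

open Classical in
/-- The indicator function of adjacency, with real values. -/
noncomputable def adjInd {V : Type*} (G : SimpleGraph V) (v u : V) : ℝ := if G.Adj v u then 1 else 0

/-- The number of neighbours of `v` in `T`, as a real number. -/
noncomputable def degIn {V : Type*} (G : SimpleGraph V) (T : Finset V) (v : V) : ℝ :=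
  ∑ u ∈ T, adjInd G v u

section Degrees

variable {V : Type*} (G : SimpleGraph V)

theorem adjInd_comm (v u : V) : adjInd G v u = adjInd G u v := by
  unfold adjInd; rw [G.adj_comm]

theorem adjInd_nonneg (v u : V) : 0 ≤ adjInd G v u := by
  unfold adjInd; split_ifs <;> norm_num

theorem adjInd_le_one (v u : V) : adjInd G v u ≤ 1 := by
  unfold adjInd; split_ifs <;> norm_num

theorem adjInd_self (v : V) : adjInd G v v = 0 := by simp [adjInd]

variable {G} in
theorem adjInd_of_not_adj {v u : V} (h : ¬ G.Adj v u) : adjInd G v u = 0 := by simp [adjInd, h]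

theorem adjInd_sq (v u : V) : adjInd G v u ^ 2 = adjInd G v u := by
  unfold adjInd; split_ifs <;> norm_num

theorem degIn_nonneg (T : Finset V) (v : V) : 0 ≤ degIn G T v :=
  Finset.sum_nonneg fun u _ => adjInd_nonneg G v u

theorem degIn_mono {S T : Finset V} (h : S ⊆ T) (v : V) : degIn G S v ≤ degIn G T v :=
  Finset.sum_le_sum_of_subset_of_nonneg h fun u _ _ => adjInd_nonneg G v u

theorem degIn_le_card (T : Finset V) (v : V) : degIn G T v ≤ #T := by
  have := Finset.sum_le_sum fun u (_ : u ∈ T) => adjInd_le_one G v u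
  simpa [degIn] using this

theorem degIn_union_le [DecidableEq V] (S T : Finset V) (v : V) :
    degIn G (S ∪ T) v ≤ degIn G S v + degIn G T v := by
  have h := Finset.sum_union_inter (s₁ := S) (s₂ := T) (f := adjInd G v)
  have h2 := degIn_nonneg G (S ∩ T) v
  unfold degIn at *
  linarith

theorem degIn_union [DecidableEq V] {S T : Finset V} (h : Disjoint S T) (v : V) :
    degIn G (S ∪ T) v = degIn G S v + degIn G T v :=
  Finset.sum_union h

theorem sum_degIn_comm (S T : Finset V) :
    ∑ v ∈ S, degIn G T v = ∑ v ∈ T, degIn G S v := by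
  unfold degIn
  rw [Finset.sum_comm]
  simp_rw [adjInd_comm]

open Classical in
theorem degIn_eq_card (T : Finset V) (v : V) : degIn G T v = #(T.filter (G.Adj v)) := by
  simp [degIn, adjInd]

end Degrees

/-- Every set `S ⊆ U` with at most half of all vertices sends at least `c * |S|` edges to
the rest of `U`. -/
def ExpandsIn {V : Type*} [Fintype V] [DecidableEq V] (G : SimpleGraph V) (U : Finset V)
    (c : ℝ) : Prop :=
  ∀ S ⊆ U, 2 * #S ≤ Fintype.card V → c * #S ≤ ∑ v ∈ S, degIn G (U \ S) v

theorem sum_degIn_le {V : Type*} [Fintype V] {G : SimpleGraph V} {d : ℝ}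
    (hd : ∀ v, degIn G univ v ≤ d) (S T : Finset V) :
    ∑ v ∈ S, degIn G T v ≤ d * #S := by
  calc ∑ v ∈ S, degIn G T v ≤ ∑ v ∈ S, d :=
        Finset.sum_le_sum fun v _ => (degIn_mono G (subset_univ T) v).trans (hd v)
    _ = d * #S := by simp [mul_comm]

/-! ### Expansion survives the deletion of a small set. -/

section Prune

variable {V : Type*} [Fintype V] [DecidableEq V] {G : SimpleGraph V} {c d : ℝ}

theorem ExpandsIn.le_degIn {U : Finset V} (h : ExpandsIn G U c) (hN : 2 ≤ Fintype.card V)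
    {v : V} (hv : v ∈ U) : c ≤ degIn G U v := by
  have := h {v} (by simpa using hv) (by simpa using hN)
  simp only [card_singleton, Nat.cast_one, mul_one, sum_singleton] at this
  exact this.trans (degIn_mono G sdiff_subset v)

/-- After deleting a small set from an expander, a large expanding part remains. -/
theorem exists_expandsIn_disjoint (hc : 0 < c) (hcd : c ≤ d) (hd : ∀ v, degIn G univ v ≤ d)
    (hexp : ExpandsIn G univ c) (Q : Finset V)
    (hQ : 18 * d ^ 2 * #Q ≤ c ^ 2 * Fintype.card V) :
    ∃ U : Finset V, Disjoint U Q ∧ c * #Uᶜ ≤ 3 * d * #Q ∧ ExpandsIn G U (c / 2) := by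
  classical
  have hd0 : 0 < d := hc.trans_le hcd
  -- `Z` is a largest set violating expansion outside `Q`. As `Z` expands in the whole graph, most
  -- of its outgoing edges end in `Q`, so `Z` is small. A violating set `S` in the complement of `Q
  -- ∪ Z` could be added to `Z`.
  let 𝒵 : Finset (Finset V) := univ.filter fun Z => Disjoint Z Q ∧ 2 * #Z ≤ Fintype.card V ∧
    ∑ v ∈ Z, degIn G (Q ∪ Z)ᶜ v ≤ c / 2 * #Z
  have h𝒵 : (∅ : Finset V) ∈ 𝒵 := by simp [𝒵]
  obtain ⟨Z, hZ, hmax⟩ := exists_max_image 𝒵 card ⟨_, h𝒵⟩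
  simp only [𝒵, mem_filter, mem_univ, true_and] at hZ hmax
  obtain ⟨hZQ, hZN, hZe⟩ := hZ
  have hZc : c * #Z ≤ 2 * d * #Q := by
    have h1 := hexp Z (subset_univ _) hZN
    have h2 : ∑ v ∈ Z, degIn G (univ \ Z) v
        ≤ ∑ v ∈ Z, (degIn G (Q ∪ Z)ᶜ v + degIn G Q v) := by
      refine Finset.sum_le_sum fun v _ => (degIn_mono G ?_ v).trans (degIn_union_le G _ _ v)
      intro x hx
      simp only [mem_sdiff, mem_univ, true_and] at hx
      by_cases hxQ : x ∈ Q <;> simp [hx, hxQ]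
    rw [Finset.sum_add_distrib, sum_degIn_comm G Z Q] at h2
    have h3 := sum_degIn_le hd Q Z
    linarith
  have hUc : c * #(Q ∪ Z) ≤ 3 * d * #Q := by
    have h1 : (#(Q ∪ Z) : ℝ) ≤ #Q + #Z := by exact_mod_cast card_union_le Q Z
    have h2 : c * #Q ≤ d * #Q := by gcongr
    nlinarith
  refine ⟨(Q ∪ Z)ᶜ, ?_, by rwa [compl_compl], ?_⟩
  · rw [disjoint_left]
    intro x hx hxQ
    simp [hxQ] at hx
  intro S hS hSN
  by_contra! hlt
  by_cases hsmall : 2 * (#S + #Z) ≤ Fintype.card V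
  · have hSQ : Disjoint S Q := by
      rw [disjoint_left]; intro x hx hxQ
      have := hS hx
      simp [hxQ] at this
    have hSZ : Disjoint Z S := by
      rw [disjoint_left]; intro x hxZ hx
      have := hS hx
      simp [hxZ] at this
    have hcard : #(Z ∪ S) = #Z + #S := card_union_of_disjoint hSZ
    have h1 := hmax (Z ∪ S) ⟨disjoint_union_left.2 ⟨hZQ, hSQ⟩, by rw [hcard]; omega, by
      rw [Finset.sum_union hSZ, hcard]
      have h2 : ∑ v ∈ Z, degIn G (Q ∪ (Z ∪ S))ᶜ v ≤ ∑ v ∈ Z, degIn G (Q ∪ Z)ᶜ v :=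
        Finset.sum_le_sum fun v _ => degIn_mono G (by
          intro x hx; simp only [mem_compl, mem_union] at hx ⊢; tauto) v
      have h3 : ∑ v ∈ S, degIn G (Q ∪ (Z ∪ S))ᶜ v ≤ ∑ v ∈ S, degIn G ((Q ∪ Z)ᶜ \ S) v :=
        Finset.sum_le_sum fun v _ => degIn_mono G (by
          intro x hx; simp only [mem_compl, mem_union, mem_sdiff] at hx ⊢; tauto) v
      push_cast
      linarith⟩
    rw [hcard] at h1
    have hS0 : #S = 0 := by omega
    rw [card_eq_zero] at hS0
    subst hS0
    simp at hlt
  -- Here `Z ∪ S` exceeds half of all vertices and maximality says nothing. But expansion of `S`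
  -- gives |S| < 6d²|Q|/c², and |Z| ≤ 3d²|Q|/c². Doubling the sum produces the constant 18 of `hQ`.
  · have h1 := hexp S (subset_univ _) hSN
    have h2 : ∑ v ∈ S, degIn G (univ \ S) v
        ≤ ∑ v ∈ S, (degIn G ((Q ∪ Z)ᶜ \ S) v + degIn G (Q ∪ Z) v) := by
      refine Finset.sum_le_sum fun v _ => (degIn_mono G ?_ v).trans (degIn_union_le G _ _ v)
      intro x hx
      simp only [mem_sdiff, mem_univ, true_and] at hx
      by_cases hxQ : x ∈ Q ∪ Z
      · exact mem_union_right _ hxQ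
      · exact mem_union_left _ (by simp only [mem_sdiff, mem_compl]; exact ⟨hxQ, hx⟩)
    rw [Finset.sum_add_distrib, sum_degIn_comm G S (Q ∪ Z)] at h2
    have h3 := sum_degIn_le hd (Q ∪ Z) S
    have h4 : (Fintype.card V : ℝ) < 2 * (#S + #Z) := by
      push Not at hsmall; exact_mod_cast hsmall
    have h5 : (#Z : ℝ) ≤ #(Q ∪ Z) := by exact_mod_cast card_le_card subset_union_right
    have h6 : c * #S < 2 * d * #(Q ∪ Z) := by linarith
    have h7 : c * c * #S < 6 * d ^ 2 * #Q := by
      nlinarith [mul_lt_mul_of_pos_left h6 hc, mul_le_mul_of_nonneg_left hUc hd0.le]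
    have h8 : c * c * #Z ≤ 3 * d ^ 2 * #Q := by
      have : c * (c * #Z) ≤ c * (3 * d * #Q) :=
        mul_le_mul_of_nonneg_left ((mul_le_mul_of_nonneg_left h5 hc.le).trans hUc) hc.le
      have h9 : c * (3 * d * #Q) ≤ d * (3 * d * #Q) := by gcongr
      nlinarith
    nlinarith [mul_lt_mul_of_pos_left h4 (mul_pos hc hc)]

end Prune

/-! ### Short paths in expanders -/

section Connect

variable {V : Type*} [DecidableEq V] {G : SimpleGraph V} {c d : ℝ}

open Classical in
/-- The vertices reached from `B` in at most `i` steps inside `T`. -/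
noncomputable def reach (G : SimpleGraph V) (T B : Finset V) : ℕ → Finset V
  | 0 => B
  | i + 1 => reach G T B i ∪ T.filter fun u => ∃ v ∈ reach G T B i, G.Adj v u

theorem reach_subset {T B : Finset V} (h : B ⊆ T) (i : ℕ) : reach G T B i ⊆ T := by
  classical
  induction i with
  | zero => exact h
  | succ i ih => exact union_subset ih (filter_subset _ _)

theorem exists_walk_of_mem_reach {T B : Finset V} {x : V} (hB : ∀ z ∈ B, G.Adj x z ∧ z ∈ T)
    (i : ℕ) : ∀ z ∈ reach G T B i,
      ∃ p : G.Walk x z, p.length ≤ i + 1 ∧ ∀ w ∈ p.support, w = x ∨ w ∈ T := by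
  classical
  induction i with
  | zero =>
    intro z hz
    refine ⟨(hB z hz).1.toWalk, by simp, ?_⟩
    intro w hw
    simp at hw
    rcases hw with rfl | rfl
    · exact Or.inl rfl
    · exact Or.inr (hB _ hz).2
  | succ i ih =>
    intro z hz
    rw [reach, mem_union, mem_filter] at hz
    rcases hz with hz | ⟨hzT, v, hv, hvz⟩
    · obtain ⟨p, hp, hs⟩ := ih z hz
      exact ⟨p, by omega, hs⟩
    · obtain ⟨p, hp, hs⟩ := ih v hv
      refine ⟨p.concat hvz, by simp; omega, fun w hw => ?_⟩
      rw [SimpleGraph.Walk.support_concat, List.mem_append] at hw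
      rcases hw with hw | hw
      · exact hs w hw
      · simp at hw
        subst hw
        exact Or.inr hzT

variable [Fintype V]

/-- While the ball has at most half of all vertices, it sends c times its size many edges into the
rest of `U`. At most d|R| ≤ c|B|/2 of them are lost to `R`, and each new vertex receives at most d.
Hence the growth factor 1 + c/(2d). -/
theorem card_reach {U R B : Finset V} (hc : 0 < c) (hd0 : 0 < d) (hd : ∀ v, degIn G univ v ≤ d)
    (hexp : ExpandsIn G U c) (hB : B ⊆ U \ R) (hR : 2 * d * #R ≤ c * #B) (i : ℕ)
    (hi : 2 * #(reach G (U \ R) B i) ≤ Fintype.card V) :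
    (1 + c / (2 * d)) ^ i * #B ≤ #(reach G (U \ R) B i) ∧ #B ≤ #(reach G (U \ R) B i) ∧
    (1 + c / (2 * d)) ^ (i + 1) * #B ≤ #(reach G (U \ R) B (i + 1)) := by
  classical
  have step : ∀ i, 2 * #(reach G (U \ R) B i) ≤ Fintype.card V → #B ≤ #(reach G (U \ R) B i) →
      (1 + c / (2 * d)) * #(reach G (U \ R) B i) ≤ #(reach G (U \ R) B (i + 1)) := by
    intro i hi hBi
    set S := reach G (U \ R) B i with hS
    set S' := reach G (U \ R) B (i + 1) with hS'
    have hSU : S ⊆ U := (reach_subset hB i).trans sdiff_subset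
    have hSS' : S ⊆ S' := subset_union_left
    have h1 := hexp S hSU hi
    have h2 : ∑ v ∈ S, degIn G (U \ S) v ≤ ∑ v ∈ S, (degIn G (S' \ S) v + degIn G R v) := by
      refine Finset.sum_le_sum fun v hv => ?_
      refine le_trans ?_ (degIn_union_le G _ _ v)
      unfold degIn
      have : ∑ u ∈ U \ S, adjInd G v u = ∑ u ∈ (U \ S).filter (fun u => G.Adj v u),
          adjInd G v u := by
        rw [Finset.sum_filter]
        refine Finset.sum_congr rfl fun u _ => ?_
        split_ifs with h
        · rfl
        · exact adjInd_of_not_adj h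
      rw [this]
      refine Finset.sum_le_sum_of_subset_of_nonneg ?_ fun u _ _ => adjInd_nonneg G v u
      intro u hu
      simp only [mem_filter, mem_sdiff] at hu
      rw [mem_union, mem_sdiff]
      by_cases huR : u ∈ R
      · exact Or.inr huR
      · refine Or.inl ⟨?_, hu.1.2⟩
        rw [hS', reach, mem_union, mem_filter]
        exact Or.inr ⟨mem_sdiff.2 ⟨hu.1.1, huR⟩, v, hv, hu.2⟩
    rw [Finset.sum_add_distrib, sum_degIn_comm G S R, sum_degIn_comm G S (S' \ S)] at h2
    have h3 := sum_degIn_le hd R S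
    have h4 := sum_degIn_le hd (S' \ S) S
    have h5 : (#(S' \ S) : ℝ) = #S' - #S := by
      rw [card_sdiff_of_subset hSS', Nat.cast_sub (card_le_card hSS')]
    have h6 : c * #B ≤ c * #S := by gcongr
    have h7 : c / 2 * #S ≤ d * (#S' - #S) := by rw [← h5]; linarith
    have h8 : (1 + c / (2 * d)) * #S = #S + c / 2 * #S / d := by field_simp
    rw [h8]
    have h9 : c / 2 * #S / d ≤ #S' - #S := by
      rw [div_le_iff₀ hd0]; linarith
    linarith
  have hpos : 0 ≤ 1 + c / (2 * d) := by positivity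
  have main : ∀ i, 2 * #(reach G (U \ R) B i) ≤ Fintype.card V →
      (1 + c / (2 * d)) ^ i * #B ≤ #(reach G (U \ R) B i) ∧ #B ≤ #(reach G (U \ R) B i) := by
    intro i
    induction i with
    | zero => intro _; simp [reach]
    | succ i ih =>
      intro hi
      have hsub : reach G (U \ R) B i ⊆ reach G (U \ R) B (i + 1) := subset_union_left
      have hi' := card_le_card hsub
      obtain ⟨h1, h2⟩ := ih (by omega)
      refine ⟨?_, h2.trans hi'⟩
      refine le_trans ?_ (step i (by omega) h2)
      rw [pow_succ']
      nlinarith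
  obtain ⟨h1, h2⟩ := main i hi
  refine ⟨h1, h2, le_trans ?_ (step i hi h2)⟩
  rw [pow_succ']
  nlinarith

/-- By Bernoulli's inequality `q` steps double the ball. If it were still at most half of the graph
after `q * l` steps, it would have at least `2 ^ l` vertices, a contradiction. -/
theorem card_lt_two_mul_card_reach {U R B : Finset V} (hc : 0 < c) (hd0 : 0 < d)
    (hd : ∀ v, degIn G univ v ≤ d) (hexp : ExpandsIn G U c) (hB : B ⊆ U \ R)
    (hR : 2 * d * #R ≤ c * #B) (hB0 : B.Nonempty) {q l : ℕ} (hq : 2 * d ≤ c * q)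
    (hl : Fintype.card V ≤ 2 ^ l) :
    Fintype.card V < 2 * #(reach G (U \ R) B (q * l)) := by
  by_contra! h
  obtain ⟨h1, -, -⟩ := card_reach hc hd0 hd hexp hB hR _ h
  have h2 : (2 : ℝ) ≤ (1 + c / (2 * d)) ^ q := by
    have h3 := one_add_mul_le_pow (a := c / (2 * d)) (by
      have : 0 ≤ c / (2 * d) := by positivity
      linarith) q
    have h4 : 1 ≤ (q : ℝ) * (c / (2 * d)) := by
      rw [mul_div_assoc', le_div_iff₀ (by positivity)]; linarith
    linarith
  have h3 : (2 : ℝ) ^ l ≤ (1 + c / (2 * d)) ^ (q * l) := by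
    rw [pow_mul]; gcongr
  have h4 : (1 : ℝ) ≤ #B := by exact_mod_cast card_pos.2 hB0
  have h5 : (Fintype.card V : ℝ) ≤ 2 ^ l := by exact_mod_cast hl
  have h6 : (2 : ℝ) * #(reach G (U \ R) B (q * l)) ≤ Fintype.card V := by exact_mod_cast h
  have h7 : (2 : ℝ) ^ l * 1 ≤ (1 + c / (2 * d)) ^ (q * l) * #B := by gcongr
  have h8 : (0 : ℝ) < 2 ^ l := by positivity
  linarith

/-- The balls grown from the neighbours of `x` and of `y` inside `U \ R` both exceed half of all
vertices, so they meet. The ends themselves may lie outside `U` or in `R`. -/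
theorem exists_short_path {U R : Finset V} (hc : 0 < c) (hcd : c ≤ d)
    (hd : ∀ v, degIn G univ v ≤ d) (hexp : ExpandsIn G U c) {q l : ℕ} (hq : 2 * d ≤ c * q)
    (hl : Fintype.card V ≤ 2 ^ l) (hR : 4 * d * #R ≤ c ^ 2) {x y : V}
    (hx : c ≤ degIn G U x) (hy : c ≤ degIn G U y) :
    ∃ p : G.Walk x y, p.IsPath ∧ p.length ≤ 2 * (q * l + 1) ∧
      ∀ z ∈ p.support, z = x ∨ z = y ∨ z ∈ U \ R := by
  classical
  have hd0 : 0 < d := hc.trans_le hcd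
  have hRc : 4 * (#R : ℝ) ≤ c := by
    have : d * (4 * #R) ≤ d * c := by nlinarith
    exact le_of_mul_le_mul_left this hd0
  have key : ∀ x : V, c ≤ degIn G U x → ∃ B : Finset V, (∀ z ∈ B, G.Adj x z ∧ z ∈ U \ R) ∧
      Fintype.card V < 2 * #(reach G (U \ R) B (q * l)) := by
    intro x hx
    set B := (U \ R).filter (G.Adj x) with hBdef
    have hBc : c / 2 ≤ #B := by
      have h1 : degIn G U x ≤ degIn G (U \ R) x + degIn G R x :=
        (degIn_mono G (by intro u hu; by_cases h : u ∈ R <;> simp [hu, h]) x).trans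
          (degIn_union_le G _ _ x)
      have h2 := degIn_le_card G R x
      have h3 : degIn G (U \ R) x = #B := degIn_eq_card G _ x
      linarith
    have hB0 : B.Nonempty := by
      rw [← card_pos]
      have : (0 : ℝ) < #B := by linarith
      exact_mod_cast this
    refine ⟨B, fun z hz => ⟨(mem_filter.1 hz).2, (mem_filter.1 hz).1⟩, ?_⟩
    exact card_lt_two_mul_card_reach hc hd0 hd hexp (filter_subset _ _) (by nlinarith) hB0 hq hl
  obtain ⟨B, hB, hBc⟩ := key x hx
  obtain ⟨B', hB', hBc'⟩ := key y hy
  have hne : ¬ Disjoint (reach G (U \ R) B (q * l)) (reach G (U \ R) B' (q * l)) := by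
    intro hdis
    have h1 := card_union_of_disjoint hdis
    have h2 := card_le_univ (reach G (U \ R) B (q * l) ∪ reach G (U \ R) B' (q * l))
    omega
  obtain ⟨z, hz, hz'⟩ := not_disjoint_iff.1 hne
  obtain ⟨p, hp, hps⟩ := exists_walk_of_mem_reach hB _ z hz
  obtain ⟨p', hp', hps'⟩ := exists_walk_of_mem_reach hB' _ z hz'
  refine ⟨(p.append p'.reverse).bypass, SimpleGraph.Walk.bypass_isPath _, ?_, ?_⟩
  · refine (SimpleGraph.Walk.length_bypass_le_length _).trans ?_
    simp
    omega
  · intro w hw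
    have := SimpleGraph.Walk.support_bypass_subset_support _ hw
    rw [SimpleGraph.Walk.mem_support_append_iff, SimpleGraph.Walk.support_reverse,
      List.mem_reverse] at this
    rcases this with h | h
    · rcases hps w h with h | h
      · exact Or.inl h
      · exact Or.inr (Or.inr h)
    · rcases hps' w h with h | h
      · exact Or.inr (Or.inl h)
      · exact Or.inr (Or.inr h)

/-- Prescribed vertices of an expander can be linked by internally disjoint short paths. -/
theorem exists_linkage {α : Type*} [DecidableEq α] {U : Finset V} (hc : 0 < c) (hcd : c ≤ d)
    (hd : ∀ v, degIn G univ v ≤ d) (hexp : ExpandsIn G U c) {q l : ℕ} (hq : 2 * d ≤ c * q)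
    (hl : Fintype.card V ≤ 2 ^ l) (P : Finset α) (b : α → V)
    (hbU : ∀ x ∈ P, c ≤ degIn G U (b x)) (E : Finset (Sym2 α)) (hE : ∀ e ∈ E, ∀ x ∈ e, x ∈ P)
    (hcard : 4 * d * (#P + #E * (2 * (q * l + 1) + 1)) ≤ c ^ 2) :
    ∃ A : Sym2 α → Finset V, (∀ e ∈ E, A e ⊆ U) ∧ (∀ e ∈ E, ∀ x ∈ P, b x ∉ A e) ∧
      (∀ e ∈ E, ∀ f ∈ E, e ≠ f → Disjoint (A e) (A f)) ∧
      (∀ e ∈ E, #(A e) ≤ 2 * (q * l + 1) + 1) ∧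
      ∀ u v, s(u, v) ∈ E → ∃ p : G.Walk (b u) (b v), p.IsPath ∧
        ∀ z, z ∈ p.support ↔ z = b u ∨ z = b v ∨ z ∈ A s(u, v) := by
  classical
  have hd0 : 0 < d := hc.trans_le hcd
  induction E using Finset.induction_on with
  | empty => exact ⟨fun _ => ∅, by simp⟩
  | insert e E he ih =>
    have hcast : ((#(insert e E) : ℕ) : ℝ) = #E + 1 := by
      rw [card_insert_of_notMem he]; push_cast; rfl
    rw [hcast] at hcard
    have hD : (0 : ℝ) ≤ 2 * (q * l + 1) + 1 := by positivity
    obtain ⟨A, hAU, hAb, hAd, hAc, hAp⟩ := ih (fun e he => hE e (mem_insert_of_mem he)) (by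
      refine le_trans ?_ hcard
      have : (#E : ℝ) ≤ #E + 1 := by linarith
      gcongr)
    -- Paths are added one at a time, each avoiding all prescribed vertices and all earlier
    -- interiors.
    set R : Finset V := P.image b ∪ E.biUnion A with hRdef
    have hRc : (#R : ℝ) ≤ #P + (#E + 1) * (2 * (q * l + 1) + 1) := by
      have h1 : #R ≤ #P + #E * (2 * (q * l + 1) + 1) :=
        (card_union_le _ _).trans (add_le_add card_image_le (card_biUnion_le_card_mul _ _ _ hAc))
      have h2 : (#R : ℝ) ≤ #P + #E * (2 * (q * l + 1) + 1) := by exact_mod_cast h1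
      linarith
    have hmain : ∃ X : Finset V, X ⊆ U \ R ∧ #X ≤ 2 * (q * l + 1) + 1 ∧
        ∀ u v, s(u, v) = e → ∃ p : G.Walk (b u) (b v), p.IsPath ∧
        ∀ z, z ∈ p.support ↔ z = b u ∨ z = b v ∨ z ∈ X := by
      induction e using Sym2.ind with
      | _ u v =>
      have hu := hE s(u, v) (mem_insert_self _ _) u (Sym2.mem_mk_left u v)
      have hv := hE s(u, v) (mem_insert_self _ _) v (Sym2.mem_mk_right u v)
      obtain ⟨p, hp, hpl, hps⟩ := exists_short_path hc hcd hd hexp hq hl (R := R) (by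
        refine le_trans ?_ hcard
        gcongr) (hbU u hu) (hbU v hv)
      have hpX : ∀ z, z ∈ p.support ↔ z = b u ∨ z = b v ∨ z ∈ p.support.toFinset ∩ (U \ R) := by
        intro z
        constructor
        · intro hz
          rcases hps z hz with h | h | h
          · exact Or.inl h
          · exact Or.inr (Or.inl h)
          · exact Or.inr (Or.inr (mem_inter.2 ⟨List.mem_toFinset.2 hz, h⟩))
        · rintro (rfl | rfl | h)
          · exact p.start_mem_support
          · exact p.end_mem_support
          · exact List.mem_toFinset.1 (mem_inter.1 h).1
      -- Both ends lie in `R`, so this set omits them. It serves either orientation of the pair.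
      refine ⟨p.support.toFinset ∩ (U \ R), inter_subset_right, ?_, ?_⟩
      · refine (card_le_card inter_subset_left).trans ((List.toFinset_card_le _).trans ?_)
        rw [SimpleGraph.Walk.length_support]; omega
      · intro u' v' h
        rw [Sym2.eq_iff] at h
        rcases h with ⟨rfl, rfl⟩ | ⟨rfl, rfl⟩
        · exact ⟨p, hp, hpX⟩
        · refine ⟨p.reverse, hp.reverse, fun z => ?_⟩
          rw [SimpleGraph.Walk.support_reverse, List.mem_reverse, hpX z]
          tauto
    obtain ⟨X, hXR, hXc, hXp⟩ := hmain
    have hA' : ∀ f ∈ E, Function.update A e X f = A f := fun f hf => by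
      rw [Function.update_of_ne]; rintro rfl; exact he hf
    have hAe : Function.update A e X e = X := Function.update_self ..
    have hXA : ∀ f ∈ E, Disjoint X (A f) := by
      intro f hf
      rw [disjoint_left]
      intro z hz hzf
      exact (mem_sdiff.1 (hXR hz)).2 (mem_union_right _ (mem_biUnion.2 ⟨f, hf, hzf⟩))
    refine ⟨Function.update A e X, ?_, ?_, ?_, ?_, ?_⟩
    · intro f hf
      rcases mem_insert.1 hf with rfl | hf
      · rw [hAe]; exact hXR.trans sdiff_subset
      · rw [hA' f hf]; exact hAU f hf
    · intro f hf x hx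
      rcases mem_insert.1 hf with rfl | hf
      · rw [hAe]; intro h
        exact (mem_sdiff.1 (hXR h)).2 (mem_union_left _ (mem_image_of_mem _ hx))
      · rw [hA' f hf]; exact hAb f hf x hx
    · intro f hf g hg hfg
      rcases mem_insert.1 hf with hfe | hf <;> rcases mem_insert.1 hg with hge | hg
      · exact absurd (hfe.trans hge.symm) hfg
      · rw [hfe, hAe, hA' g hg]; exact hXA g hg
      · rw [hge, hAe, hA' f hf]; exact (hXA f hf).symm
      · rw [hA' f hf, hA' g hg]; exact hAd f hf g hg hfg
    · intro f hf
      rcases mem_insert.1 hf with rfl | hf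
      · rw [hAe]; exact hXc
      · rw [hA' f hf]; exact hAc f hf
    · intro u v huv
      by_cases h : s(u, v) = e
      · obtain ⟨p, hp, hps⟩ := hXp u v h
        refine ⟨p, hp, fun z => ?_⟩
        rw [hps z, h, hAe]
      · have huv' : s(u, v) ∈ E := (mem_insert.1 huv).resolve_left h
        obtain ⟨p, hp, hps⟩ := hAp u v huv'
        refine ⟨p, hp, fun z => ?_⟩
        rw [hps z, hA' _ huv']

end Connect

/-! ### Systems of hubs -/

section Hubs

variable {V W : Type*}

/-- The pairs of distinct points over the same hub. -/
def hubPairs (I : Finset V) (hub : V → ℕ) : Set (Sym2 (V × W)) :=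
  {e | ∃ p q : V × W, e = s(p, q) ∧ p ≠ q ∧ p.1 ∈ I ∧ q.1 ∈ I ∧ hub p.1 = hub q.1}

/-- For every value of `hub`, the part of `I` with this value, times `W`, is the vertex set
of a complete graph a subdivision of which is placed in `G` by `b` (vertices) and `A` (interiors of
paths). The points `(v, w₀)` are placed at `v`; everything else lies in `Q`. -/
structure IsHubSystem (G : SimpleGraph V) (w₀ : W) (I : Finset V) (hub : V → ℕ) (b : V × W → V)
    (A : Sym2 (V × W) → Finset V) (Q : Finset V) : Prop where
  base : ∀ v ∈ I, b (v, w₀) = v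
  inj : Set.InjOn b {p | p.1 ∈ I}
  mem : ∀ p, p.1 ∈ I → p.2 ≠ w₀ → b p ∈ Q
  sub : ∀ e ∈ hubPairs I hub, A e ⊆ Q
  avoid : ∀ e ∈ hubPairs I hub, ∀ p, p.1 ∈ I → b p ∉ A e
  disj : ∀ e ∈ hubPairs I hub, ∀ f ∈ hubPairs I hub, e ≠ f → Disjoint (A e) (A f)
  path : ∀ p q, s(p, q) ∈ hubPairs I hub → ∃ w : G.Walk (b p) (b q), w.IsPath ∧
    ∀ z, z ∈ w.support ↔ z = b p ∨ z = b q ∨ z ∈ A s(p, q)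

theorem IsHubSystem.empty [Nonempty V] (G : SimpleGraph V) (w₀ : W) (hub : V → ℕ) :
    ∃ b A, IsHubSystem G w₀ ∅ hub b A ∅ := by
  have h : ∀ e : Sym2 (V × W), e ∉ hubPairs (∅ : Finset V) hub := by
    rintro e ⟨p, q, -, -, hp, -⟩
    simp at hp
  exact ⟨fun _ => Classical.arbitrary V, fun _ => ∅, by simp, by simp, by simp,
    fun e he => absurd he (h e), fun e he => absurd he (h e), fun e he => absurd he (h e),
    fun p q he => absurd he (h _)⟩

variable [DecidableEq V] [Fintype V] [Fintype W] [DecidableEq W] {G : SimpleGraph V} {c d : ℝ}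

theorem IsHubSystem.extend {w₀ : W} {I : Finset V} {hub : V → ℕ} {b : V × W → V}
    {A : Sym2 (V × W) → Finset V} {Q : Finset V} (h : IsHubSystem G w₀ I hub b A Q) {R : ℕ}
    (hhub : ∀ v ∈ I, hub v < R) {S X₀ U : Finset V} (hI : I ⊆ X₀) (hS : S ⊆ X₀)
    (hSI : Disjoint S I) (hQX : Disjoint Q X₀) (hUX : Disjoint U X₀) (hUQ : Disjoint U Q)
    (hc : 0 < c) (hcd : c ≤ d)
    (hd : ∀ v, degIn G univ v ≤ d) (hexp : ExpandsIn G U c) {q l : ℕ} (hq : 2 * d ≤ c * q)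
    (hl : Fintype.card V ≤ 2 ^ l) (hN : 2 ≤ Fintype.card V) (hSU : ∀ x ∈ S, c ≤ degIn G U x)
    (hUS : #S * Fintype.card W ≤ #U) {m : ℕ} (hm : m = #S * Fintype.card W)
    (hcard : 4 * d * (m + m ^ 2 * (2 * (q * l + 1) + 1)) ≤ c ^ 2) :
    ∃ b' A' Q', IsHubSystem G w₀ (I ∪ S) (fun v => if v ∈ S then R else hub v) b' A' Q' ∧
      Disjoint Q' X₀ ∧ #Q' ≤ #Q + (m + m ^ 2 * (2 * (q * l + 1) + 1)) := by
  classical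
  have hd0 : 0 < d := hc.trans_le hcd
  set P : Finset (V × W) := S ×ˢ univ with hP
  have hPm : #P = m := by rw [hP, card_product, card_univ, hm]
  obtain ⟨g, hg⟩ := Function.Embedding.exists_of_card_le_finset (α := P) (s := U)
    (by rw [Fintype.card_coe, hPm, hm]; exact hUS)
  -- The point `(v, w₀)` stays at `v`; all other points of the new hub go injectively to fresh
  -- vertices of `U`.
  let bn : V × W → V := fun p => if hp : p ∈ P ∧ p.2 ≠ w₀ then g ⟨p, hp.1⟩ else p.1
  have hbn0 : ∀ v, bn (v, w₀) = v := fun v => by simp [bn]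
  have hbn1 : ∀ p (hp : p ∈ P), p.2 ≠ w₀ → bn p = g ⟨p, hp⟩ := fun p hp hp2 => by
    simp [bn, hp, hp2]
  have hbnU : ∀ p, p ∈ P → p.2 ≠ w₀ → bn p ∈ U := fun p hp hp2 => by
    rw [hbn1 p hp hp2]; exact hg (Set.mem_range_self _)
  have hPS : ∀ p, p ∈ P ↔ p.1 ∈ S := fun p => by simp [hP]
  have hbnS : ∀ p, p.2 = w₀ → bn p = p.1 := by
    rintro ⟨v, w⟩ rfl; exact hbn0 v
  have hbninj : ∀ p ∈ P, ∀ p' ∈ P, bn p = bn p' → p = p' := by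
    intro p hp p' hp' hpp
    by_cases h1 : p.2 = w₀ <;> by_cases h2 : p'.2 = w₀
    · rw [hbnS p h1, hbnS p' h2] at hpp
      exact Prod.ext hpp (h1.trans h2.symm)
    · have h3 := hbnU p' hp' h2
      rw [← hpp, hbnS p h1] at h3
      exact absurd (hS ((hPS p).1 hp)) (disjoint_left.1 hUX h3)
    · have h3 := hbnU p hp h1
      rw [hpp, hbnS p' h2] at h3
      exact absurd (hS ((hPS p').1 hp')) (disjoint_left.1 hUX h3)
    · rw [hbn1 p hp h1, hbn1 p' hp' h2] at hpp
      exact congrArg Subtype.val (g.injective hpp)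
  set E : Finset (Sym2 (V × W)) := P.offDiag.image (fun x => s(x.1, x.2)) with hE
  have hEc : #E ≤ m ^ 2 := by
    refine card_image_le.trans ?_
    rw [offDiag_card, hPm, sq]; omega
  have hmemE : ∀ p q, s(p, q) ∈ E ↔ p ∈ P ∧ q ∈ P ∧ p ≠ q := by
    intro p q
    rw [hE, mem_image]
    constructor
    · rintro ⟨⟨x, y⟩, hxy, hh⟩
      rw [mem_offDiag] at hxy
      rw [Sym2.eq_iff] at hh
      rcases hh with ⟨h1, h2⟩ | ⟨h1, h2⟩
      · simp only at h1 h2 hxy; subst h1 h2; exact hxy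
      · simp only at h1 h2 hxy; subst h1 h2; exact ⟨hxy.2.1, hxy.1, hxy.2.2.symm⟩
    · intro hh
      exact ⟨(p, q), mem_offDiag.2 hh, rfl⟩
  obtain ⟨An, hAU, hAb, hAd, hAc, hAp⟩ := exists_linkage hc hcd hd hexp hq hl P bn
    (by
      intro p hp
      by_cases h1 : p.2 = w₀
      · rw [hbnS p h1]; exact hSU _ ((hPS p).1 hp)
      · exact hexp.le_degIn hN (hbnU p hp h1)) E
    (by
      intro e he x hx
      induction e using Sym2.ind with
      | _ u v =>
      rw [hmemE] at he
      rcases Sym2.mem_iff.1 hx with rfl | rfl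
      exacts [he.1, he.2.1])
    (by
      refine le_trans ?_ hcard
      have h1 : (#E : ℝ) ≤ m ^ 2 := by exact_mod_cast hEc
      rw [hPm]
      gcongr)
  set Q' : Finset V := Q ∪ ((P.filter fun p => p.2 ≠ w₀).image bn ∪ E.biUnion An) with hQ'
  have hnewU : (P.filter fun p => p.2 ≠ w₀).image bn ∪ E.biUnion An ⊆ U := by
    refine union_subset (fun x hx => ?_) (biUnion_subset.2 hAU)
    obtain ⟨p, hp, rfl⟩ := mem_image.1 hx
    rw [mem_filter] at hp
    exact hbnU p hp.1 hp.2
  let b' : V × W → V := fun p => if p.1 ∈ S then bn p else b p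
  let A' : Sym2 (V × W) → Finset V := fun e => if ∀ p ∈ e, p.1 ∈ S then An e else A e
  have hnS : ∀ v ∈ I, v ∉ S := fun v hv hvS => disjoint_left.1 hSI hvS hv
  -- Old hub numbers are below `R`, so a pair over one hub is either entirely new or entirely old.
  have hcase : ∀ e ∈ hubPairs (I ∪ S) (fun v => if v ∈ S then R else hub v),
      (e ∈ E ∧ A' e = An e ∧ ∀ p ∈ e, b' p = bn p) ∨
      (e ∈ hubPairs I hub ∧ A' e = A e ∧ ∀ p ∈ e, b' p = b p) := by
    rintro e ⟨p, q, rfl, hpq, hp, hq, hh⟩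
    replace hh : (if p.1 ∈ S then R else hub p.1) = if q.1 ∈ S then R else hub q.1 := hh
    by_cases hpS : p.1 ∈ S
    · have hqS : q.1 ∈ S := by
        by_contra hqS
        rw [if_pos hpS, if_neg hqS] at hh
        have := hhub q.1 ((mem_union.1 hq).resolve_right hqS)
        omega
      refine Or.inl ⟨(hmemE p q).2 ⟨(hPS p).2 hpS, (hPS q).2 hqS, hpq⟩, ?_, ?_⟩
      · refine if_pos fun r hr => ?_
        rcases Sym2.mem_iff.1 hr with rfl | rfl <;> assumption
      · intro r hr
        rcases Sym2.mem_iff.1 hr with rfl | rfl <;> simp [b', hpS, hqS]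
    · have hqS : q.1 ∉ S := by
        intro hqS
        rw [if_neg hpS, if_pos hqS] at hh
        have := hhub p.1 ((mem_union.1 hp).resolve_right hpS)
        omega
      rw [if_neg hpS, if_neg hqS] at hh
      refine Or.inr ⟨⟨p, q, rfl, hpq, (mem_union.1 hp).resolve_right hpS,
        (mem_union.1 hq).resolve_right hqS, hh⟩, ?_, ?_⟩
      · exact if_neg fun hr => hpS (hr p (Sym2.mem_mk_left _ _))
      · intro r hr
        rcases Sym2.mem_iff.1 hr with rfl | rfl <;> simp [b', hpS, hqS]
  have hb'S : ∀ p, p.1 ∈ S → b' p = bn p := fun p hp => by simp [b', hp]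
  have hb'I : ∀ p, p.1 ∈ I → b' p = b p := fun p hp => by simp [b', hnS _ hp]
  have hbold : ∀ p, p.1 ∈ I → b p ∈ Q ∨ b p ∈ I := by
    rintro ⟨v, w⟩ hv
    by_cases hw : w = w₀
    · subst hw; right; rw [h.base v hv]; exact hv
    · exact Or.inl (h.mem _ hv hw)
  have hbnew : ∀ p, p.1 ∈ S → bn p ∈ U ∨ bn p ∈ S := by
    intro p hp
    by_cases hw : p.2 = w₀
    · right; rw [hbnS p hw]; exact hp
    · exact Or.inl (hbnU p ((hPS p).2 hp) hw)
  have hno : ∀ x, (x ∈ U ∨ x ∈ S) → (x ∈ Q ∨ x ∈ I) → False := by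
    rintro x (hx | hx) (hx' | hx')
    · exact disjoint_left.1 hUQ hx hx'
    · exact disjoint_left.1 hUX hx (hI hx')
    · exact disjoint_left.1 hQX hx' (hS hx)
    · exact disjoint_left.1 hSI hx hx'
  refine ⟨b', A', Q', ⟨?_, ?_, ?_, ?_, ?_, ?_, ?_⟩, ?_, ?_⟩
  · intro v hv
    rcases mem_union.1 hv with hv | hv
    · rw [hb'I _ hv]; exact h.base v hv
    · rw [hb'S _ hv]; exact hbn0 v
  · intro p hp p' hp' hpp
    rcases mem_union.1 hp with hp | hp <;> rcases mem_union.1 hp' with hp' | hp'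
    · rw [hb'I _ hp, hb'I _ hp'] at hpp
      exact h.inj hp hp' hpp
    · rw [hb'I _ hp, hb'S _ hp'] at hpp
      exact (hno _ (hbnew p' hp') (hpp ▸ hbold p hp)).elim
    · rw [hb'S _ hp, hb'I _ hp'] at hpp
      exact (hno _ (hbnew p hp) (hpp ▸ hbold p' hp')).elim
    · rw [hb'S _ hp, hb'S _ hp'] at hpp
      exact hbninj p ((hPS p).2 hp) p' ((hPS p').2 hp') hpp
  · intro p hp hp2
    rcases mem_union.1 hp with hp | hp
    · rw [hb'I _ hp]; exact mem_union_left _ (h.mem p hp hp2)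
    · rw [hb'S _ hp]
      exact mem_union_right _ (mem_union_left _ (mem_image_of_mem _
        (mem_filter.2 ⟨(hPS p).2 hp, hp2⟩)))
  · intro e he
    rcases hcase e he with ⟨heE, hA, -⟩ | ⟨heI, hA, -⟩
    · rw [hA]
      exact fun x hx => mem_union_right _ (mem_union_right _ (mem_biUnion.2 ⟨e, heE, hx⟩))
    · rw [hA]
      exact (h.sub e heI).trans subset_union_left
  · intro e he p hp
    rcases hcase e he with ⟨heE, hA, -⟩ | ⟨heI, hA, -⟩ <;> rw [hA] <;>
      rcases mem_union.1 hp with hp | hp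
    · rw [hb'I _ hp]
      exact fun hx => hno _ (Or.inl (hAU e heE hx)) (hbold p hp)
    · rw [hb'S _ hp]; exact hAb e heE p ((hPS p).2 hp)
    · rw [hb'I _ hp]; exact h.avoid e heI p hp
    · rw [hb'S _ hp]
      exact fun hx => hno _ (hbnew p hp) (Or.inl (h.sub e heI hx))
  · intro e he f hf hef
    rcases hcase e he with ⟨heE, hA, -⟩ | ⟨heI, hA, -⟩ <;>
      rcases hcase f hf with ⟨hfE, hA', -⟩ | ⟨hfI, hA', -⟩ <;> rw [hA, hA']
    · exact hAd e heE f hfE hef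
    · exact disjoint_of_subset_left (hAU e heE) (disjoint_of_subset_right (h.sub f hfI) hUQ)
    · exact (disjoint_of_subset_left (hAU f hfE)
        (disjoint_of_subset_right (h.sub e heI) hUQ)).symm
    · exact h.disj e heI f hfI hef
  · intro p q he
    rcases hcase _ he with ⟨heE, hA, hb⟩ | ⟨heI, hA, hb⟩
    · rw [hA, hb p (Sym2.mem_mk_left _ _), hb q (Sym2.mem_mk_right _ _)]
      exact hAp p q heE
    · rw [hA, hb p (Sym2.mem_mk_left _ _), hb q (Sym2.mem_mk_right _ _)]
      exact h.path p q heI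
  · rw [hQ', disjoint_union_left]
    exact ⟨hQX, disjoint_of_subset_left hnewU hUX⟩
  · refine (card_union_le _ _).trans (Nat.add_le_add_left ((card_union_le _ _).trans ?_) _)
    refine add_le_add ?_ ?_
    · exact card_image_le.trans ((card_filter_le _ _).trans hPm.le)
    · exact (card_biUnion_le_card_mul _ _ _ hAc).trans (Nat.mul_le_mul_right _ hEc)

/-- In a large part of an expander a further hub can be built. -/
theorem IsHubSystem.exists_extend {w₀ : W} {I : Finset V} {hub : V → ℕ} {b : V × W → V}
    {A : Sym2 (V × W) → Finset V} {Q : Finset V} (h : IsHubSystem G w₀ I hub b A Q) {R : ℕ}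
    (hhub : ∀ v ∈ I, hub v < R) {X₀ Z : Finset V} (hI : I ⊆ X₀) (hZ : Z ⊆ X₀)
    (hQX : Disjoint Q X₀) (hc : 0 < c) (hcd : c ≤ d)
    (hd : ∀ v, degIn G univ v ≤ d) (hexp : ExpandsIn G univ c) {q l : ℕ} (hq : 4 * d ≤ c * q)
    (hl : Fintype.card V ≤ 2 ^ l) (hN : 2 ≤ Fintype.card V)
    {m B β κ : ℕ} (hm : m = B * Fintype.card W)
    (hcard : 16 * d * (m + m ^ 2 * (2 * (q * l + 1) + 1)) ≤ c ^ 2)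
    (hκ : 18 * d ^ 2 * κ ≤ c ^ 2 * Fintype.card V) (hQκ : #X₀ + #Q ≤ κ)
    (hbad : ∀ U, c * #Uᶜ ≤ 3 * d * κ → ∀ Z' ⊆ Z, (∀ x ∈ Z', degIn G U x < c / 2) → #Z' ≤ β)
    (hmN : c * m + 3 * d * κ ≤ c * Fintype.card V) (hZI : β + B ≤ #(Z \ I)) :
    ∃ S b' A' Q', S ⊆ Z \ I ∧ #S = B ∧
      IsHubSystem G w₀ (I ∪ S) (fun v => if v ∈ S then R else hub v) b' A' Q' ∧
      Disjoint Q' X₀ ∧ #Q' ≤ #Q + (m + m ^ 2 * (2 * (q * l + 1) + 1)) := by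
  classical
  have hd0 : 0 < d := hc.trans_le hcd
  have hcu : (#(Q ∪ X₀) : ℝ) ≤ κ := by
    exact_mod_cast (card_union_le _ _).trans ((Nat.add_comm _ _).trans_le hQκ)
  -- Remove everything reserved so far. The rest still expands at rate `c / 2`, and by `hbad` all
  -- but `β` vertices of `Z` keep enough neighbours there to serve as base vertices.
  obtain ⟨U, hUQ, hUc, hUexp⟩ := exists_expandsIn_disjoint hc hcd hd hexp (Q ∪ X₀) (by
    refine le_trans ?_ hκ; gcongr)
  have hUc' : c * #Uᶜ ≤ 3 * d * κ := hUc.trans (by gcongr)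
  rw [disjoint_union_right] at hUQ
  have hgood : B ≤ #((Z \ I).filter fun x => c / 2 ≤ degIn G U x) := by
    have h1 := card_filter_add_card_filter_not (s := Z \ I) (fun x => c / 2 ≤ degIn G U x)
    have h2 := hbad U hUc' ((Z \ I).filter fun x => ¬ c / 2 ≤ degIn G U x)
      ((filter_subset _ _).trans sdiff_subset) (fun x hx => not_le.1 (mem_filter.1 hx).2)
    omega
  obtain ⟨S, hS, hSB⟩ := exists_subset_card_eq hgood
  have hSZ : S ⊆ Z \ I := hS.trans (filter_subset _ _)
  have hmS : m = #S * Fintype.card W := by rw [hSB, hm]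
  have hUm : m ≤ #U := by
    have h1 : (#U : ℝ) + #Uᶜ = Fintype.card V := by exact_mod_cast card_add_card_compl U
    have h2 : c * m ≤ c * #U := by rw [← h1] at hmN; nlinarith
    exact_mod_cast le_of_mul_le_mul_left h2 hc
  obtain ⟨b', A', Q', h1, h2, h3⟩ := h.extend hhub hI (hSZ.trans (sdiff_subset.trans hZ))
    (disjoint_of_subset_left hSZ sdiff_disjoint) hQX hUQ.2 hUQ.1 (c := c / 2) (by positivity)
    (by linarith) hd hUexp (q := q) (by linarith) hl hN
    (fun x hx => (mem_filter.1 (hS hx)).2) (hmS ▸ hUm) hmS (by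
      have : (c / 2) ^ 2 = c ^ 2 / 4 := by ring
      rw [this]; linarith)
  exact ⟨S, b', A', Q', hSZ, hSB, h1, h2, h3⟩

/-- Almost all vertices of two given sets can be put into hubs. -/
theorem exists_isHubSystem (w₀ : W) {X Y : Finset V} (hc : 0 < c) (hcd : c ≤ d)
    (hd : ∀ v, degIn G univ v ≤ d) (hexp : ExpandsIn G univ c) {q l : ℕ} (hq : 4 * d ≤ c * q)
    (hl : Fintype.card V ≤ 2 ^ l) (hN : 2 ≤ Fintype.card V)
    {m B β κ r g : ℕ} (hm : m = B * Fintype.card W)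
    (hg : g = m + m ^ 2 * (2 * (q * l + 1) + 1)) (hcard : 16 * d * g ≤ c ^ 2)
    (hκ : 18 * d ^ 2 * κ ≤ c ^ 2 * Fintype.card V) (hQκ : #(X ∪ Y) + 2 * r * g ≤ κ)
    (hbad : ∀ U, c * #Uᶜ ≤ 3 * d * κ → ∀ Z, (Z ⊆ X ∨ Z ⊆ Y) →
      (∀ x ∈ Z, degIn G U x < c / 2) → #Z ≤ β)
    (hmN : c * m + 3 * d * κ ≤ c * Fintype.card V) (hX : r * B + β ≤ #X) (hY : r * B + β ≤ #Y)
    (hXY : Disjoint X Y) :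
    ∃ IX IY hub b A Q, IX ⊆ X ∧ IY ⊆ Y ∧ #IX = r * B ∧ #IY = r * B ∧
      IsHubSystem G w₀ (IX ∪ IY) hub b A Q ∧ Disjoint Q (X ∪ Y) ∧ #Q ≤ 2 * r * g ∧
      (∀ v ∈ IX, hub v < 2 * r ∧ Even (hub v)) ∧ (∀ v ∈ IY, hub v < 2 * r ∧ Odd (hub v)) := by
  classical
  have : Nonempty V := Fintype.card_pos_iff.1 (by omega)
  have hcard' : 16 * d * (m + m ^ 2 * (2 * (q * l + 1) + 1)) ≤ c ^ 2 := by
    refine le_trans (le_of_eq ?_) hcard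
    rw [hg]; push_cast; ring
  -- Hubs are built alternately, with number 2s in `X` and 2s + 1 in `Y`. The parity ensures that a
  -- path from `X` to `Y` never joins two vertices of one hub.
  suffices H : ∀ s ≤ r, ∃ IX IY hub b A Q, IX ⊆ X ∧ IY ⊆ Y ∧ #IX = s * B ∧ #IY = s * B ∧
      IsHubSystem G w₀ (IX ∪ IY) hub b A Q ∧ Disjoint Q (X ∪ Y) ∧ #Q ≤ 2 * s * g ∧
      (∀ v ∈ IX, hub v < 2 * s ∧ Even (hub v)) ∧ (∀ v ∈ IY, hub v < 2 * s ∧ Odd (hub v)) from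
    H r le_rfl
  intro s
  induction s with
  | zero =>
    intro _
    obtain ⟨b, A, h⟩ := IsHubSystem.empty G w₀ (fun _ : V => 0)
    exact ⟨∅, ∅, fun _ => 0, b, A, ∅, by simp, by simp, by simp, by simp, by simpa using h,
      by simp, by simp, by simp, by simp⟩
  | succ s ih =>
    intro hs
    obtain ⟨IX, IY, hub, b, A, Q, hIX, hIY, hIXc, hIYc, hsys, hQ, hQc, hhX, hhY⟩ := ih (by omega)
    have hsB : s * B + B ≤ r * B := by
      rw [← Nat.succ_mul]; exact Nat.mul_le_mul_right _ hs
    have hsg : 2 * s * g + 2 * g ≤ 2 * r * g := by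
      have : 2 * s * g + 2 * g = 2 * (s + 1) * g := by ring
      rw [this]; gcongr
    have hI0 : IX ∪ IY ⊆ X ∪ Y := union_subset_union hIX hIY
    have hcX : #(X \ (IX ∪ IY)) = #X - s * B := by
      have : X \ (IX ∪ IY) = X \ IX := by
        ext x; simp only [mem_sdiff, mem_union]
        constructor
        · rintro ⟨h1, h2⟩; exact ⟨h1, fun h => h2 (Or.inl h)⟩
        · rintro ⟨h1, h2⟩
          exact ⟨h1, fun h => h.elim h2 fun h => disjoint_left.1 hXY h1 (hIY h)⟩
      rw [this, card_sdiff_of_subset hIX, hIXc]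
    obtain ⟨S, b₁, A₁, Q₁, hS, hSB, hsys₁, hQ₁, hQc₁⟩ := hsys.exists_extend (R := 2 * s)
      (fun v hv => (mem_union.1 hv).elim (fun h => (hhX v h).1) fun h => (hhY v h).1)
      hI0 (subset_union_left (s₁ := X)) hQ hc hcd hd hexp hq hl hN hm hcard' (κ := κ) (β := β)
      hκ (by omega) (fun U hU Z hZ => hbad U hU Z (Or.inl hZ)) hmN (by omega)
    rw [← hg] at hQc₁
    have hSX : S ⊆ X := hS.trans sdiff_subset
    have hSI : ∀ v ∈ S, v ∉ IX ∧ v ∉ IY := fun v hv => by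
      have := (mem_sdiff.1 (hS hv)).2
      rw [mem_union, not_or] at this; exact this
    have hI1 : IX ∪ IY ∪ S ⊆ X ∪ Y := union_subset hI0 (hSX.trans subset_union_left)
    have hcY : #(Y \ (IX ∪ IY ∪ S)) = #Y - s * B := by
      have : Y \ (IX ∪ IY ∪ S) = Y \ IY := by
        ext x; simp only [mem_sdiff, mem_union]
        constructor
        · rintro ⟨h1, h2⟩; exact ⟨h1, fun h => h2 (Or.inl (Or.inr h))⟩
        · rintro ⟨h1, h2⟩
          exact ⟨h1, fun h => h.elim (fun h => h.elim (fun h => disjoint_left.1 hXY (hIX h) h1) h2)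
            fun h => disjoint_left.1 hXY (hSX h) h1⟩
      rw [this, card_sdiff_of_subset hIY, hIYc]
    obtain ⟨S', b₂, A₂, Q₂, hS', hSB', hsys₂, hQ₂, hQc₂⟩ := hsys₁.exists_extend (R := 2 * s + 1)
      (fun v hv => by
        show (if v ∈ S then 2 * s else hub v) < 2 * s + 1
        split_ifs with h
        · omega
        · rcases mem_union.1 ((mem_union.1 hv).resolve_right h) with h | h
          · have := (hhX v h).1; omega
          · have := (hhY v h).1; omega)
      hI1 (subset_union_right (s₂ := Y)) hQ₁ hc hcd hd hexp hq hl hN hm hcard' (κ := κ) (β := β)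
      hκ (by omega) (fun U hU Z hZ => hbad U hU Z (Or.inr hZ)) hmN (by omega)
    rw [← hg] at hQc₂
    have hSY : S' ⊆ Y := hS'.trans sdiff_subset
    have hSI' : ∀ v ∈ S', v ∉ IX ∧ v ∉ IY ∧ v ∉ S := fun v hv => by
      have := (mem_sdiff.1 (hS' hv)).2
      simp only [mem_union, not_or] at this; exact ⟨this.1.1, this.1.2, this.2⟩
    refine ⟨IX ∪ S, IY ∪ S', fun v => if v ∈ S' then 2 * s + 1 else if v ∈ S then 2 * s else hub v,
      b₂, A₂, Q₂, union_subset hIX hSX, union_subset hIY hSY, ?_, ?_,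
      ?_, hQ₂, ?_, ?_, ?_⟩
    · rw [card_union_of_disjoint (disjoint_left.2 fun v hv hvS => (hSI v hvS).1 hv), hIXc, hSB,
        Nat.succ_mul]
    · rw [card_union_of_disjoint (disjoint_left.2 fun v hv hvS => (hSI' v hvS).2.1 hv), hIYc, hSB',
        Nat.succ_mul]
    · convert hsys₂ using 1
      ext x; simp only [mem_union]; tauto
    · have : 2 * (s + 1) * g = 2 * s * g + 2 * g := by ring
      omega
    · intro v hv
      have hv' : v ∉ S' := fun h => by
        rcases mem_union.1 hv with hv | hv
        exacts [(hSI' v h).1 hv, (hSI' v h).2.2 hv]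
      simp only [if_neg hv']
      split_ifs with h
      · exact ⟨by omega, even_two_mul s⟩
      · have := hhX v ((mem_union.1 hv).resolve_right h)
        exact ⟨by omega, this.2⟩
    · intro v hv
      beta_reduce
      split_ifs with h h1
      · exact ⟨by omega, odd_two_mul_add_one s⟩
      · exact absurd h1 fun h1 => by
          have hvY := (mem_union.1 hv).resolve_right h
          exact (hSI v h1).2 hvY
      · have := hhY v ((mem_union.1 hv).resolve_right h)
        exact ⟨by omega, this.2⟩

end Hubs

/-! ### Weighted matchings between layers -/

section Weights

variable {V : Type*} {G : SimpleGraph V}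

/-- Hall's theorem for bipartite graphs with edge weights that are nearly regular on average. -/
theorem exists_injOn_of_weights [Nonempty V] (A B : Finset V) (ω : V → V → ℝ)
    (h0 : ∀ x u, 0 ≤ ω x u) (hω : ∀ x u, ¬ G.Adj x u → ω x u = 0) {a b : ℝ}
    (ha : ∑ x ∈ A, max 0 (1 - ∑ u ∈ B, ω x u) ≤ a)
    (hb : ∑ u ∈ B, max 0 (∑ x ∈ A, ω x u - 1) ≤ b) :
    ∃ (T : Finset V) (f : V → V), T ⊆ A ∧ (#A : ℝ) ≤ #T + (a + b) ∧ Set.InjOn f T ∧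
      ∀ x ∈ T, f x ∈ B ∧ G.Adj x (f x) := by
  classical
  have ha0 : 0 ≤ a := (Finset.sum_nonneg fun x _ => le_max_left _ _).trans ha
  have hb0 : 0 ≤ b := (Finset.sum_nonneg fun x _ => le_max_left _ _).trans hb
  obtain ⟨T, f, hTA, hc, hf, hfn⟩ := exists_injOn_of_card_le_add A
    (fun x => B.filter (G.Adj x)) ⌊a + b⌋₊ (by
    intro S hS
    set T := S.biUnion fun x => B.filter (G.Adj x) with hT
    have hTB : T ⊆ B := biUnion_subset.2 fun x _ => filter_subset _ _
    -- Double counting of weight: `S` sends at least |S| - a, all of it into its neighbourhood `T`,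
    -- which receives at most |T| + b.
    have h1 : (#S : ℝ) - a ≤ ∑ x ∈ S, ∑ u ∈ B, ω x u := by
      have h2 : ∑ x ∈ S, (1 - ∑ u ∈ B, ω x u) ≤ a := by
        refine le_trans (Finset.sum_le_sum fun x _ => le_max_right 0 _) (le_trans ?_ ha)
        exact Finset.sum_le_sum_of_subset_of_nonneg hS fun x _ _ => le_max_left _ _
      rw [Finset.sum_sub_distrib] at h2
      simp only [sum_const, nsmul_eq_mul, mul_one] at h2
      linarith
    have h2 : ∑ x ∈ S, ∑ u ∈ B, ω x u = ∑ x ∈ S, ∑ u ∈ T, ω x u := by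
      refine Finset.sum_congr rfl fun x hx => (Finset.sum_subset hTB fun u hu huT => ?_).symm
      refine hω x u fun hadj => huT ?_
      rw [hT, mem_biUnion]
      exact ⟨x, hx, mem_filter.2 ⟨hu, hadj⟩⟩
    have h3 : ∑ x ∈ S, ∑ u ∈ T, ω x u ≤ ∑ u ∈ T, ∑ x ∈ A, ω x u := by
      rw [Finset.sum_comm]
      exact Finset.sum_le_sum fun u _ => Finset.sum_le_sum_of_subset_of_nonneg hS
        fun x _ _ => h0 x u
    have h4 : ∑ u ∈ T, (∑ x ∈ A, ω x u - 1) ≤ b := by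
      refine le_trans (Finset.sum_le_sum fun x _ => le_max_right 0 _) (le_trans ?_ hb)
      exact Finset.sum_le_sum_of_subset_of_nonneg hTB fun x _ _ => le_max_left _ _
    rw [Finset.sum_sub_distrib] at h4
    simp only [sum_const, nsmul_eq_mul, mul_one] at h4
    have h5 : (#S : ℝ) - #T ≤ a + b := by linarith
    have h6 : ((#S - #T : ℕ) : ℝ) ≤ a + b := by
      rcases le_total #S #T with h | h
      · rw [Nat.sub_eq_zero_of_le h]; push_cast; linarith
      · rw [Nat.cast_sub h]; exact h5
    have := Nat.le_floor h6
    omega)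
  refine ⟨T, f, hTA, ?_, hf, fun x hx => mem_filter.1 (hfn x hx)⟩
  have h1 : (#A : ℝ) ≤ #T + (⌊a + b⌋₊ : ℝ) := by exact_mod_cast hc
  have h2 := Nat.floor_le (add_nonneg ha0 hb0)
  linarith

/-- The weight of the pair `x u` which makes a random subset of `T`, in which `u` is included with
probability proportional to its degree, regular on average. -/
noncomputable def pairWeight (G : SimpleGraph V) (T : Finset V) (t : ℕ) (d : ℝ) (x u : V) : ℝ :=
  t * d * adjInd G x u / (degIn G T x * degIn G T u)

theorem pairWeight_comm (T : Finset V) (t : ℕ) (d : ℝ) (x u : V) :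
    pairWeight G T t d x u = pairWeight G T t d u x := by
  unfold pairWeight; rw [adjInd_comm, mul_comm (degIn G T x)]

theorem pairWeight_nonneg (T : Finset V) (t : ℕ) {d : ℝ} (hd : 0 ≤ d) (x u : V) :
    0 ≤ pairWeight G T t d x u :=
  div_nonneg (mul_nonneg (by positivity) (adjInd_nonneg _ _ _))
    (mul_nonneg (degIn_nonneg _ _ _) (degIn_nonneg _ _ _))

theorem pairWeight_of_not_adj (T : Finset V) (t : ℕ) (d : ℝ) {x u : V} (h : ¬ G.Adj x u) :
    pairWeight G T t d x u = 0 := by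
  unfold pairWeight; rw [adjInd_of_not_adj h]; simp

/-- How far `Z` is from being seen in the same proportion by all vertices of `T`. -/
noncomputable def discrepancy (G : SimpleGraph V) (T : Finset V) (t : ℕ) (d : ℝ) (Z : Finset V) :
    ℝ :=
  ∑ v ∈ T, |∑ u ∈ Z, pairWeight G T t d v u - 1|

theorem discrepancy_nonneg (T : Finset V) (t : ℕ) (d : ℝ) (Z : Finset V) :
    0 ≤ discrepancy G T t d Z :=
  Finset.sum_nonneg fun _ _ => abs_nonneg _

/-- Multiplied by deg(v)/d and summed over `v` in `T`, the weights at each `u` in `Z` add up to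
exactly t. Thus t|Z| is an average of the quantities measured by the discrepancy, with coefficients
at most 1. -/
theorem abs_card_sub_le_discrepancy [Fintype V] {T Z : Finset V} {t : ℕ} {d : ℝ} (hd0 : 0 < d)
    (hd : ∀ v, degIn G univ v ≤ d) (hT : ∀ v ∈ T, 0 < degIn G T v) (hZ : Z ⊆ T) :
    |(t : ℝ) * #Z - ∑ v ∈ T, degIn G T v / d| ≤ discrepancy G T t d Z := by
  have h1 : (t : ℝ) * #Z = ∑ v ∈ T, degIn G T v / d * ∑ u ∈ Z, pairWeight G T t d v u := by
    simp_rw [Finset.mul_sum]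
    rw [Finset.sum_comm]
    have : ∀ u ∈ Z, ∑ v ∈ T, degIn G T v / d * pairWeight G T t d v u = t := by
      intro u hu
      have h2 : ∀ v ∈ T, degIn G T v / d * pairWeight G T t d v u
          = t / degIn G T u * adjInd G u v := by
        intro v hv
        have h3 := (hT v hv).ne'
        have h4 := (hT u (hZ hu)).ne'
        rw [pairWeight, adjInd_comm]
        field_simp
      rw [Finset.sum_congr rfl h2, ← Finset.mul_sum]
      exact div_mul_cancel₀ _ (hT u (hZ hu)).ne'
    rw [Finset.sum_congr rfl this]
    simp [mul_comm]
  rw [h1, ← Finset.sum_sub_distrib]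
  refine (Finset.abs_sum_le_sum_abs _ _).trans (Finset.sum_le_sum fun v hv => ?_)
  have h2 : degIn G T v / d * ∑ u ∈ Z, pairWeight G T t d v u - degIn G T v / d
      = degIn G T v / d * (∑ u ∈ Z, pairWeight G T t d v u - 1) := by ring
  rw [h2, abs_mul]
  have h3 : |degIn G T v / d| ≤ 1 := by
    rw [abs_of_nonneg (div_nonneg (hT v hv).le hd0.le), div_le_one hd0]
    exact (degIn_mono G (subset_univ T) v).trans (hd v)
  exact mul_le_of_le_one_left (abs_nonneg _) h3

/-- Both degrees are at most d, so every edge has weight at least t/d. -/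
theorem degIn_le_sum_pairWeight [Fintype V] {t : ℕ} {d : ℝ} (ht : 0 < t) (hd0 : 0 < d)
    (hd : ∀ v, degIn G univ v ≤ d) (hpos : ∀ v, 0 < degIn G univ v) (Z : Finset V) (v : V) :
    degIn G Z v ≤ d / t * ∑ u ∈ Z, pairWeight G univ t d v u := by
  rw [Finset.mul_sum]
  refine Finset.sum_le_sum fun u _ => ?_
  have ht' : (0 : ℝ) < t := by exact_mod_cast ht
  have h1 : d / t * pairWeight G univ t d v u
      = adjInd G v u * (d ^ 2 / (degIn G univ v * degIn G univ u)) := by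
    have := (hpos v).ne'
    have := (hpos u).ne'
    rw [pairWeight]; field_simp
  rw [h1]
  refine le_mul_of_one_le_right (adjInd_nonneg _ _ _) ?_
  rw [one_le_div (mul_pos (hpos v) (hpos u)), sq]
  exact mul_le_mul (hd v) (hd u) (hpos u).le hd0.le

theorem sum_degIn_le_discrepancy [Fintype V] {t : ℕ} {d : ℝ} (ht : 0 < t) (hd0 : 0 < d)
    (hd : ∀ v, degIn G univ v ≤ d) (hpos : ∀ v, 0 < degIn G univ v) (Z S : Finset V) :
    ∑ v ∈ S, degIn G Z v ≤ d / t * (#S + discrepancy G univ t d Z) := by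
  calc ∑ v ∈ S, degIn G Z v
      ≤ ∑ v ∈ S, d / t * (1 + |∑ u ∈ Z, pairWeight G univ t d v u - 1|) := by
        refine Finset.sum_le_sum fun v _ =>
          (degIn_le_sum_pairWeight ht hd0 hd hpos Z v).trans ?_
        have := le_abs_self (∑ u ∈ Z, pairWeight G univ t d v u - 1)
        gcongr
        linarith
    _ = d / t * (#S + ∑ v ∈ S, |∑ u ∈ Z, pairWeight G univ t d v u - 1|) := by
        rw [← Finset.mul_sum, Finset.sum_add_distrib]; simp
    _ ≤ _ := by
        gcongr
        exact Finset.sum_le_sum_of_subset_of_nonneg (subset_univ S) fun _ _ _ => abs_nonneg _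

/-- Few vertices of a well distributed set send many edges to a small set. -/
theorem card_le_of_degIn_lt [Fintype V] [DecidableEq V] {t : ℕ} {c d : ℝ} (ht : 0 < t)
    (hc : 0 < c)
    (hd0 : 0 < d) (hd : ∀ v, degIn G univ v ≤ d) (hcv : ∀ v, c ≤ degIn G univ v)
    {U Z Z' : Finset V} (hZ : Z' ⊆ Z) (h : ∀ x ∈ Z', degIn G U x < c / 2) :
    c / 2 * #Z' ≤ d / t * (#Uᶜ + discrepancy G univ t d Z) := by
  -- Each vertex of `Z'` has more than c/2 neighbours outside `U`. Counted from the other side, a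
  -- vertex outside `U` sees at most about d/t vertices of `Z`. This gain of a factor t keeps the
  -- unusable part of `X` and `Y` small.
  calc c / 2 * #Z' = ∑ x ∈ Z', c / 2 := by simp [mul_comm]
    _ ≤ ∑ x ∈ Z', degIn G Uᶜ x := by
        refine Finset.sum_le_sum fun x hx => ?_
        have h1 := degIn_union G (disjoint_compl_right (a := U)) x
        rw [union_compl] at h1
        have h2 := h x hx
        have h3 := hcv x
        linarith
    _ ≤ ∑ x ∈ Z, degIn G Uᶜ x :=
        Finset.sum_le_sum_of_subset_of_nonneg hZ fun x _ _ => degIn_nonneg _ _ _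
    _ = ∑ v ∈ Uᶜ, degIn G Z v := sum_degIn_comm G _ _
    _ ≤ _ := sum_degIn_le_discrepancy ht hd0 hd (fun v => hc.trans_le (hcv v)) _ _

/-- The proportion in which a random subset of `T` is expected to be seen from `x`. -/
noncomputable def expectedWeight [Fintype V] (G : SimpleGraph V) (T : Finset V) (x : V) : ℝ :=
  ∑ u ∈ T, adjInd G x u * degIn G T u / (degIn G univ x * degIn G univ u)

/-- Disjoint layers in `T` which are well distributed with respect to `T` and to another set. -/
theorem exists_layers [Fintype V] [DecidableEq V] {c d K : ℝ} {t : ℕ} (ht : 0 < t) (hc : 0 < c)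
    (hd0 : 0 < d) (hK : 0 < K) (hd : ∀ v, degIn G univ v ≤ d) (T X₀ : Finset V)
    (hTX : Disjoint T X₀) (hT : ∀ v ∈ T, c ≤ degIn G T v) (hX : ∀ v ∈ X₀, c ≤ degIn G univ v) :
    ∃ A : ℕ → Finset V, (∀ j, A j ⊆ T) ∧ (∀ i j, i ≠ j → Disjoint (A i) (A j)) ∧
      ∑ j ∈ range t, (discrepancy G T t d (A j) +
        ∑ x ∈ X₀, |∑ u ∈ A j, pairWeight G univ t d x u - expectedWeight G T x|)
      ≤ (K * (t ^ 2 * d / c ^ 2) + t / K) * Fintype.card V := by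
  classical
  have ht' : (0 : ℝ) < t := by exact_mod_cast ht
  -- Including `u` in a layer with probability deg_T(u)/(dt) cancels the factor of `u` in the
  -- weight. For `x` in `T` the mean becomes 1; for `x` in `X₀`, where degrees of the whole graph
  -- are used, it becomes `expectedWeight`.
  let ω : V → V → ℝ := fun x u =>
    if x ∈ T then pairWeight G T t d x u else pairWeight G univ t d x u
  have hdT : ∀ v, degIn G T v ≤ d := fun v => (degIn_mono G (subset_univ T) v).trans (hd v)
  have hu₀ : ∀ v ∈ T, c ≤ degIn G univ v := fun v hv =>
    (hT v hv).trans (degIn_mono G (subset_univ T) v)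
  obtain ⟨A, hAT, hAd, hA⟩ := exists_disjoint_sample (T ∪ X₀) T t ht (fun u => degIn G T u / d)
    (fun u _ => div_nonneg (degIn_nonneg _ _ _) hd0.le)
    (fun u _ => (div_le_one hd0).2 (hdT u)) ω
  refine ⟨A, hAT, hAd, ?_⟩
  have hvar : ∑ x ∈ T ∪ X₀, ∑ u ∈ T, degIn G T u / d * ω x u ^ 2
      ≤ t ^ 2 * d / c ^ 2 * Fintype.card V := by
    -- Variance at a single `x`; `D` stands for either of the two degree functions.
    have key : ∀ (D : V → ℝ), (∀ u ∈ T, degIn G T u ≤ D u) → ∀ x, c ≤ D x → degIn G T x ≤ D x →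
        ∑ u ∈ T, degIn G T u / d * (t * d * adjInd G x u / (D x * D u)) ^ 2
          ≤ t ^ 2 * d / c ^ 2 := by
      intro D hD x hx hx'
      have hDx : 0 < D x := hc.trans_le hx
      calc ∑ u ∈ T, degIn G T u / d * (t * d * adjInd G x u / (D x * D u)) ^ 2
          ≤ ∑ u ∈ T, t ^ 2 * d / (D x ^ 2 * c) * adjInd G x u := by
            refine Finset.sum_le_sum fun u hu => ?_
            have hcu := hT u hu
            have hDu : 0 < D u := hc.trans_le (hcu.trans (hD u hu))
            have h1 : degIn G T u / d * (t * d * adjInd G x u / (D x * D u)) ^ 2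
                = t ^ 2 * d / (D x ^ 2 * D u) * adjInd G x u * (degIn G T u / D u) := by
              rw [div_pow, mul_pow, mul_pow, adjInd_sq]; field_simp
            rw [h1]
            have h2 : degIn G T u / D u ≤ 1 := (div_le_one hDu).2 (hD u hu)
            have h3 : 0 ≤ t ^ 2 * d / (D x ^ 2 * D u) * adjInd G x u :=
              mul_nonneg (by positivity) (adjInd_nonneg _ _ _)
            refine (mul_le_of_le_one_right h3 h2).trans ?_
            have h4 := adjInd_nonneg G x u
            have h5 := hcu.trans (hD u hu)
            gcongr
        _ = t ^ 2 * d / (D x * c) * (degIn G T x / D x) := by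
            rw [← Finset.mul_sum, ← degIn]; field_simp
        _ ≤ t ^ 2 * d / (D x * c) := by
            refine mul_le_of_le_one_right (by positivity) ((div_le_one hDx).2 hx')
        _ ≤ t ^ 2 * d / c ^ 2 := by
            rw [sq c]; gcongr
    calc _ ≤ ∑ x ∈ T ∪ X₀, t ^ 2 * d / c ^ 2 := by
          refine Finset.sum_le_sum fun x hx => ?_
          by_cases hxT : x ∈ T
          · simp only [ω, if_pos hxT]
            exact key (degIn G T) (fun _ _ => le_rfl) x (hT x hxT) le_rfl
          · simp only [ω, if_neg hxT]
            exact key (degIn G univ) (fun u _ => degIn_mono G (subset_univ T) u) x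
              (hX x ((mem_union.1 hx).resolve_left hxT)) (degIn_mono G (subset_univ T) x)
      _ = #(T ∪ X₀) * (t ^ 2 * d / c ^ 2) := by simp
      _ ≤ _ := by
          rw [mul_comm]
          have : (#(T ∪ X₀) : ℝ) ≤ Fintype.card V := by exact_mod_cast card_le_univ _
          gcongr
  have hmean1 : ∀ x ∈ T, (∑ u ∈ T, degIn G T u / d * ω x u) / t = 1 := by
    intro x hx
    have hx0 := (hc.trans_le (hT x hx)).ne'
    have h1 : ∀ u ∈ T, degIn G T u / d * ω x u = t / degIn G T x * adjInd G x u := by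
      intro u hu
      have := (hc.trans_le (hT u hu)).ne'
      simp only [ω, if_pos hx, pairWeight]
      field_simp
    rw [Finset.sum_congr rfl h1, ← Finset.mul_sum, ← degIn]
    field_simp
  have hmean2 : ∀ x ∈ X₀, (∑ u ∈ T, degIn G T u / d * ω x u) / t = expectedWeight G T x := by
    intro x hx
    have hxT : x ∉ T := fun h => disjoint_left.1 hTX h hx
    rw [expectedWeight, Finset.sum_div]
    refine Finset.sum_congr rfl fun u hu => ?_
    have h1 := (hc.trans_le (hu₀ u hu)).ne'
    have h2 := (hc.trans_le (hX x hx)).ne'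
    simp only [ω, if_neg hxT, pairWeight]
    field_simp
  have hmain := sum_abs_le_of_sum_sq_le (range t ×ˢ (T ∪ X₀))
    (fun p => ∑ u ∈ A p.1, ω p.2 u - (∑ u ∈ T, degIn G T u / d * ω p.2 u) / t) hK
    (a := t ^ 2 * d / c ^ 2 * Fintype.card V) (by rw [Finset.sum_product]; exact hA.trans hvar)
  rw [Finset.sum_product] at hmain
  have hlhs : ∀ j, discrepancy G T t d (A j) +
        ∑ x ∈ X₀, |∑ u ∈ A j, pairWeight G univ t d x u - expectedWeight G T x|
      = ∑ x ∈ T ∪ X₀, |∑ u ∈ A j, ω x u - (∑ u ∈ T, degIn G T u / d * ω x u) / t| := by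
    intro j
    rw [Finset.sum_union hTX, discrepancy]
    congr 1
    · refine Finset.sum_congr rfl fun x hx => ?_
      rw [hmean1 x hx]; simp only [ω, if_pos hx]
    · refine Finset.sum_congr rfl fun x hx => ?_
      have hxT : x ∉ T := fun h => disjoint_left.1 hTX h hx
      rw [hmean2 x hx]; simp only [ω, if_neg hxT]
  simp_rw [hlhs]
  refine hmain.trans ?_
  rw [card_product, card_range]
  have : (#(T ∪ X₀) : ℝ) ≤ Fintype.card V := by exact_mod_cast card_le_univ _
  push_cast
  have h2 : (t : ℝ) * #(T ∪ X₀) / K ≤ t * Fintype.card V / K := by gcongr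
  have h3 : (K * (t ^ 2 * d / c ^ 2) + t / K) * (Fintype.card V : ℝ)
    = K * (t ^ 2 * d / c ^ 2 * Fintype.card V) + t * Fintype.card V / K := by ring
  linarith

end Weights

/-! ### Composing matchings -/

/-- A path is continued exactly if its current end is matched onwards. Ends are distinct, so each
step loses at most as many paths as the layer has unmatched vertices. -/
theorem exists_layered_paths {V : Type*} [DecidableEq V] {G : SimpleGraph V} (A : ℕ → Finset V)
    (M : ℕ → Finset V) (f : ℕ → V → V) (T : ℕ)
    (hdis : ∀ i ≤ T, ∀ j ≤ T, i ≠ j → Disjoint (A i) (A j))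
    (hf : ∀ j < T, Set.InjOn (f j) (M j)) (hM : ∀ j < T, M j ⊆ A j)
    (hfA : ∀ j < T, ∀ x ∈ M j, f j x ∈ A (j + 1) ∧ G.Adj x (f j x)) :
    ∃ (E : Finset V) (g : V → V) (L : V → Finset V), E ⊆ A 0 ∧
      (#(A 0) : ℝ) ≤ #E + ∑ j ∈ range T, ((#(A j) : ℝ) - #(M j)) ∧
      Set.InjOn g E ∧ (∀ x ∈ E, g x ∈ A T) ∧
      (∀ x ∈ E, ∃ p : G.Walk x (g x), p.IsPath ∧ p.length = T ∧ p.support.toFinset = L x) ∧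
      (∀ x ∈ E, ∀ y ∈ E, x ≠ y → Disjoint (L x) (L y)) ∧
      ∀ x ∈ E, ∀ z ∈ L x, z = x ∨ z = g x ∨ ∃ j, 0 < j ∧ j < T ∧ z ∈ A j := by
  induction T with
  | zero =>
    refine ⟨A 0, id, fun x => {x}, subset_rfl, by simp, Function.injective_id.injOn, by simp,
      fun x _ => ⟨.nil, by simp⟩, ?_, ?_⟩
    · intro x _ y _ hxy
      simpa using hxy
    · intro x _ z hz
      exact Or.inl (by simpa using hz)
  | succ T ih =>
    obtain ⟨E, g, L, hE, hcard, hg, hgT, hp, hL, hz⟩ := ih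
      (fun i hi j hj => hdis i (by omega) j (by omega)) (fun j hj => hf j (by omega))
      (fun j hj => hM j (by omega)) (fun j hj => hfA j (by omega))
    have hLlow : ∀ x ∈ E, ∀ z ∈ L x, ∃ j ≤ T, z ∈ A j := by
      intro x hx z hzL
      rcases hz x hx z hzL with rfl | rfl | ⟨j, -, hj, hzA⟩
      · exact ⟨0, by omega, hE hx⟩
      · exact ⟨T, le_rfl, hgT x hx⟩
      · exact ⟨j, hj.le, hzA⟩
    have hnew : ∀ x ∈ E, ∀ z ∈ L x, z ∉ A (T + 1) := by
      intro x hx z hzL hzA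
      obtain ⟨j, hj, hzj⟩ := hLlow x hx z hzL
      exact disjoint_left.1 (hdis j (by omega) (T + 1) le_rfl (by omega)) hzj hzA
    set E' := E.filter fun x => g x ∈ M T with hE'
    have hmem : ∀ x ∈ E', x ∈ E ∧ g x ∈ M T := fun x hx => mem_filter.1 hx
    refine ⟨E', fun x => f T (g x), fun x => insert (f T (g x)) (L x),
      (filter_subset _ _).trans hE, ?_, ?_, ?_, ?_, ?_, ?_⟩
    · rw [Finset.sum_range_succ]
      have h1 : #E' + #(E.filter fun x => ¬ g x ∈ M T) = #E :=
        card_filter_add_card_filter_not (s := E) (fun x => g x ∈ M T)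
      have h2 : #(E.filter fun x => ¬ g x ∈ M T) ≤ #(A T \ M T) := by
        refine card_le_card_of_injOn g (fun x hx => ?_)
          (hg.mono fun x hx => (mem_filter.1 hx).1)
        have := mem_filter.1 hx
        exact mem_coe.2 (mem_sdiff.2 ⟨hgT x this.1, this.2⟩)
      have h3 : (#(A T \ M T) : ℝ) = #(A T) - #(M T) := by
        rw [card_sdiff_of_subset (hM T (by omega)),
          Nat.cast_sub (card_le_card (hM T (by omega)))]
      have h4 : (#E : ℝ) ≤ #E' + #(A T \ M T) := by
        have : #E ≤ #E' + #(A T \ M T) := by omega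
        exact_mod_cast this
      linarith
    · intro x hx y hy hxy
      have hx' := hmem x hx
      have hy' := hmem y hy
      exact hg hx'.1 hy'.1 (hf T (by omega) hx'.2 hy'.2 hxy)
    · intro x hx
      exact (hfA T (by omega) _ (hmem x hx).2).1
    · intro x hx
      have hx' := hmem x hx
      obtain ⟨p, hpp, hpl, hps⟩ := hp x hx'.1
      have hadj := hfA T (by omega) _ hx'.2
      refine ⟨p.concat hadj.2, hpp.concat ?_ hadj.2, by simp [hpl], ?_⟩
      · intro hmem
        rw [← List.mem_toFinset, hps] at hmem
        exact hnew x hx'.1 _ hmem hadj.1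
      · rw [SimpleGraph.Walk.support_concat, List.toFinset_append, hps]
        ext z; simp
    · intro x hx y hy hxy
      have hx' := hmem x hx
      have hy' := hmem y hy
      rw [disjoint_insert_left, disjoint_insert_right]
      refine ⟨?_, ?_, hL x hx'.1 y hy'.1 hxy⟩
      · rw [mem_insert, not_or]
        refine ⟨fun h => hxy (hg hx'.1 hy'.1 (hf T (by omega) hx'.2 hy'.2 h)), fun h => ?_⟩
        exact hnew y hy'.1 _ h (hfA T (by omega) _ hx'.2).1
      · exact fun h => hnew x hx'.1 _ h (hfA T (by omega) _ hy'.2).1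
    · intro x hx z hzL
      have hx' := hmem x hx
      rcases mem_insert.1 hzL with rfl | hzL
      · exact Or.inr (Or.inl rfl)
      rcases hz x hx'.1 z hzL with rfl | rfl | ⟨j, hj0, hj, hzA⟩
      · exact Or.inl rfl
      -- For `T = 0` the old end is the start of the path rather than an inner vertex.
      · rcases Nat.eq_zero_or_pos T with rfl | hT
        · left
          obtain ⟨p, -, hpl, -⟩ := hp x hx'.1
          exact (SimpleGraph.Walk.eq_of_length_eq_zero hpl).symm
        · exact Or.inr (Or.inr ⟨T, hT, by omega, hgT x hx'.1⟩)
      · exact Or.inr (Or.inr ⟨j, hj0, by omega, hzA⟩)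

/-! ### Subdivisions described by the interiors of their paths -/

theorem isPath_append_of_disjoint {V : Type*} {G : SimpleGraph V} {x y z : V} {p : G.Walk x y}
    {q : G.Walk y z} (hp : p.IsPath) (hq : q.IsPath)
    (h : ∀ w ∈ p.support, w ∈ q.support → w = y) : (p.append q).IsPath := by
  rw [SimpleGraph.Walk.isPath_def, SimpleGraph.Walk.support_append, List.nodup_append]
  have hq' := (SimpleGraph.Walk.isPath_def q).1 hq
  rw [← SimpleGraph.Walk.cons_tail_support] at hq'
  refine ⟨(SimpleGraph.Walk.isPath_def p).1 hp, (List.nodup_cons.1 hq').2, ?_⟩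
  rintro a ha b hb rfl
  have := h a ha (List.mem_of_mem_tail hb)
  subst this
  exact (List.nodup_cons.1 hq').1 hb

/-- The set `S` is the vertex set of a subgraph of `G` which is a subdivision of `F`. -/
def HasSubdivisionOn {W V : Type*} (F : SimpleGraph W) (G : SimpleGraph V) (S : Set V) : Prop :=
  ∃ K : G.Subgraph, IsSubdivision F K ∧ K.verts = S

/-- Linkages supply interiors indexed by unordered pairs; consistently oriented paths are produced
from them here. -/
theorem hasSubdivisionOn_of_paths {W V : Type*} {F : SimpleGraph W} {G : SimpleGraph V}
    {b : W → V} (A : Sym2 W → Set V) (hb : Function.Injective b)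
    (hpath : ∀ u v, F.Adj u v → ∃ p : G.Walk (b u) (b v), p.IsPath ∧
      ∀ z, z ∈ p.support ↔ z = b u ∨ z = b v ∨ z ∈ A s(u, v))
    (havoid : ∀ e ∈ F.edgeSet, ∀ w, b w ∉ A e)
    (hdisj : ∀ e ∈ F.edgeSet, ∀ f ∈ F.edgeSet, e ≠ f → Disjoint (A e) (A f)) :
    HasSubdivisionOn F G {z | z ∈ Set.range b ∨ ∃ e ∈ F.edgeSet, z ∈ A e} := by
  classical
  -- An arbitrary order selects one path per edge; the other orientation receives its reverse.
  let _ : LinearOrder W := linearOrderOfSTO WellOrderingRel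
  choose p hp hps using hpath
  let P : ∀ u v : W, F.Adj u v → G.Walk (b u) (b v) := fun u v h =>
    if u < v then p u v h else (p v u h.symm).reverse
  have hP : ∀ u v h, (P u v h).IsPath := by
    intro u v h
    simp only [P]
    split_ifs
    · exact hp u v h
    · exact (hp v u h.symm).reverse
  have hPs : ∀ u v h z, z ∈ (P u v h).support ↔ z = b u ∨ z = b v ∨ z ∈ A s(u, v) := by
    intro u v h z
    simp only [P]
    split_ifs
    · exact hps u v h z
    · rw [SimpleGraph.Walk.support_reverse, List.mem_reverse, hps v u h.symm z, Sym2.eq_swap]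
      tauto
  have hPr : ∀ u v h, P v u h.symm = (P u v h).reverse := by
    intro u v h
    simp only [P]
    rcases lt_trichotomy u v with hlt | rfl | hlt
    · rw [if_pos hlt, if_neg hlt.asymm]
    · exact absurd h (F.irrefl)
    · rw [if_neg hlt.asymm, if_pos hlt, SimpleGraph.Walk.reverse_reverse]
  let K : G.Subgraph :=
    { verts := {z | z ∈ Set.range b ∨ ∃ e ∈ F.edgeSet, z ∈ A e}
      Adj := fun x y => ∃ u v h, s(x, y) ∈ (P u v h).edges
      adj_sub := by
        rintro x y ⟨u, v, h, hxy⟩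
        exact SimpleGraph.Walk.adj_of_mem_edges _ hxy
      edge_vert := by
        rintro x y ⟨u, v, h, hxy⟩
        have := (hPs u v h x).1 (SimpleGraph.Walk.fst_mem_support_of_mem_edges _ hxy)
        rcases this with rfl | rfl | hx
        · exact Or.inl ⟨u, rfl⟩
        · exact Or.inl ⟨v, rfl⟩
        · exact Or.inr ⟨s(u, v), h, hx⟩
      symm := by
        refine ⟨?_⟩
        rintro x y ⟨u, v, h, hxy⟩
        exact ⟨u, v, h, by rwa [Sym2.eq_swap]⟩ }
  refine ⟨K, ⟨b, P, hb, hP, hPr, ?_, ?_, ?_, fun x y => Iff.rfl⟩, rfl⟩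
  · intro u v h w hw
    rcases (hPs u v h _).1 hw with hw | hw | hw
    · exact Or.inl (hb hw)
    · exact Or.inr (hb hw)
    · exact absurd hw (havoid _ h w)
  · intro u v h u' v' h' hne x hx hx'
    rcases (hPs u v h _).1 hx with rfl | rfl | hx
    · exact ⟨u, rfl⟩
    · exact ⟨v, rfl⟩
    rcases (hPs u' v' h' _).1 hx' with rfl | rfl | hx'
    · exact ⟨u', rfl⟩
    · exact ⟨v', rfl⟩
    exact absurd hx' (Set.disjoint_left.1 (hdisj _ h _ h' hne) hx)
  · intro x
    constructor
    · rintro (hx | ⟨e, he, hx⟩)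
      · exact Or.inl hx
      · induction e using Sym2.ind with
        | _ u v => exact Or.inr ⟨u, v, he, (hPs u v he x).2 (Or.inr (Or.inr hx))⟩
    · rintro (hx | ⟨u, v, h, hx⟩)
      · exact Or.inl hx
      · rcases (hPs u v h x).1 hx with rfl | rfl | hx
        · exact Or.inl ⟨u, rfl⟩
        · exact Or.inl ⟨v, rfl⟩
        · exact Or.inr ⟨s(u, v), h, hx⟩

theorem support_subset_of_adj {V : Type*} {C : SimpleGraph V} {J : Finset V}
    (hJ : ∀ x y, C.Adj x y → x ∈ J) {x y : V} (q : C.Walk x y) (hx : x ∈ J) :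
    ∀ z ∈ q.support, z ∈ J := by
  induction q with
  | nil => simpa using hx
  | cons h q ih =>
    intro z hz
    rw [SimpleGraph.Walk.support_cons, List.mem_cons] at hz
    rcases hz with rfl | hz
    · exact hx
    · exact ih (hJ _ _ h.symm) z hz

/-- A path in a graph which is subdivided in `G` gives a path in `G`. -/
theorem exists_path_lift {V : Type*} {C G : SimpleGraph V} (In : V → V → Finset V)
    (J : Finset V) (hJ : ∀ x y, C.Adj x y → x ∈ J)
    (hcomm : ∀ x y, C.Adj x y → In x y = In y x)
    (hpath : ∀ x y, C.Adj x y → ∃ p : G.Walk x y, p.IsPath ∧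
      ∀ z, z ∈ p.support ↔ z = x ∨ z = y ∨ z ∈ In x y)
    (havoid : ∀ x y, C.Adj x y → ∀ z ∈ J, z ∉ In x y)
    (hdisj : ∀ x y x' y', C.Adj x y → C.Adj x' y' → s(x, y) ≠ s(x', y') →
      Disjoint (In x y) (In x' y')) {x y : V} (q : C.Walk x y) (hq : q.IsPath) :
    ∃ p : G.Walk x y, p.IsPath ∧
      (∀ z ∈ p.support, z ∈ q.support ∨ ∃ a a', s(a, a') ∈ q.edges ∧ z ∈ In a a') ∧
      (∀ z ∈ q.support, z ∈ p.support) ∧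
      ∀ a a', s(a, a') ∈ q.edges → ∀ z ∈ In a a', z ∈ p.support := by
  induction q with
  | nil => exact ⟨.nil, by simp⟩
  | @cons u v w h q ih =>
    rw [SimpleGraph.Walk.cons_isPath_iff] at hq
    obtain ⟨p, hp, hp1, hp2, hp3⟩ := ih hq.1
    obtain ⟨r, hr, hrs⟩ := hpath u v h
    -- The path for the first edge meets the lifted rest only in `v`: `u` is not on `q`, and
    -- interiors of distinct edges are disjoint and avoid `J`.
    refine ⟨r.append p, isPath_append_of_disjoint hr hp ?_, ?_, ?_, ?_⟩
    · intro z hz hzp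
      rcases (hrs z).1 hz with rfl | rfl | hz
      · exfalso
        rcases hp1 z hzp with hzq | ⟨a, a', haa, hza⟩
        · exact hq.2 hzq
        · exact havoid a a' (SimpleGraph.Walk.adj_of_mem_edges _ haa) z (hJ _ _ h) hza
      · rfl
      · exfalso
        rcases hp1 z hzp with hzq | ⟨a, a', haa, hza⟩
        · have hzJ : z ∈ J := support_subset_of_adj hJ q (hJ _ _ h.symm) z hzq
          exact havoid u v h z hzJ hz
        · have hne : s(u, v) ≠ s(a, a') := by
            intro he
            rw [← he] at haa
            exact hq.2 (SimpleGraph.Walk.fst_mem_support_of_mem_edges _ haa)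
          exact disjoint_left.1 (hdisj u v a a' h (SimpleGraph.Walk.adj_of_mem_edges _ haa) hne)
            hz hza
    · intro z hz
      rw [SimpleGraph.Walk.mem_support_append_iff] at hz
      simp only [SimpleGraph.Walk.support_cons, SimpleGraph.Walk.edges_cons, List.mem_cons]
      rcases hz with hz | hz
      · rcases (hrs z).1 hz with rfl | rfl | hz
        · exact Or.inl (Or.inl rfl)
        · exact Or.inl (Or.inr q.start_mem_support)
        · exact Or.inr ⟨u, v, Or.inl rfl, hz⟩
      · rcases hp1 z hz with hz | ⟨a, a', haa, hza⟩
        · exact Or.inl (Or.inr hz)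
        · exact Or.inr ⟨a, a', Or.inr haa, hza⟩
    · intro z hz
      rw [SimpleGraph.Walk.mem_support_append_iff]
      rw [SimpleGraph.Walk.support_cons, List.mem_cons] at hz
      rcases hz with rfl | hz
      · exact Or.inl r.start_mem_support
      · exact Or.inr (hp2 z hz)
    · intro a a' haa z hz
      rw [SimpleGraph.Walk.edges_cons, List.mem_cons] at haa
      rw [SimpleGraph.Walk.mem_support_append_iff]
      rcases haa with haa | haa
      · rw [Sym2.eq_iff] at haa
        rcases haa with ⟨rfl, rfl⟩ | ⟨rfl, rfl⟩
        · exact Or.inl ((hrs z).2 (Or.inr (Or.inr hz)))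
        · rw [hcomm _ _ h.symm] at hz
          exact Or.inl ((hrs z).2 (Or.inr (Or.inr hz)))
      · exact Or.inr (hp3 a a' haa z hz)

/-! ### Cycles through hubs -/

/-- The graph on `J` in which every vertex is joined to its images under two involutions. -/
def involutionGraph {V : Type*} (J : Finset V) (ε τ : V → V) : SimpleGraph V where
  Adj x y := x ∈ J ∧ y ∈ J ∧ x ≠ y ∧ ((y = ε x ∨ y = τ x) ∨ (x = ε y ∨ x = τ y))
  symm := ⟨fun _ _ h => ⟨h.2.1, h.1, h.2.2.1.symm, h.2.2.2.symm⟩⟩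
  loopless := ⟨fun _ h => h.2.2.1 rfl⟩

section Involutions

variable {V : Type*} {J : Finset V} {ε τ : V → V}

theorem involutionGraph_adj (hε : ∀ x ∈ J, ε x ∈ J ∧ ε x ≠ x ∧ ε (ε x) = x)
    (hτ : ∀ x ∈ J, τ x ∈ J ∧ τ x ≠ x ∧ τ (τ x) = x) {x : V} (hx : x ∈ J) (y : V) :
    (involutionGraph J ε τ).Adj x y ↔ y = ε x ∨ y = τ x := by
  constructor
  · rintro ⟨-, hy, -, h | h | h⟩
    · exact h
    · left; rw [h]; exact (hε y hy).2.2.symm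
    · right; rw [h]; exact (hτ y hy).2.2.symm
  · rintro (rfl | rfl)
    · exact ⟨hx, (hε x hx).1, (hε x hx).2.1.symm, Or.inl (Or.inl rfl)⟩
    · exact ⟨hx, (hτ x hx).1, (hτ x hx).2.1.symm, Or.inl (Or.inr rfl)⟩

/-- Two fixed-point-free involutions that never agree make the graph 2-regular on `J`, so the
component of `i` is a cycle. Starting it with the step to `τ i` and removing that edge leaves a path
through the whole component, which keeps all edges given by `ε`. -/
theorem exists_path_of_involutions [Finite V] (hε : ∀ x ∈ J, ε x ∈ J ∧ ε x ≠ x ∧ ε (ε x) = x)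
    (hτ : ∀ x ∈ J, τ x ∈ J ∧ τ x ≠ x ∧ τ (τ x) = x) (hne : ∀ x ∈ J, ε x ≠ τ x)
    {i : V} (hi : i ∈ J) :
    ∃ q : (involutionGraph J ε τ).Walk (τ i) i, q.IsPath ∧
      (∀ x, (involutionGraph J ε τ).Reachable i x ↔ x ∈ q.support) ∧
      ∀ x ∈ q.support, s(x, ε x) ∈ q.edges := by
  set C := involutionGraph J ε τ with hC
  have hadj : ∀ x ∈ J, ∀ y, C.Adj x y ↔ y = ε x ∨ y = τ x := fun x hx y =>
    involutionGraph_adj hε hτ hx y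
  have hnb : ∀ x ∈ J, C.neighborSet x = {ε x, τ x} := by
    intro x hx; ext y; exact hadj x hx y
  have hcyc : C.IsCycles := by
    rintro x ⟨y, hy⟩
    have hx : x ∈ J := hy.1
    rw [hnb x hx, Set.ncard_pair (hne x hx)]
  obtain ⟨p, hp, hpv⟩ := hcyc.exists_cycle_toSubgraph_verts_eq_connectedComponentSupp
    (v := i) (c := C.connectedComponentMk i) rfl ⟨τ i, (hadj i hi _).2 (Or.inr rfl)⟩
  have hall : ∀ p : C.Walk i i, p.IsCycle → ∀ x ∈ p.support, ∀ y, C.Adj x y →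
      p.toSubgraph.Adj x y := by
    intro p hp x hx y hxy
    have h1 := hp.ncard_neighborSet_toSubgraph_eq_two hx
    have h2 : p.toSubgraph.neighborSet x = C.neighborSet x := by
      refine Set.eq_of_subset_of_ncard_le (p.toSubgraph.neighborSet_subset x) ?_ (Set.toFinite _)
      rw [h1, hcyc ⟨y, hxy⟩]
    have h3 : y ∈ p.toSubgraph.neighborSet x := by rw [h2]; exact hxy
    exact h3
  obtain ⟨p', hp', hsnd, hpv'⟩ := hp.exists_isCycle_snd_verts_eq
    (hall p hp i p.start_mem_support (τ i) ((hadj i hi _).2 (Or.inr rfl)))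
  rw [hpv] at hpv'
  have hsupp : ∀ x, C.Reachable i x ↔ x ∈ p'.support := by
    intro x
    rw [← SimpleGraph.Walk.mem_verts_toSubgraph, hpv', SimpleGraph.ConnectedComponent.mem_supp_iff,
      SimpleGraph.ConnectedComponent.eq, SimpleGraph.reachable_comm]
  cases p' with
  | nil => exact absurd hp' (by simp)
  | @cons _ v _ h q =>
    simp only [SimpleGraph.Walk.snd_cons] at hsnd
    subst hsnd
    have hq := (SimpleGraph.Walk.cons_isCycle_iff q h).1 hp'
    have hs : ∀ x, x ∈ (SimpleGraph.Walk.cons h q).support ↔ x ∈ q.support := by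
      intro x
      rw [SimpleGraph.Walk.support_cons, List.mem_cons]
      constructor
      · rintro (rfl | h)
        · exact q.end_mem_support
        · exact h
      · exact Or.inr
    refine ⟨q, hq.1, fun x => (hsupp x).trans (hs x), fun x hx => ?_⟩
    have hxJ : x ∈ J := support_subset_of_adj (C := C) (fun _ _ h => h.1) q h.2.1 x hx
    have h1 := hall _ hp' x ((hs x).2 hx) (ε x) ((hadj x hxJ _).2 (Or.inl rfl))
    rw [SimpleGraph.Walk.adj_toSubgraph_iff_mem_edges, SimpleGraph.Walk.edges_cons,
      List.mem_cons] at h1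
    refine h1.resolve_left fun h2 => ?_
    rw [Sym2.eq_iff] at h2
    rcases h2 with ⟨rfl, h2⟩ | ⟨rfl, h2⟩
    · exact hne _ hi h2
    · have h3 := (hε _ hxJ).2.2
      rw [h2] at h3
      exact hne _ hi h3

end Involutions

/-! ### Turning a cycle of hubs and long paths into one subdivision. -/

section Component

variable {V W : Type*} [Fintype V] {F : SimpleGraph W} {G : SimpleGraph V}

/-- A closed chain of hubs contains a subdivision of `F`. -/
theorem IsHubSystem.exists_hasSubdivisionOn {w₀ w₁ : W} (hF : F.Adj w₀ w₁) {I : Finset V}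
    {hub : V → ℕ} {b : V × W → V} {A : Sym2 (V × W) → Finset V} {Q : Finset V}
    (h : IsHubSystem G w₀ I hub b A Q) (hQI : Disjoint Q I) {J : Finset V} (hJI : J ⊆ I)
    {ε τ : V → V} (hε : ∀ x ∈ J, ε x ∈ J ∧ ε x ≠ x ∧ ε (ε x) = x)
    (hτ : ∀ x ∈ J, τ x ∈ J ∧ τ x ≠ x ∧ τ (τ x) = x) (hne : ∀ x ∈ J, ε x ≠ τ x)
    (hhub : ∀ x ∈ J, hub (τ x) = hub x) (L : V → Finset V) (hLε : ∀ x ∈ J, L (ε x) = L x)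
    (hLp : ∀ x ∈ J, ∃ p : G.Walk x (ε x), p.IsPath ∧
      ∀ z, z ∈ p.support ↔ z = x ∨ z = ε x ∨ z ∈ L x)
    (hLI : ∀ x ∈ J, Disjoint (L x) I) (hLQ : ∀ x ∈ J, Disjoint (L x) Q)
    (hLd : ∀ x ∈ J, ∀ y ∈ J, y ≠ x → y ≠ ε x → Disjoint (L x) (L y)) {i : V} (hi : i ∈ J) :
    ∃ S : Set V, HasSubdivisionOn F G S ∧
      (∀ x ∈ J, (involutionGraph J ε τ).Reachable i x → ↑(L x) ⊆ S) ∧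
      ∀ z ∈ S, (∃ x ∈ J, ∃ w, (involutionGraph J ε τ).Reachable i x ∧ z = b (x, w)) ∨
        (∃ x ∈ J, (involutionGraph J ε τ).Reachable i x ∧ z ∈ L x) ∨
        ∃ e ∈ hubPairs I hub, (∀ p ∈ e, (involutionGraph J ε τ).Reachable i p.1) ∧ z ∈ A e := by
  classical
  set C := involutionGraph J ε τ with hC
  have hadj : ∀ x ∈ J, ∀ y, C.Adj x y ↔ y = ε x ∨ y = τ x := fun x hx y =>
    involutionGraph_adj hε hτ hx y
  have hw : w₀ ≠ w₁ := hF.ne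
  obtain ⟨q, hq, hqr, hqε⟩ := exists_path_of_involutions hε hτ hne hi
  have hqJ : ∀ x ∈ q.support, x ∈ J :=
    support_subset_of_adj (C := C) (fun _ _ h => h.1) q (hτ i hi).1
  have hpair : ∀ x y, C.Adj x y → y ≠ ε x → s((x, w₀), (y, w₀)) ∈ hubPairs I hub ∧ y = τ x := by
    intro x y hxy hy
    have hx : x ∈ J := hxy.1
    have hy' := ((hadj x hx y).1 hxy).resolve_left hy
    refine ⟨⟨_, _, rfl, fun h => hxy.ne (congrArg Prod.fst h), hJI hx, hJI hxy.2.1, ?_⟩, hy'⟩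
    rw [hy']; exact (hhub x hx).symm
  -- An edge given by `ε` stands for a long path, one given by `τ` for the hub path between two base
  -- points.
  let In : V → V → Finset V := fun x y => if y = ε x then L x else A s((x, w₀), (y, w₀))
  have hInε : ∀ x, In x (ε x) = L x := fun x => if_pos rfl
  have hInn : ∀ x y, y ≠ ε x → In x y = A s((x, w₀), (y, w₀)) := fun x y h => if_neg h
  have hεsymm : ∀ x ∈ J, ∀ y, y = ε x → x = ε y := fun x hx y hy => by
    rw [hy, (hε x hx).2.2]
  obtain ⟨p, hp, hp1, hp2, hp3⟩ := exists_path_lift (C := C) (G := G) In J (fun _ _ h => h.1)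
    (by
      intro x y hxy
      by_cases hy : y = ε x
      · have hx' := hεsymm x hxy.1 y hy
        rw [hy, hInε]
        conv_rhs => rw [← hy, hx', ← hx']
        rw [show In y x = L y by rw [hx', ← hx']; conv_lhs => rw [hx']; exact hInε y]
        rw [hy]; exact (hLε x hxy.1).symm
      · have hx' : x ≠ ε y := fun hx' => hy (hεsymm y hxy.2.1 x hx')
        rw [hInn x y hy, hInn y x hx', Sym2.eq_swap])
    (by
      intro x y hxy
      by_cases hy : y = ε x
      · subst hy
        rw [hInε]; exact hLp x hxy.1
      · obtain ⟨he, -⟩ := hpair x y hxy hy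
        rw [hInn x y hy]
        have := h.path _ _ he
        rwa [h.base x (hJI hxy.1), h.base y (hJI hxy.2.1)] at this)
    (by
      intro x y hxy z hz
      by_cases hy : y = ε x
      · subst hy
        rw [hInε]; exact fun hzL => disjoint_left.1 (hLI x hxy.1) hzL (hJI hz)
      · obtain ⟨he, -⟩ := hpair x y hxy hy
        rw [hInn x y hy]
        have := h.avoid _ he (z, w₀) (hJI hz)
        rwa [h.base z (hJI hz)] at this)
    (by
      intro x y x' y' hxy hxy' hs
      by_cases hy : y = ε x <;> by_cases hy' : y' = ε x'
      · subst hy hy'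
        rw [hInε, hInε]
        refine hLd x hxy.1 x' hxy'.1 ?_ ?_
        · rintro rfl; exact hs rfl
        · rintro rfl; exact hs (by rw [(hε x hxy.1).2.2, Sym2.eq_swap])
      · subst hy
        obtain ⟨he, -⟩ := hpair x' y' hxy' hy'
        rw [hInε, hInn x' y' hy']
        exact disjoint_of_subset_right (h.sub _ he) (hLQ x hxy.1)
      · subst hy'
        obtain ⟨he, -⟩ := hpair x y hxy hy
        rw [hInε, hInn x y hy]
        exact (disjoint_of_subset_right (h.sub _ he) (hLQ x' hxy'.1)).symm
      · obtain ⟨he, -⟩ := hpair x y hxy hy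
        obtain ⟨he', -⟩ := hpair x' y' hxy' hy'
        rw [hInn x y hy, hInn x' y' hy']
        refine h.disj _ he _ he' fun hh => hs ?_
        have := congrArg (Sym2.map Prod.fst) hh
        simpa using this)
    q hq
  -- the closing path inside the hub of `i`
  have hiI := hJI hi
  have hτI := hJI (hτ i hi).1
  set e₁ : Sym2 (V × W) := s((τ i, w₀), (i, w₁)) with he₁
  have he₁m : e₁ ∈ hubPairs I hub :=
    ⟨_, _, rfl, fun hh => (hτ i hi).2.1 (congrArg Prod.fst hh), hτI, hiI, hhub i hi⟩
  obtain ⟨r, hr, hrs⟩ := h.path _ _ he₁m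
  rw [← he₁] at hrs
  have hbτ : b (τ i, w₀) = τ i := h.base _ hτI
  have hbi : b (i, w₀) = i := h.base _ hiI
  -- properties of vertices of `p`
  have hpAe : ∀ z ∈ p.support, ∀ e ∈ hubPairs I hub,
      (∀ x y, e ≠ s((x, w₀), (y, w₀)) ∨ x = y) → z ∉ A e := by
    intro z hz e he hne' hze
    rcases hp1 z hz with hz | ⟨x, y, hxy, hz⟩
    · have := h.avoid _ he (z, w₀) (hJI (hqJ z hz))
      rw [h.base z (hJI (hqJ z hz))] at this
      exact this hze
    · have hxy' : C.Adj x y := SimpleGraph.Walk.adj_of_mem_edges _ hxy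
      by_cases hy : y = ε x
      · subst hy
        rw [hInε] at hz
        exact disjoint_left.1 (hLQ x hxy'.1) hz (h.sub _ he hze)
      · rw [hInn x y hy] at hz
        refine disjoint_left.1 (h.disj _ (hpair x y hxy' hy).1 _ he ?_) hz hze
        intro hh
        rcases hne' x y with h1 | h1
        · exact h1 hh.symm
        · exact hxy'.ne h1
  have hpb : ∀ z ∈ p.support, ∀ w, z = b (i, w) → w = w₀ := by
    intro z hz w hzw
    by_contra hw0
    have hzQ : z ∈ Q := hzw ▸ h.mem (i, w) hiI hw0
    rcases hp1 z hz with hz | ⟨x, y, hxy, hz⟩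
    · exact disjoint_left.1 hQI hzQ (hJI (hqJ z hz))
    · have hxy' : C.Adj x y := SimpleGraph.Walk.adj_of_mem_edges _ hxy
      by_cases hy : y = ε x
      · subst hy
        rw [hInε] at hz
        exact disjoint_left.1 (hLQ x hxy'.1) hz hzQ
      · rw [hInn x y hy] at hz
        exact h.avoid _ (hpair x y hxy' hy).1 (i, w) hiI (hzw ▸ hz)
  -- Three kinds of hub paths are in use, and they never coincide: those on `p` join base points
  -- over different vertices, `e₁` involves `w₁`, and those for the other edges of `F` have both
  -- ends over `i`.
  have hee : ∀ x y, e₁ ≠ s((x, w₀), (y, w₀)) ∨ x = y := by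
    intro x y
    left
    intro hh
    rw [he₁, Sym2.eq_iff] at hh
    rcases hh with ⟨-, h2⟩ | ⟨-, h2⟩
    · exact hw (congrArg Prod.snd h2).symm
    · exact hw (congrArg Prod.snd h2).symm
  -- The edge w₀w₁ runs from `i` backwards along `p` to `τ i` and then through the hub to `(i, w₁)`,
  -- thus around the whole cycle. All other edges of `F` are realised directly over `i`.
  let A' : Sym2 W → Set V := fun e => if e = s(w₀, w₁) then
      {z | (z ∈ p.support ∧ z ≠ i) ∨ z ∈ A e₁} else ↑(A (e.map fun w => (i, w)))
  have hA'1 : A' s(w₀, w₁) = {z | (z ∈ p.support ∧ z ≠ i) ∨ z ∈ A e₁} := if_pos rfl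
  have hA'2 : ∀ e, e ≠ s(w₀, w₁) → A' e = ↑(A (e.map fun w => (i, w))) := fun e he => if_neg he
  have hmap : ∀ u v, u ≠ v → (s(u, v) : Sym2 W).map (fun w => (i, w)) ∈ hubPairs I hub :=
    fun u v huv => ⟨(i, u), (i, v), rfl, fun hh => huv (congrArg Prod.snd hh), hiI, hiI, rfl⟩
  have hmap' : ∀ e ∈ F.edgeSet, (e.map fun w => (i, w)) ∈ hubPairs I hub := by
    intro e he
    induction e using Sym2.ind with
    | _ u v => exact hmap u v (SimpleGraph.Adj.ne he)
  have hmapne : ∀ e : Sym2 W, ∀ x y, (e.map fun w => (i, w)) ≠ s((x, w₀), (y, w₀)) ∨ x = y := by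
    intro e x y
    by_cases hxy : x = y
    · exact Or.inr hxy
    refine Or.inl fun hh => hxy ?_
    induction e using Sym2.ind with
    | _ u v =>
    have := congrArg (Sym2.map Prod.fst) hh
    simp only [Sym2.map_mk, Sym2.eq_iff] at this
    rcases this with ⟨rfl, rfl⟩ | ⟨rfl, rfl⟩ <;> rfl
  have hmape : ∀ e : Sym2 W, (e.map fun w => (i, w)) ≠ e₁ := by
    intro e hh
    induction e using Sym2.ind with
    | _ u v =>
    have := congrArg (Sym2.map Prod.fst) hh
    simp only [he₁, Sym2.map_mk, Sym2.eq_iff] at this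
    rcases this with ⟨h1, -⟩ | ⟨-, h1⟩ <;> exact (hτ i hi).2.1 h1.symm
  have hbinj : Function.Injective fun w => b (i, w) := by
    intro u v huv
    exact congrArg Prod.snd (h.inj (show (i, u) ∈ {p : V × W | p.1 ∈ I} from hiI)
      (show (i, v) ∈ {p : V × W | p.1 ∈ I} from hiI) huv)
  have hlong : ∃ P : G.Walk (b (i, w₀)) (b (i, w₁)), P.IsPath ∧
      ∀ z, z ∈ P.support ↔ z = b (i, w₀) ∨ z = b (i, w₁) ∨ z ∈ A' s(w₀, w₁) := by
    refine ⟨((p.reverse.copy hbi.symm hbτ.symm)).append r, isPath_append_of_disjoint ?_ hr ?_, ?_⟩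
    · simpa using hp.reverse
    · intro z hz hzr
      simp only [SimpleGraph.Walk.support_copy, SimpleGraph.Walk.support_reverse,
        List.mem_reverse] at hz
      rcases (hrs z).1 hzr with hz' | hz' | hz'
      · exact hz'
      · exact absurd (hpb z hz w₁ hz').symm hw
      · exact absurd hz' (hpAe z hz e₁ he₁m hee)
    · intro z
      rw [hA'1, SimpleGraph.Walk.mem_support_append_iff, hrs z]
      simp only [SimpleGraph.Walk.support_copy, SimpleGraph.Walk.support_reverse,
        List.mem_reverse, Set.mem_ofPred_eq, hbi, hbτ]
      constructor
      · rintro (hz | rfl | hz | hz)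
        · by_cases hzi : z = i
          · exact Or.inl hzi
          · exact Or.inr (Or.inr (Or.inl ⟨hz, hzi⟩))
        · exact Or.inr (Or.inr (Or.inl ⟨p.start_mem_support, (hτ i hi).2.1⟩))
        · exact Or.inr (Or.inl hz)
        · exact Or.inr (Or.inr (Or.inr hz))
      · rintro (rfl | hz | ⟨hz, -⟩ | hz)
        · exact Or.inl p.end_mem_support
        · exact Or.inr (Or.inr (Or.inl hz))
        · exact Or.inl hz
        · exact Or.inr (Or.inr (Or.inr hz))
  refine ⟨_, hasSubdivisionOn_of_paths (F := F) (G := G) (b := fun w => b (i, w)) A' hbinj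
    ?_ ?_ ?_, ?_, ?_⟩
  · intro u v huv
    by_cases he : s(u, v) = s(w₀, w₁)
    · rw [he]
      rw [Sym2.eq_iff] at he
      rcases he with ⟨rfl, rfl⟩ | ⟨rfl, rfl⟩
      · exact hlong
      · obtain ⟨P, hP, hPs⟩ := hlong
        refine ⟨P.reverse, hP.reverse, fun z => ?_⟩
        rw [SimpleGraph.Walk.support_reverse, List.mem_reverse, hPs z]
        tauto
    · rw [hA'2 _ he]
      exact h.path _ _ (hmap u v huv.ne)
  · intro e he w
    by_cases hew : e = s(w₀, w₁)
    · rw [hew, hA'1]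
      rintro (⟨h1, h2⟩ | h1)
      · have h3 := hpb _ h1 w rfl
        rw [h3, hbi] at h2
        exact h2 rfl
      · exact h.avoid _ he₁m (i, w) hiI h1
    · rw [hA'2 _ hew]
      exact h.avoid _ (hmap' e he) (i, w) hiI
  · have key : ∀ e ∈ F.edgeSet, e ≠ s(w₀, w₁) → Disjoint (A' s(w₀, w₁)) (A' e) := by
      intro e he hew
      rw [hA'1, hA'2 e hew, Set.disjoint_left]
      rintro z (⟨hz, -⟩ | hz) hze
      · exact hpAe z hz _ (hmap' e he) (hmapne e) hze
      · exact disjoint_left.1 (h.disj _ he₁m _ (hmap' e he) (hmape e).symm) hz hze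
    intro e he f hf hef
    by_cases hew : e = s(w₀, w₁)
    · subst hew
      exact key f hf hef.symm
    by_cases hfw : f = s(w₀, w₁)
    · subst hfw
      exact (key e he hew).symm
    rw [hA'2 e hew, hA'2 f hfw, Finset.disjoint_coe]
    refine h.disj _ (hmap' e he) _ (hmap' f hf) fun hh => hef ?_
    exact Sym2.map.injective (fun u v huv => congrArg Prod.snd huv) hh
  · intro x hx hreach z hz
    have hxq := (hqr x).1 hreach
    refine Or.inr ⟨s(w₀, w₁), hF, ?_⟩
    rw [hA'1]
    refine Or.inl ⟨hp3 x (ε x) (hqε x hxq) z (by rw [hInε]; exact hz), ?_⟩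
    rintro rfl
    exact disjoint_left.1 (hLI x hx) hz hiI
  · rintro z (⟨w, rfl⟩ | ⟨e, he, hz⟩)
    · exact Or.inl ⟨i, hi, w, SimpleGraph.Reachable.refl _, rfl⟩
    · by_cases hew : e = s(w₀, w₁)
      · rw [hew, hA'1] at hz
        rcases hz with ⟨hz, -⟩ | hz
        · rcases hp1 z hz with hz | ⟨x, y, hxy, hz⟩
          · exact Or.inl ⟨z, hqJ z hz, w₀, (hqr z).2 hz, (h.base z (hJI (hqJ z hz))).symm⟩
          · have hxy' : C.Adj x y := SimpleGraph.Walk.adj_of_mem_edges _ hxy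
            have hxr := (hqr x).2 (SimpleGraph.Walk.fst_mem_support_of_mem_edges _ hxy)
            by_cases hy : y = ε x
            · subst hy
              rw [hInε] at hz
              exact Or.inr (Or.inl ⟨x, hxy'.1, hxr, hz⟩)
            · rw [hInn x y hy] at hz
              refine Or.inr (Or.inr ⟨_, (hpair x y hxy' hy).1, ?_, hz⟩)
              intro p' hp'
              rcases Sym2.mem_iff.1 hp' with rfl | rfl
              · exact hxr
              · exact hxr.trans hxy'.reachable
        · refine Or.inr (Or.inr ⟨e₁, he₁m, ?_, hz⟩)
          intro p' hp'
          rcases Sym2.mem_iff.1 hp' with rfl | rfl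
          · exact ((hadj i hi _).2 (Or.inr rfl)).reachable
          · exact SimpleGraph.Reachable.refl _
      · rw [hA'2 _ hew] at hz
        refine Or.inr (Or.inr ⟨_, hmap' e he, ?_, hz⟩)
        intro p' hp'
        obtain ⟨w, -, rfl⟩ := Sym2.mem_map.1 hp'
        exact SimpleGraph.Reachable.refl _

end Component

/-! ### Packing subdivisions into a system of hubs and long paths -/

section Packing

variable {V W : Type*} [Fintype V] {F : SimpleGraph W} {G : SimpleGraph V}

/-- The used ends of long paths can be paired up within the hubs, after giving up few paths. -/
theorem exists_even_hubs {V : Type*} [DecidableEq V] (E : Finset V) (g : V → V) (hub : V → ℕ)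
    (R : ℕ) (hE : ∀ x ∈ E, hub x < R ∧ hub (g x) < R) :
    ∃ E₀ ⊆ E, #E ≤ #E₀ + R ∧
      ∀ j, Even (#(E₀.filter fun x => hub x = j) + #(E₀.filter fun x => hub (g x) = j)) := by
  let f : V → Fin R → ZMod 2 := fun x j =>
    (if hub x = j then 1 else 0) + if hub (g x) = j then 1 else 0
  -- The at most `R` paths in `r` carry the whole parity vector of used ends, so removing them
  -- leaves even numbers at all hubs.
  obtain ⟨r, hr, hrc, hrs⟩ := exists_subset_card_le_sum_eq E f
  rw [Fintype.card_fin] at hrc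
  refine ⟨E \ r, sdiff_subset, ?_, ?_⟩
  · have := card_sdiff_add_card_eq_card hr
    omega
  intro j
  by_cases hj : j < R
  · have h1 : ∑ e ∈ E \ r, f e = 0 := by
      have := Finset.sum_sdiff (f := f) hr
      rw [hrs] at this
      simpa using this
    have h2 := congrFun h1 ⟨j, hj⟩
    simp only [f, Finset.sum_apply, Finset.sum_add_distrib, Finset.sum_boole, Pi.zero_apply] at h2
    rw [← Nat.cast_add] at h2
    exact (ZMod.natCast_eq_zero_iff_even).1 h2
  · have h1 : (E \ r).filter (fun x => hub x = j) = ∅ := by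
      rw [filter_eq_empty_iff]
      rintro x hx rfl
      exact hj (hE x (sdiff_subset hx)).1
    have h2 : (E \ r).filter (fun x => hub (g x) = j) = ∅ := by
      rw [filter_eq_empty_iff]
      rintro x hx rfl
      exact hj (hE x (sdiff_subset hx)).2
    rw [h1, h2]; simp

/-- `ε` switches between the ends of a long path and `τ` pairs the used ends within each hub. One
subdivision is taken per component. The points, paths and pairs it uses all belong to its component,
which gives disjointness even where several cycles pass through one hub. -/
theorem exists_packing_of_hubs {w₀ w₁ : W} (hF : F.Adj w₀ w₁) {IX IY : Finset V} [DecidableEq V]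
    {hub : V → ℕ} {b : V × W → V} {A : Sym2 (V × W) → Finset V} {Q : Finset V}
    (h : IsHubSystem G w₀ (IX ∪ IY) hub b A Q) (hQ : Disjoint Q (IX ∪ IY)) {R : ℕ}
    (hX : ∀ v ∈ IX, hub v < R ∧ Even (hub v)) (hY : ∀ v ∈ IY, hub v < R ∧ Odd (hub v))
    {E : Finset V} (hE : E ⊆ IX) {g : V → V} (hg : Set.InjOn g E) (hgY : ∀ x ∈ E, g x ∈ IY)
    (L : V → Finset V) (hLp : ∀ x ∈ E, ∃ p : G.Walk x (g x), p.IsPath ∧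
      ∀ z, z ∈ p.support ↔ z = x ∨ z = g x ∨ z ∈ L x)
    (hLI : ∀ x ∈ E, Disjoint (L x) (IX ∪ IY)) (hLQ : ∀ x ∈ E, Disjoint (L x) Q)
    (hLd : ∀ x ∈ E, ∀ y ∈ E, x ≠ y → Disjoint (L x) (L y)) :
    ∃ 𝒮 : Set (Set V), (∀ S ∈ 𝒮, HasSubdivisionOn F G S) ∧ 𝒮.Pairwise Disjoint ∧
      ∃ E₀ ⊆ E, #E ≤ #E₀ + R ∧ ∀ x ∈ E₀, ↑(L x) ⊆ ⋃₀ 𝒮 := by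
  classical
  obtain ⟨E₀, hE₀, hE₀c, heven⟩ := exists_even_hubs E g hub R
    fun x hx => ⟨(hX x (hE hx)).1, (hY _ (hgY x hx)).1⟩
  have hpar : ∀ x ∈ IX, ∀ y ∈ IY, hub x ≠ hub y := by
    intro x hx y hy hxy
    have h1 := (hX x hx).2
    rw [hxy] at h1
    exact (Nat.not_even_iff_odd.2 (hY y hy).2) h1
  have hXY : Disjoint IX IY := disjoint_left.2 fun x hx hy => hpar x hx x hy rfl
  have hg₀ : Set.InjOn g E₀ := hg.mono hE₀
  set J := E₀ ∪ E₀.image g with hJ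
  have hEX : ∀ x ∈ E₀, x ∈ IX := fun x hx => hE (hE₀ hx)
  have hgE : ∀ x ∈ E₀, g x ∈ IY := fun x hx => hgY x (hE₀ hx)
  have hgn : ∀ x ∈ E₀, g x ∉ E₀ := fun x hx hx' => disjoint_left.1 hXY (hEX _ hx') (hgE x hx)
  have hJI : J ⊆ IX ∪ IY := by
    refine union_subset_union (hE₀.trans hE) fun y hy => ?_
    obtain ⟨x, hx, rfl⟩ := mem_image.1 hy
    exact hgE x hx
  let gi : V → V := fun y => if hy : ∃ x ∈ E₀, g x = y then hy.choose else y
  have hgi : ∀ x ∈ E₀, gi (g x) = x := by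
    intro x hx
    have hex : ∃ x' ∈ E₀, g x' = g x := ⟨x, hx, rfl⟩
    simp only [gi, dif_pos hex]
    exact hg₀ hex.choose_spec.1 hx hex.choose_spec.2
  let ε : V → V := fun x => if x ∈ E₀ then g x else gi x
  have hε1 : ∀ x ∈ E₀, ε x = g x := fun x hx => if_pos hx
  have hε2 : ∀ x ∈ E₀, ε (g x) = x := fun x hx => (if_neg (hgn x hx)).trans (hgi x hx)
  have hJcases : ∀ y ∈ J, y ∈ E₀ ∨ ∃ x ∈ E₀, g x = y := fun y hy =>
    (mem_union.1 hy).imp id fun hy => mem_image.1 hy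
  have hE₀J : ∀ x ∈ E₀, x ∈ J := fun x hx => mem_union_left _ hx
  have hgJ : ∀ x ∈ E₀, g x ∈ J := fun x hx => mem_union_right _ (mem_image_of_mem g hx)
  have hεhub : ∀ x ∈ J, hub (ε x) ≠ hub x := by
    intro y hy
    rcases hJcases y hy with hy | ⟨x, hx, rfl⟩
    · rw [hε1 y hy]; exact (hpar _ (hEX y hy) _ (hgE y hy)).symm
    · rw [hε2 x hx]; exact hpar _ (hEX x hx) _ (hgE x hx)
  have hε : ∀ x ∈ J, ε x ∈ J ∧ ε x ≠ x ∧ ε (ε x) = x := by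
    intro y hy
    refine ⟨?_, fun hh => hεhub y hy (congrArg hub hh), ?_⟩
    · rcases hJcases y hy with hy | ⟨x, hx, rfl⟩
      · rw [hε1 y hy]; exact hgJ y hy
      · rw [hε2 x hx]; exact hE₀J x hx
    · rcases hJcases y hy with hy | ⟨x, hx, rfl⟩
      · rw [hε1 y hy, hε2 y hy]
      · rw [hε2 x hx, hε1 x hx]
  have hinv : ∀ j, ∃ τ : V → V, ∀ x ∈ J.filter (fun x => hub x = j),
      τ x ∈ J.filter (fun x => hub x = j) ∧ τ x ≠ x ∧ τ (τ x) = x := by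
    intro j
    refine exists_involution_of_even _ ?_
    have h1 : J.filter (fun x => hub x = j)
        = E₀.filter (fun x => hub x = j) ∪ (E₀.filter fun x => hub (g x) = j).image g := by
      rw [hJ, filter_union, filter_image]
    rw [h1, card_union_of_disjoint, card_image_of_injOn (hg₀.mono (filter_subset _ _))]
    · exact heven j
    · rw [disjoint_left]
      intro x hx hx'
      obtain ⟨y, hy, rfl⟩ := mem_image.1 hx'
      exact hgn y (mem_filter.1 hy).1 (mem_filter.1 hx).1
  choose τ' hτ' using hinv
  let τ : V → V := fun x => τ' (hub x) x
  have hτm : ∀ x ∈ J, τ x ∈ J ∧ hub (τ x) = hub x := by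
    intro x hx
    exact mem_filter.1 (hτ' (hub x) x (mem_filter.2 ⟨hx, rfl⟩)).1
  have hτ : ∀ x ∈ J, τ x ∈ J ∧ τ x ≠ x ∧ τ (τ x) = x := by
    intro x hx
    have h1 := hτ' (hub x) x (mem_filter.2 ⟨hx, rfl⟩)
    refine ⟨(hτm x hx).1, h1.2.1, ?_⟩
    show τ' (hub (τ x)) (τ x) = x
    rw [(hτm x hx).2]; exact h1.2.2
  have hne : ∀ x ∈ J, ε x ≠ τ x := fun x hx hh =>
    hεhub x hx (by rw [hh]; exact (hτm x hx).2)
  let L' : V → Finset V := fun x => if x ∈ E₀ then L x else L (gi x)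
  have hL1 : ∀ x ∈ E₀, L' x = L x := fun x hx => if_pos hx
  have hL2 : ∀ x ∈ E₀, L' (g x) = L x := fun x hx =>
    (if_neg (hgn x hx)).trans (by rw [hgi x hx])
  have hL'prop : ∀ y ∈ J, ∃ x ∈ E₀, L' y = L x ∧ (y = x ∨ y = g x) := by
    intro y hy
    rcases hJcases y hy with hy | ⟨x, hx, rfl⟩
    · exact ⟨y, hy, hL1 y hy, Or.inl rfl⟩
    · exact ⟨x, hx, hL2 x hx, Or.inr rfl⟩
  have hL'ε : ∀ x ∈ J, L' (ε x) = L' x := by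
    intro y hy
    rcases hJcases y hy with hy | ⟨x, hx, rfl⟩
    · rw [hε1 y hy, hL1 y hy, hL2 y hy]
    · rw [hε2 x hx, hL1 x hx, hL2 x hx]
  have hL'p : ∀ x ∈ J, ∃ p : G.Walk x (ε x), p.IsPath ∧
      ∀ z, z ∈ p.support ↔ z = x ∨ z = ε x ∨ z ∈ L' x := by
    intro y hy
    rcases hJcases y hy with hy | ⟨x, hx, rfl⟩
    · rw [hε1 y hy, hL1 y hy]
      exact hLp y (hE₀ hy)
    · rw [hε2 x hx, hL2 x hx]
      obtain ⟨p, hp, hps⟩ := hLp x (hE₀ hx)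
      refine ⟨p.reverse, hp.reverse, fun z => ?_⟩
      rw [SimpleGraph.Walk.support_reverse, List.mem_reverse, hps z]
      tauto
  have hL'I : ∀ x ∈ J, Disjoint (L' x) (IX ∪ IY) := by
    intro y hy
    obtain ⟨x, hx, hh, -⟩ := hL'prop y hy
    rw [hh]; exact hLI x (hE₀ hx)
  have hL'Q : ∀ x ∈ J, Disjoint (L' x) Q := by
    intro y hy
    obtain ⟨x, hx, hh, -⟩ := hL'prop y hy
    rw [hh]; exact hLQ x (hE₀ hx)
  have hL'd : ∀ x ∈ J, ∀ y ∈ J, y ≠ x → y ≠ ε x → Disjoint (L' x) (L' y) := by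
    intro y hy y' hy' hne1 hne2
    obtain ⟨x, hx, hh, hxy⟩ := hL'prop y hy
    obtain ⟨x', hx', hh', hxy'⟩ := hL'prop y' hy'
    rw [hh, hh']
    refine hLd x (hE₀ hx) x' (hE₀ hx') ?_
    rintro rfl
    rcases hxy with rfl | rfl <;> rcases hxy' with rfl | rfl
    · exact hne1 rfl
    · exact hne2 (hε1 _ hx).symm
    · exact hne2 (hε2 _ hx).symm
    · exact hne1 rfl
  have hmain : ∀ i : J, ∃ S : Set V, _ := fun i => h.exists_hasSubdivisionOn hF hQ hJI hε hτ hne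
    (fun x hx => (hτm x hx).2) L' hL'ε hL'p hL'I hL'Q hL'd i.2
  choose S hS hSL hSz using hmain
  set C := involutionGraph J ε τ with hC
  have hrJ : ∀ i ∈ J, ∀ x, C.Reachable i x → x ∈ J := by
    rintro i hi x ⟨p⟩
    exact support_subset_of_adj (C := C) (fun _ _ h => h.1) p hi x p.end_mem_support
  have hdisj : ∀ i j : J, ¬ C.Reachable i j → Disjoint (S i) (S j) := by
    intro i j hij
    have hnr : ∀ x, C.Reachable i x → C.Reachable j x → False := fun x h1 h2 =>
      hij (h1.trans h2.symm)
    have hbm : ∀ x ∈ J, ∀ w, b (x, w) ∈ Q ∨ b (x, w) ∈ IX ∪ IY := by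
      intro x hx w
      by_cases hw : w = w₀
      · subst hw; right; rw [h.base x (hJI hx)]; exact hJI hx
      · exact Or.inl (h.mem _ (hJI hx) hw)
    have hbL : ∀ x ∈ J, ∀ w, ∀ y ∈ J, b (x, w) ∉ L' y := by
      intro x hx w y hy hz
      rcases hbm x hx w with h1 | h1
      · exact disjoint_left.1 (hL'Q y hy) hz h1
      · exact disjoint_left.1 (hL'I y hy) hz h1
    rw [Set.disjoint_left]
    intro z hz hz'
    rcases hSz i z hz with ⟨x, hx, w, hr, rfl⟩ | ⟨x, hx, hr, hzx⟩ | ⟨e, he, hr, hze⟩ <;>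
      rcases hSz j _ hz' with ⟨x', hx', w', hr', hzz⟩ | ⟨x', hx', hr', hzx'⟩ | ⟨e', he', hr', hze'⟩
    · have h1 := congrArg Prod.fst (h.inj (show (x, w) ∈ {p : V × W | p.1 ∈ IX ∪ IY} from hJI hx)
        (show (x', w') ∈ {p : V × W | p.1 ∈ IX ∪ IY} from hJI hx') hzz)
      simp only at h1
      subst h1
      exact hnr _ hr hr'
    · exact hbL x hx w x' hx' hzx'
    · exact h.avoid e' he' (x, w) (hJI hx) hze'
    · subst hzz; exact hbL x' hx' w' x hx hzx
    · refine disjoint_left.1 (hL'd x hx x' hx' ?_ ?_) hzx hzx'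
      · rintro rfl; exact hnr _ hr hr'
      · rintro rfl
        exact hnr _ (hr.trans ((involutionGraph_adj hε hτ hx _).2 (Or.inl rfl)).reachable) hr'
    · exact disjoint_left.1 (hL'Q x hx) hzx (h.sub e' he' hze')
    · subst hzz; exact h.avoid e he (x', w') (hJI hx') hze
    · exact disjoint_left.1 (hL'Q x' hx') hzx' (h.sub e he hze)
    · refine disjoint_left.1 (h.disj e he e' he' ?_) hze hze'
      rintro rfl
      obtain ⟨p, q, rfl, -⟩ := he
      exact hnr _ (hr p (Sym2.mem_mk_left _ _)) (hr' p (Sym2.mem_mk_left _ _))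
  -- The set obtained may depend on the starting vertex, so one representative is fixed in every
  -- component.
  let rep : J → J := fun i => (Quotient.mk (⟨fun i j : J => C.Reachable i j,
    fun i => SimpleGraph.Reachable.refl _, fun h => h.symm, fun h h' => h.trans h'⟩ : Setoid J)
      i).out
  have hrep : ∀ i, C.Reachable (rep i : J) i := fun i => Quotient.mk_out (s := ⟨fun i j : J =>
    C.Reachable i j, fun i => SimpleGraph.Reachable.refl _, fun h => h.symm,
    fun h h' => h.trans h'⟩) i
  have hrepeq : ∀ i j : J, C.Reachable i j → rep i = rep j := by
    intro i j hij
    have : Quotient.mk (⟨fun i j : J => C.Reachable i j,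
      fun i => SimpleGraph.Reachable.refl _, fun h => h.symm, fun h h' => h.trans h'⟩ : Setoid J) i
      = Quotient.mk _ j := Quotient.sound hij
    simp only [rep, this]
  refine ⟨Set.range fun i => S (rep i), ?_, ?_, E₀, hE₀, hE₀c, ?_⟩
  · rintro _ ⟨i, rfl⟩; exact hS _
  · rintro _ ⟨i, rfl⟩ _ ⟨j, rfl⟩ hij
    refine hdisj _ _ fun hr => hij ?_
    have : rep i = rep j := hrepeq i j ((hrep i).symm.trans (hr.trans (hrep j)))
    simp only [this]
  · intro x hx
    have hxJ := hE₀J x hx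
    refine Set.subset_sUnion_of_subset _ _ ?_ ⟨⟨x, hxJ⟩, rfl⟩
    have := hSL (rep ⟨x, hxJ⟩) x hxJ (hrep ⟨x, hxJ⟩)
    rwa [hL1 x hx] at this

end Packing

/-! ### Long paths between two well distributed sets -/

/-- The weight is symmetric: the discrepancy of `B` bounds the missing weight at `A`, and that of
`A` bounds the excess at `B`. -/
theorem exists_matching_layer {V : Type*} [Nonempty V] {G : SimpleGraph V} {d : ℝ} {t : ℕ}
    (hd0 : 0 < d) {T A B : Finset V} (hA : A ⊆ T) (hB : B ⊆ T) :
    ∃ (M : Finset V) (f : V → V), M ⊆ A ∧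
      (#A : ℝ) ≤ #M + (discrepancy G T t d B + discrepancy G T t d A) ∧
      Set.InjOn f M ∧ ∀ x ∈ M, f x ∈ B ∧ G.Adj x (f x) := by
  refine exists_injOn_of_weights A B (pairWeight G T t d)
    (fun x u => pairWeight_nonneg _ _ hd0.le x u) (fun x u => pairWeight_of_not_adj _ _ _) ?_ ?_
  · refine le_trans (Finset.sum_le_sum fun x _ => ?_)
      (Finset.sum_le_sum_of_subset_of_nonneg hA fun _ _ _ => abs_nonneg _)
    rw [abs_sub_comm]
    exact max_le (abs_nonneg _) (le_abs_self _)
  · refine le_trans (Finset.sum_le_sum fun x _ => ?_)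
      (Finset.sum_le_sum_of_subset_of_nonneg hB fun _ _ _ => abs_nonneg _)
    simp_rw [pairWeight_comm (G := G) T t d x]
    exact max_le (abs_nonneg _) (le_abs_self _)

theorem expectedWeight_le_one {V : Type*} [Fintype V] {G : SimpleGraph V}
    (hpos : ∀ v, 0 < degIn G univ v) (T : Finset V) (x : V) :
    expectedWeight G T x ≤ 1 := by
  calc expectedWeight G T x ≤ ∑ u ∈ T, adjInd G x u / degIn G univ x := by
        refine Finset.sum_le_sum fun u _ => ?_
        have h1 := hpos x
        have h2 := hpos u
        have h3 : adjInd G x u * degIn G T u / (degIn G univ x * degIn G univ u)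
            = adjInd G x u / degIn G univ x * (degIn G T u / degIn G univ u) := mul_div_mul_comm ..
        rw [h3]
        refine mul_le_of_le_one_right (div_nonneg (adjInd_nonneg _ _ _) h1.le) ?_
        exact (div_le_one h2).2 (degIn_mono G (subset_univ T) u)
    _ = degIn G T x / degIn G univ x := by rw [← Finset.sum_div, ← degIn]
    _ ≤ 1 := (div_le_one (hpos x)).2 (degIn_mono G (subset_univ T) x)

section LongPaths

variable {V : Type*} [Fintype V] [DecidableEq V] {G : SimpleGraph V} {c d : ℝ} {t : ℕ}

/-- The loss at `x` is the average over its neighbours `u` of `β u`, the proportion of the degree of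
`u` lost by restricting to `T` (1 outside `T`). As `X` is evenly seen, t times the total loss is at
most Σ β up to the discrepancy. Outside `T` this sum is at most |Tᶜ|; inside, at most d|Tᶜ|/c by
counting edges leaving `T`. -/
theorem sum_one_sub_expectedWeight_le (ht : 0 < t) (hc : 0 < c) (hcd : c ≤ d)
    (hd : ∀ v, degIn G univ v ≤ d) (hcv : ∀ v, c ≤ degIn G univ v) (T X : Finset V) :
    t * ∑ x ∈ X, (1 - expectedWeight G T x)
      ≤ (1 + d / c) * #Tᶜ + discrepancy G univ t d X := by
  have hd0 : 0 < d := hc.trans_le hcd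
  have hpos : ∀ v, 0 < degIn G univ v := fun v => hc.trans_le (hcv v)
  have ht' : (0 : ℝ) < t := by exact_mod_cast ht
  let β : V → ℝ := fun u => 1 - if u ∈ T then degIn G T u / degIn G univ u else 0
  have hβ0 : ∀ u, 0 ≤ β u := by
    intro u
    simp only [β]
    split_ifs
    · have := (div_le_one (hpos u)).2 (degIn_mono G (subset_univ T) u)
      linarith
    · norm_num
  have hβ1 : ∀ u, β u ≤ 1 := by
    intro u
    simp only [β]
    split_ifs
    · have := div_nonneg (degIn_nonneg G T u) (hpos u).le
      linarith
    · norm_num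
  have h1 : ∀ x, 1 - expectedWeight G T x = ∑ u, β u * (adjInd G x u / degIn G univ x) := by
    intro x
    have h2 : ∑ u, adjInd G x u / degIn G univ x = 1 := by
      rw [← Finset.sum_div]; exact div_self (hpos x).ne'
    have h3 : expectedWeight G T x = ∑ u, (if u ∈ T then degIn G T u / degIn G univ u else 0)
        * (adjInd G x u / degIn G univ x) := by
      simp only [ite_mul, zero_mul]
      rw [← Finset.sum_filter, expectedWeight]
      refine Finset.sum_congr (by ext; simp) fun u _ => ?_
      have := (hpos u).ne'
      have := (hpos x).ne'
      field_simp
    rw [h3, ← h2, ← Finset.sum_sub_distrib]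
    refine Finset.sum_congr rfl fun u _ => ?_
    simp only [β]; ring
  have h2 : t * ∑ x ∈ X, (1 - expectedWeight G T x)
      = ∑ u, β u * (degIn G univ u / d) * ∑ x ∈ X, pairWeight G univ t d u x := by
    simp_rw [h1, Finset.mul_sum]
    rw [Finset.sum_comm]
    refine Finset.sum_congr rfl fun u _ => Finset.sum_congr rfl fun x _ => ?_
    have := (hpos u).ne'
    have := (hpos x).ne'
    rw [pairWeight, adjInd_comm G u x]
    field_simp
  rw [h2]
  have h3 : ∀ u, β u * (degIn G univ u / d) * ∑ x ∈ X, pairWeight G univ t d u x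
      ≤ β u + |∑ x ∈ X, pairWeight G univ t d u x - 1| := by
    intro u
    set D := ∑ x ∈ X, pairWeight G univ t d u x with hD
    have hD0 : 0 ≤ D := Finset.sum_nonneg fun x _ => pairWeight_nonneg _ _ hd0.le _ _
    have h4 : degIn G univ u / d ≤ 1 := (div_le_one hd0).2 (hd u)
    have h5 : β u * (degIn G univ u / d) ≤ β u := mul_le_of_le_one_right (hβ0 u) h4
    have h6 : β u * (degIn G univ u / d) * D ≤ β u * D := mul_le_mul_of_nonneg_right h5 hD0
    have h7 : β u * (D - 1) ≤ |D - 1| := by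
      calc β u * (D - 1) ≤ β u * |D - 1| := mul_le_mul_of_nonneg_left (le_abs_self _) (hβ0 u)
        _ ≤ |D - 1| := mul_le_of_le_one_left (abs_nonneg _) (hβ1 u)
    linarith
  refine (Finset.sum_le_sum fun u _ => h3 u).trans ?_
  rw [Finset.sum_add_distrib]
  refine add_le_add ?_ le_rfl
  have h4 : ∑ u, β u = ∑ u ∈ T, β u + ∑ u ∈ Tᶜ, β u := (Finset.sum_add_sum_compl T β).symm
  have h5 : ∑ u ∈ Tᶜ, β u ≤ #Tᶜ := by
    calc ∑ u ∈ Tᶜ, β u ≤ ∑ u ∈ Tᶜ, 1 := Finset.sum_le_sum fun u _ => hβ1 u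
      _ = #Tᶜ := by simp
  have h6 : ∑ u ∈ T, β u ≤ d / c * #Tᶜ := by
    calc ∑ u ∈ T, β u ≤ ∑ u ∈ T, 1 / c * degIn G Tᶜ u := by
          refine Finset.sum_le_sum fun u hu => ?_
          simp only [β, if_pos hu]
          have h7 := degIn_union G (disjoint_compl_right (a := T)) u
          rw [union_compl] at h7
          have h8 : 1 - degIn G T u / degIn G univ u = 1 / degIn G univ u * degIn G Tᶜ u := by
            rw [eq_comm, one_div, inv_mul_eq_div, eq_sub_iff_add_eq, ← add_div, add_comm, ← h7]
            exact div_self (hpos u).ne'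
          rw [h8]
          have := hcv u
          have := degIn_nonneg G Tᶜ u
          gcongr
      _ = 1 / c * ∑ u ∈ Tᶜ, degIn G T u := by rw [← Finset.mul_sum, sum_degIn_comm]
      _ ≤ 1 / c * (d * #Tᶜ) := by
          have := sum_degIn_le hd Tᶜ T
          gcongr
      _ = d / c * #Tᶜ := by ring
  linarith

/-- The deficiency of the best matching from a set into a layer. -/
noncomputable def endDeficiency (G : SimpleGraph V) (t : ℕ) (d : ℝ) (T X B : Finset V) : ℝ :=
  ∑ x ∈ X, (1 - expectedWeight G T x) +
    ∑ x ∈ X, |∑ u ∈ B, pairWeight G univ t d x u - expectedWeight G T x| +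
    discrepancy G univ t d X

theorem exists_matching_end {V : Type*} [Fintype V] [Nonempty V] {G : SimpleGraph V} {d : ℝ}
    {t : ℕ} (hd0 : 0 < d) (hpos : ∀ v, 0 < degIn G univ v)
    (T B : Finset V) {X X' : Finset V} (hX : X' ⊆ X) :
    ∃ (M : Finset V) (f : V → V), M ⊆ X' ∧ (#X' : ℝ) ≤ #M + endDeficiency G t d T X B ∧
      Set.InjOn f M ∧ ∀ x ∈ M, f x ∈ B ∧ G.Adj x (f x) := by
  refine exists_injOn_of_weights X' B (pairWeight G univ t d)
    (fun x u => pairWeight_nonneg _ _ hd0.le x u) (fun x u => pairWeight_of_not_adj _ _ _)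
    (a := _) (b := _) ?_ ?_
  · rw [← Finset.sum_add_distrib]
    have hterm : ∀ x, max 0 (1 - ∑ u ∈ B, pairWeight G univ t d x u)
        ≤ (1 - expectedWeight G T x)
          + |∑ u ∈ B, pairWeight G univ t d x u - expectedWeight G T x| := by
      intro x
      have h1 := expectedWeight_le_one hpos T x
      have h2 := abs_nonneg (∑ u ∈ B, pairWeight G univ t d x u - expectedWeight G T x)
      have h3 := neg_abs_le (∑ u ∈ B, pairWeight G univ t d x u - expectedWeight G T x)
      refine max_le ?_ ?_ <;> linarith
    refine (Finset.sum_le_sum fun x _ => hterm x).trans ?_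
    exact Finset.sum_le_sum_of_subset_of_nonneg hX fun x _ _ => (le_max_left _ _).trans (hterm x)
  · calc ∑ u ∈ B, max 0 (∑ x ∈ X', pairWeight G univ t d x u - 1)
        ≤ ∑ u ∈ B, |∑ x ∈ X, pairWeight G univ t d u x - 1| := by
          refine Finset.sum_le_sum fun u _ => max_le (abs_nonneg _) ?_
          refine le_trans ?_ (le_abs_self _)
          refine sub_le_sub_right ?_ _
          simp_rw [pairWeight_comm (G := G) univ t d u]
          exact Finset.sum_le_sum_of_subset_of_nonneg hX fun x _ _ =>
            pairWeight_nonneg _ _ hd0.le _ _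
      _ ≤ _ := Finset.sum_le_sum_of_subset_of_nonneg (subset_univ B) fun _ _ _ => abs_nonneg _

/-- Matchings between successive layers combine to many disjoint long paths. -/
theorem exists_long_paths [Nonempty V] (ht : 0 < t) (hd0 : 0 < d)
    (hpos : ∀ v, 0 < degIn G univ v) {T X Y X' Y' : Finset V} (hX : X' ⊆ X) (hY : Y' ⊆ Y)
    (hXY : Disjoint X Y) (hTX : Disjoint T (X ∪ Y)) (A : ℕ → Finset V) (hAT : ∀ j, A j ⊆ T)
    (hAd : ∀ i j, i ≠ j → Disjoint (A i) (A j)) :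
    ∃ (E : Finset V) (g : V → V) (L : V → Finset V), E ⊆ X' ∧ Set.InjOn g E ∧
      (∀ x ∈ E, g x ∈ Y') ∧ (∀ x ∈ E, L x ⊆ T ∧ #(L x) = t) ∧
      (∀ x ∈ E, ∃ p : G.Walk x (g x), p.IsPath ∧
        ∀ z, z ∈ p.support ↔ z = x ∨ z = g x ∨ z ∈ L x) ∧
      (∀ x ∈ E, ∀ y ∈ E, x ≠ y → Disjoint (L x) (L y)) ∧
      (#X' : ℝ) ≤ #E + endDeficiency G t d T X (A 0) + endDeficiency G t d T Y (A (t - 1)) +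
        2 * ∑ j ∈ range t, discrepancy G T t d (A j) + (#(A (t - 1)) - #Y') := by
  have hTX' : ∀ z ∈ T, z ∉ X ∧ z ∉ Y := fun z hz => by
    have := disjoint_left.1 hTX hz
    rwa [mem_union, not_or] at this
  -- Layer 0 is `X'`, layers 1 to t are `A 0` to `A (t - 1)`, and layer t + 1 is `Y'`.
  let B : ℕ → Finset V := fun j => if j = 0 then X' else if j ≤ t then A (j - 1) else Y'
  have hB0 : B 0 = X' := if_pos rfl
  have hBm : ∀ j, 0 < j → j ≤ t → B j = A (j - 1) := fun j h1 h2 => by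
    simp [B, h1.ne', h2]
  have hBl : B (t + 1) = Y' := by simp [B]
  obtain ⟨M₀, f₀, hM₀, hc₀, hf₀, ha₀⟩ := exists_matching_end (t := t) hd0 hpos T (A 0) hX
  obtain ⟨M₁, f₁, hM₁, hc₁, hf₁, ha₁⟩ := exists_matching_end (t := t) hd0 hpos T (A (t - 1)) hY
  have hmid : ∀ j, ∃ (M : Finset V) (f : V → V), M ⊆ A (j - 1) ∧
      (#(A (j - 1)) : ℝ) ≤ #M + (discrepancy G T t d (A j) + discrepancy G T t d (A (j - 1))) ∧
      Set.InjOn f M ∧ ∀ x ∈ M, f x ∈ A j ∧ G.Adj x (f x) := fun j =>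
    exists_matching_layer hd0 (hAT _) (hAT _)
  choose Mm fm hMm hcm hfm ham using hmid
  -- The last matching was found from `Y'` into `A (t - 1)` and is used backwards. Its loss, counted
  -- from `A (t - 1)`, contributes the term `#(A (t - 1)) - #Y'`.
  let M : ℕ → Finset V := fun j => if j = 0 then M₀ else if j < t then Mm j else M₁.image f₁
  let f : ℕ → V → V := fun j => if j = 0 then f₀ else if j < t then fm j else
    Function.invFunOn f₁ M₁
  have hinv : ∀ y ∈ M₁, Function.invFunOn f₁ M₁ (f₁ y) = y := fun y hy =>
    hf₁.leftInvOn_invFunOn (mem_coe.2 hy)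
  have hBT : ∀ j, 0 < j → j ≤ t → B j ⊆ T := fun j h1 h2 => by rw [hBm j h1 h2]; exact hAT _
  have hdisB : ∀ i ≤ t + 1, ∀ j ≤ t + 1, i < j → Disjoint (B i) (B j) := by
    intro i hi j hj hij
    rw [disjoint_left]
    intro z hzi hzj
    have hjT : j ≤ t → z ∈ T := fun hjt => hBT j (by omega) hjt hzj
    rcases Nat.eq_zero_or_pos i with rfl | hi0
    · rw [hB0] at hzi
      rcases Nat.lt_or_ge t j with hjt | hjt
      · have : j = t + 1 := by omega
        subst this
        rw [hBl] at hzj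
        exact disjoint_left.1 hXY (hX hzi) (hY hzj)
      · exact (hTX' z (hjT hjt)).1 (hX hzi)
    · have hziT : z ∈ T := hBT i hi0 (by omega) hzi
      rcases Nat.lt_or_ge t j with hjt | hjt
      · have : j = t + 1 := by omega
        subst this
        rw [hBl] at hzj
        exact (hTX' z hziT).2 (hY hzj)
      · rw [hBm i hi0 (by omega)] at hzi
        rw [hBm j (by omega) hjt] at hzj
        exact disjoint_left.1 (hAd (i - 1) (j - 1) (by omega)) hzi hzj
  obtain ⟨E, g, L, hE, hcard, hg, hgT, hp, hL, hz⟩ := exists_layered_paths (G := G) B M f (t + 1)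
    (by
      intro i hi j hj hij
      rcases lt_or_gt_of_ne hij with h | h
      · exact hdisB i hi j hj h
      · exact (hdisB j hj i hi h).symm)
    (by
      intro j hj
      rcases Nat.eq_zero_or_pos j with rfl | hj0
      · exact hf₀
      · by_cases hjt : j < t
        · simp only [f, M, hj0.ne', if_false, hjt, if_true]; exact hfm j
        · simp only [f, M, hj0.ne', if_false, hjt]
          intro x hx y hy hxy
          obtain ⟨x', hx', rfl⟩ := mem_image.1 (mem_coe.1 hx)
          obtain ⟨y', hy', rfl⟩ := mem_image.1 (mem_coe.1 hy)
          rw [hinv x' hx', hinv y' hy'] at hxy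
          rw [hxy])
    (by
      intro j hj
      rcases Nat.eq_zero_or_pos j with rfl | hj0
      · exact hM₀
      · rw [hBm j hj0 (by omega)]
        by_cases hjt : j < t
        · simp only [M, hj0.ne', if_false, hjt, if_true]; exact hMm j
        · have : j = t := by omega
          subst this
          simp only [M, hj0.ne', if_false, hjt]
          intro y hy
          obtain ⟨x, hx, rfl⟩ := mem_image.1 hy
          exact (ha₁ x hx).1)
    (by
      intro j hj x hx
      rcases Nat.eq_zero_or_pos j with rfl | hj0
      · rw [hBm (0 + 1) (by omega) (by omega)]
        exact ha₀ x hx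
      · by_cases hjt : j < t
        · rw [hBm (j + 1) (by omega) (by omega)]
          simp only [f, M, hj0.ne', if_false, hjt, if_true] at hx ⊢
          exact ham j x hx
        · have : j = t := by omega
          subst this
          rw [hBl]
          simp only [f, M, hj0.ne', if_false, hjt] at hx ⊢
          obtain ⟨y, hy, rfl⟩ := mem_image.1 hx
          rw [hinv y hy]
          exact ⟨hM₁ hy, (ha₁ y hy).2.symm⟩)
  rw [hB0] at hE hcard
  rw [hBl] at hgT
  have hxg : ∀ x ∈ E, ∀ y ∈ E, x ≠ g y := fun x hx y hy hh =>
    disjoint_left.1 hXY (hX (hE hx)) (hh ▸ hY (hgT y hy))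
  have hmem : ∀ x ∈ E, x ∈ L x ∧ g x ∈ L x ∧ #(L x) = t + 2 := by
    intro x hx
    obtain ⟨p, hp, hpl, hpL⟩ := hp x hx
    rw [← hpL]
    refine ⟨List.mem_toFinset.2 p.start_mem_support, List.mem_toFinset.2 p.end_mem_support, ?_⟩
    rw [List.toFinset_card_of_nodup hp.support_nodup, SimpleGraph.Walk.length_support, hpl]
  refine ⟨E, g, fun x => ((L x).erase x).erase (g x), hE, hg, hgT, ?_, ?_, ?_, ?_⟩
  · intro x hx
    obtain ⟨h1, h2, h3⟩ := hmem x hx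
    refine ⟨?_, ?_⟩
    · intro z hzL
      rw [mem_erase, mem_erase] at hzL
      rcases hz x hx z hzL.2.2 with h | h | ⟨j, hj0, hj, hzB⟩
      · exact absurd h hzL.2.1
      · exact absurd h hzL.1
      · exact hBT j hj0 (by omega) hzB
    · rw [card_erase_of_mem (mem_erase.2 ⟨(hxg x hx x hx).symm, h2⟩), card_erase_of_mem h1, h3]
      rfl
  · intro x hx
    obtain ⟨h1, h2, -⟩ := hmem x hx
    obtain ⟨p, hp, hpl, hpL⟩ := hp x hx
    refine ⟨p, hp, fun z => ?_⟩
    rw [← List.mem_toFinset, hpL, mem_erase, mem_erase]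
    constructor
    · intro hzL
      by_cases hzx : z = x
      · exact Or.inl hzx
      by_cases hzg : z = g x
      · exact Or.inr (Or.inl hzg)
      exact Or.inr (Or.inr ⟨hzg, hzx, hzL⟩)
    · rintro (rfl | rfl | h)
      exacts [h1, h2, h.2.2]
  · intro x hx y hy hxy
    exact disjoint_of_subset_left ((erase_subset _ _).trans (erase_subset _ _))
      (disjoint_of_subset_right ((erase_subset _ _).trans (erase_subset _ _)) (hL x hx y hy hxy))
  · refine hcard.trans ?_
    obtain ⟨s, rfl⟩ : ∃ s, t = s + 1 := ⟨t - 1, by omega⟩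
    rw [Finset.sum_range_succ, Finset.sum_range_succ']
    have hlast : (#(B (s + 1)) : ℝ) - #(M (s + 1)) ≤ endDeficiency G (s + 1) d T Y (A s)
        + (#(A s) - #Y') := by
      rw [hBm (s + 1) (by omega) le_rfl]
      have hM : M (s + 1) = M₁.image f₁ := by simp [M]
      rw [hM, card_image_of_injOn hf₁]
      simp only [add_tsub_cancel_right] at hc₁ ⊢
      linarith
    have hfirst : (#(B 0) : ℝ) - #(M 0) ≤ endDeficiency G (s + 1) d T X (A 0) := by
      have hM : M 0 = M₀ := if_pos rfl
      rw [hB0, hM]; linarith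
    have hmids : ∑ j ∈ range s, ((#(B (j + 1)) : ℝ) - #(M (j + 1)))
        ≤ 2 * ∑ j ∈ range (s + 1), discrepancy G T (s + 1) d (A j) := by
      calc ∑ j ∈ range s, ((#(B (j + 1)) : ℝ) - #(M (j + 1)))
          ≤ ∑ j ∈ range s, (discrepancy G T (s + 1) d (A (j + 1))
            + discrepancy G T (s + 1) d (A j)) := by
            refine Finset.sum_le_sum fun j hj => ?_
            have hj' := mem_range.1 hj
            have hM : M (j + 1) = Mm (j + 1) := by simp [M, hj']
            rw [hBm (j + 1) (by omega) (by omega), hM]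
            have := hcm (j + 1)
            simp only [add_tsub_cancel_right] at this ⊢
            linarith
        _ ≤ _ := by
            rw [Finset.sum_add_distrib]
            have h1 := Finset.sum_range_succ (fun j => discrepancy G T (s + 1) d (A j)) s
            have h2 := Finset.sum_range_succ' (fun j => discrepancy G T (s + 1) d (A j)) s
            have h3 := discrepancy_nonneg (G := G) T (s + 1) d (A s)
            have h4 := discrepancy_nonneg (G := G) T (s + 1) d (A 0)
            linarith
    simp only [add_tsub_cancel_right]
    linarith

end LongPaths

/-! ### Packing subdivisions into an expander -/

/-- The sampling error for K = x^50, t = x^20 and minimum degree d/(2x²). The terms are 4x^94/d, at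
most 4/x^36 because of the exponent 130, and 1/x^30. -/
theorem layer_error_le {x d : ℝ} (hx : 100 ≤ x) (hd : x ^ 130 ≤ d) :
    x ^ 50 * ((x ^ 20) ^ 2 * d / (d / x ^ 2 / 2) ^ 2) + x ^ 20 / x ^ 50 ≤ 1 / x ^ 29 := by
  have hx0 : 0 < x := by linarith
  have hd0 : 0 < d := lt_of_lt_of_le (by positivity) hd
  have h1 : x ^ 50 * ((x ^ 20) ^ 2 * d / (d / x ^ 2 / 2) ^ 2) = 4 * x ^ 94 / d := by
    field_simp; ring
  have h2 : 4 * x ^ 94 / d ≤ 4 * x ^ 94 / x ^ 130 := by gcongr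
  have h3 : 4 * x ^ 94 / x ^ 130 = 4 / x ^ 36 := by field_simp
  have h4 : x ^ 20 / x ^ 50 = x ^ 6 / x ^ 36 := by field_simp
  have h5 : 1 / x ^ 29 = x ^ 7 / x ^ 36 := by field_simp
  rw [h1, h4, h5]
  refine (add_le_add_left (h2.trans_eq h3) _).trans ?_
  rw [← add_div]
  gcongr
  have h6 : (1 : ℝ) ≤ x ^ 6 := one_le_pow₀ (by linarith)
  have h7 : x ^ 7 = x * x ^ 6 := by ring
  rw [h7]
  nlinarith

section Cluster

variable {V W : Type*} [Fintype V] [Fintype W] {F : SimpleGraph W} {G : SimpleGraph V}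

/-- Vertices consumed by one hub: `m` points and at most `m ^ 2` linking paths, whose length comes
from doubling every 4`lam`² steps, `lam` + 1 times. -/
theorem hub_size_le {lam m w : ℕ} (hlam : 100 ≤ lam) (hw : w ≤ lam) (hm : m = lam * w) :
    m + m ^ 2 * (2 * (4 * lam ^ 2 * (lam + 1) + 1) + 1) ≤ lam ^ 9 := by
  have h1 : m ≤ lam ^ 2 := by rw [hm, sq]; gcongr
  have h2 : 2 * (4 * lam ^ 2 * (lam + 1) + 1) + 1 ≤ lam ^ 4 := by
    have h3 : 100 * lam ^ 3 ≤ lam ^ 4 := by rw [pow_succ' lam 3]; gcongr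
    have h4 : lam ^ 2 ≤ lam ^ 3 := Nat.pow_le_pow_right (by omega) (by omega)
    have h5 : 1 ≤ lam ^ 2 := Nat.one_le_pow _ _ (by omega)
    have h6 : 2 * (4 * lam ^ 2 * (lam + 1) + 1) + 1 = 8 * lam ^ 3 + 8 * lam ^ 2 + 3 := by ring
    omega
  calc _ ≤ lam ^ 2 + (lam ^ 2) ^ 2 * lam ^ 4 := by gcongr
    _ = lam ^ 2 * 1 + lam ^ 8 := by ring
    _ ≤ lam ^ 2 * lam ^ 6 + lam ^ 8 := by
        gcongr; exact Nat.one_le_pow _ _ (by omega)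
    _ = 2 * lam ^ 8 := by ring
    _ ≤ lam * lam ^ 8 := by gcongr; omega
    _ = lam ^ 9 := by ring

-- With s = Σ deg/d, about s/t paths with t interior vertices each cover about s vertices and leave
-- the deficit N - s. At most 5N/x is lost in building the paths and 4N/x in the parity correction.
set_option maxHeartbeats 4000000 in
theorem exists_packing_of_expandsIn [DecidableEq V] {w₀ w₁ : W} (hF : F.Adj w₀ w₁) {lam : ℕ}
    (hlam : 100 ≤ lam) (hW : Fintype.card W ≤ lam) {d : ℝ} (hd130 : (lam : ℝ) ^ 130 ≤ d)
    (hd : ∀ v, degIn G univ v ≤ d) (hexp : ExpandsIn G univ (d / lam ^ 2))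
    (hN : 2 ≤ Fintype.card V) (hl : Fintype.card V ≤ 2 ^ (lam + 1)) :
    ∃ 𝒮 : Set (Set V), (∀ S ∈ 𝒮, HasSubdivisionOn F G S) ∧ 𝒮.Pairwise Disjoint ∧
      ((⋃₀ 𝒮)ᶜ.ncard : ℝ) ≤ ∑ v, (1 - degIn G univ v / d) + 10 * (Fintype.card V / lam) := by
  classical
  have : Nonempty V := Fintype.card_pos_iff.1 (by omega)
  set x : ℝ := (lam : ℝ) with hxdef
  have hx : 100 ≤ x := by rw [hxdef]; exact_mod_cast hlam
  have hx0 : 0 < x := by linarith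
  have hd0 : 0 < d := lt_of_lt_of_le (by positivity) hd130
  set c : ℝ := d / x ^ 2 with hcdef
  have hc : 0 < c := by positivity
  have hx2 : 1 ≤ x ^ 2 := one_le_pow₀ (by linarith)
  have hcd : c ≤ d := div_le_self hd0.le hx2
  have hdc : d / c = x ^ 2 := by rw [hcdef]; field_simp
  have hdcx : d = x ^ 2 * c := by rw [hcdef]; field_simp
  have hcv : ∀ v, c ≤ degIn G univ v := fun v => hexp.le_degIn hN (mem_univ v)
  have hpos : ∀ v, 0 < degIn G univ v := fun v => hc.trans_le (hcv v)
  set N : ℝ := (Fintype.card V : ℝ) with hNdef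
  have hc128 : x ^ 128 ≤ c := by
    rw [hcdef, le_div_iff₀ (by positivity)]
    calc x ^ 128 * x ^ 2 = x ^ 130 := by ring
      _ ≤ d := hd130
  have hN128 : x ^ 128 ≤ N := by
    obtain ⟨v⟩ := this
    exact hc128.trans ((hcv v).trans ((degIn_le_card G univ v).trans_eq (by rw [card_univ])))
  have hN0 : 0 < N := lt_of_lt_of_le (by positivity) hN128
  have hpow : ∀ j k : ℕ, j ≤ k → N / x ^ k ≤ N / x ^ j := fun j k hjk => by
    gcongr; linarith
  have hNx : ∀ k : ℕ, N / x ^ (k + 1) ≤ N / x ^ k / 100 := by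
    intro k
    rw [pow_succ, ← div_div]
    gcongr
  obtain ⟨t, htdef⟩ : ∃ t : ℕ, t = lam ^ 20 := ⟨_, rfl⟩
  have htx : (t : ℝ) = x ^ 20 := by rw [htdef, hxdef]; push_cast; rfl
  have ht : 0 < t := by rw [htdef]; positivity
  have ht2 : 2 ≤ t := by
    rw [htdef]
    calc 2 ≤ lam ^ 1 := by rw [pow_one]; omega
      _ ≤ lam ^ 20 := Nat.pow_le_pow_right (by omega) (by omega)
  have ht0 : (0 : ℝ) < t := by exact_mod_cast ht
  obtain ⟨δ, hδ⟩ : ∃ δ : ℝ, δ = N / x ^ 29 := ⟨_, rfl⟩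
  have herr : ∀ c', c / 2 ≤ c' → (x ^ 50 * (t ^ 2 * d / c' ^ 2) + t / x ^ 50) * N ≤ δ := by
    intro c' hc'
    have h1 := layer_error_le hx hd130
    have h3 : δ = 1 / x ^ 29 * N := by rw [hδ]; ring
    rw [h3, htx]
    refine mul_le_mul_of_nonneg_right (le_trans ?_ h1) hN0.le
    have h2 : (0 : ℝ) < d / x ^ 2 / 2 := by positivity
    gcongr
  -- first sampling
  obtain ⟨A₀, -, hA₀d, hA₀⟩ := exists_layers (G := G) ht hc hd0 (K := x ^ 50) (by positivity) hd
    univ ∅ (by simp) (fun v _ => hcv v) (by simp)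
  simp only [sum_empty, add_zero] at hA₀
  replace hA₀ := hA₀.trans (herr c (by linarith))
  have hdisc : ∀ j < t, discrepancy G univ t d (A₀ j) ≤ δ := fun j hj =>
    (Finset.single_le_sum (f := fun j => discrepancy G univ t d (A₀ j))
      (fun i _ => discrepancy_nonneg _ _ _ _) (mem_range.2 hj)).trans hA₀
  set X := A₀ 0
  set Y := A₀ 1
  have hXY : Disjoint X Y := hA₀d 0 1 (by omega)
  have hDX : discrepancy G univ t d X ≤ δ := hdisc 0 (by omega)
  have hDY : discrepancy G univ t d Y ≤ δ := hdisc 1 (by omega)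
  obtain ⟨s, hs⟩ : ∃ s : ℝ, s = ∑ v, degIn G univ v / d := ⟨_, rfl⟩
  have hcX := abs_le.1 ((abs_card_sub_le_discrepancy hd0 hd (T := univ) (t := t)
    (fun v _ => hpos v) (subset_univ X)).trans hDX)
  have hcY := abs_le.1 ((abs_card_sub_le_discrepancy hd0 hd (T := univ) (t := t)
    (fun v _ => hpos v) (subset_univ Y)).trans hDY)
  rw [← hs] at hcX hcY
  have hsN : s ≤ N := by
    calc s ≤ ∑ v : V, 1 := hs.trans_le <| Finset.sum_le_sum fun v _ => (div_le_one hd0).2 (hd v)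
      _ = N := by simp [hNdef]
  have hs2 : N / x ^ 2 ≤ s := by
    calc N / x ^ 2 = ∑ v : V, c / d := by
          rw [hdcx]
          simp only [sum_const, card_univ, nsmul_eq_mul, ← hNdef]
          field_simp
      _ ≤ ∑ v, degIn G univ v / d := Finset.sum_le_sum fun v _ => by gcongr; exact hcv v
      _ = s := hs.symm
  have hδ4 : δ ≤ N / x ^ 4 := hδ.trans_le (hpow 4 29 (by omega))
  -- the sizes of the hub system
  obtain ⟨β, hβ⟩ : ∃ β : ℕ, β = ⌊N / (x ^ 20 * x ^ 4)⌋₊ := ⟨_, rfl⟩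
  have htβ : t * (β : ℝ) ≤ N / x ^ 4 := by
    have h1 : (β : ℝ) ≤ N / (x ^ 20 * x ^ 4) := by
      rw [hβ]; exact Nat.floor_le (by positivity)
    calc t * (β : ℝ) ≤ x ^ 20 * (N / (x ^ 20 * x ^ 4)) := by rw [htx]; gcongr
      _ = N / x ^ 4 := by field_simp
  have h23 := hNx 2
  have h34 := hNx 3
  have hN4 : 0 < N / x ^ 4 := by positivity
  have hβX : β ≤ #X := by
    have : (t : ℝ) * β ≤ t * #X := by linarith
    exact_mod_cast le_of_mul_le_mul_left this ht0
  have hβY : β ≤ #Y := by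
    have : (t : ℝ) * β ≤ t * #Y := by linarith
    exact_mod_cast le_of_mul_le_mul_left this ht0
  -- As many groups of `lam` vertices as fit into both `X` and `Y` with `β` vertices to spare.
  obtain ⟨r, hr⟩ : ∃ r : ℕ, r = (min #X #Y - β) / lam := ⟨_, rfl⟩
  have hr1 : r * lam ≤ min #X #Y - β := by rw [hr]; exact Nat.div_mul_le_self _ _
  have hr2 : min #X #Y - β < r * lam + lam := by
    rw [hr]
    have := Nat.lt_div_mul_add (a := min #X #Y - β) (b := lam) (by omega)
    exact this
  have hrX : r * lam + β ≤ #X := by have := min_le_left #X #Y; omega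
  have hrY : r * lam + β ≤ #Y := by have := min_le_right #X #Y; omega
  have hrlow : s - δ - N / x ^ 4 - N / x ^ 4 ≤ t * (r * x) := by
    have h1 : min #X #Y ≤ r * lam + lam + β := by omega
    have h2 : s - δ ≤ t * (min #X #Y : ℕ) := by
      rcases min_choice #X #Y with h | h <;> rw [h] <;> linarith
    have h3 : ((min #X #Y : ℕ) : ℝ) ≤ r * x + x + β := by rw [hxdef]; exact_mod_cast h1
    have h4 : (t : ℝ) * (min #X #Y : ℕ) ≤ t * (r * x + x + β) := by gcongr
    have h5 : t * x ≤ N / x ^ 4 := by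
      rw [htx, le_div_iff₀ (by positivity)]
      calc x ^ 20 * x * x ^ 4 = x ^ 25 := by ring
        _ ≤ x ^ 128 := pow_le_pow_right₀ (by linarith) (by omega)
        _ ≤ N := hN128
    linarith
  have htX : (t : ℝ) * #X ≤ 2 * N := by
    have : N / x ^ 4 ≤ N := div_le_self hN0.le (one_le_pow₀ (by linarith))
    linarith
  have htr : (t : ℝ) * (r * x) ≤ 2 * N := by
    refine le_trans ?_ htX
    have : ((r * lam : ℕ) : ℝ) ≤ #X := by exact_mod_cast (by omega : r * lam ≤ #X)
    push_cast at this
    gcongr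
  obtain ⟨m, hm⟩ : ∃ m : ℕ, m = lam * Fintype.card W := ⟨_, rfl⟩
  obtain ⟨g, hg⟩ : ∃ g : ℕ, g = m + m ^ 2 * (2 * (4 * lam ^ 2 * (lam + 1) + 1) + 1) := ⟨_, rfl⟩
  have hg9 : (g : ℝ) ≤ x ^ 9 := by
    rw [hxdef, hg]; exact_mod_cast hub_size_le hlam hW hm
  have hm2 : (m : ℝ) ≤ x ^ 2 := by
    have : m ≤ lam ^ 2 := by rw [hm, sq]; gcongr
    rw [hxdef]; exact_mod_cast this
  obtain ⟨κ, hκdef⟩ : ∃ κ : ℕ, κ = #(X ∪ Y) + 2 * r * g := ⟨_, rfl⟩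
  -- `X` and `Y` have order N/t vertices. The 2r hubs, with r at most 2N/(tx), consume at most x^9
  -- each, hence order N x^8/t in total.
  have hκ : (κ : ℝ) ≤ N / x ^ 10 := by
    have h1 : (#(X ∪ Y) : ℝ) ≤ #X + #Y := by exact_mod_cast card_union_le X Y
    have h2 : t * (#(X ∪ Y) : ℝ) ≤ 4 * N := by nlinarith
    have h3 : (t : ℝ) * (2 * r * g) ≤ 4 * N * x ^ 8 := by
      have h4 : (t : ℝ) * (2 * r * g) ≤ t * (2 * r * x ^ 9) := by gcongr
      have h5 : (t : ℝ) * (2 * r * x ^ 9) = 2 * x ^ 8 * (t * (r * x)) := by ring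
      have h6 : 2 * x ^ 8 * (t * (r * x)) ≤ 2 * x ^ 8 * (2 * N) := by gcongr
      linarith
    have h4 : (t : ℝ) * κ ≤ 4 * N + 4 * N * x ^ 8 := by
      rw [hκdef]; push_cast; linarith
    have h5 : 4 * N + 4 * N * x ^ 8 ≤ N * x ^ 10 := by
      have h6 : (1 : ℝ) ≤ x ^ 8 := one_le_pow₀ (by linarith)
      have h7 : N * x ^ 10 = (N * x ^ 8) * x ^ 2 := by ring
      have h8 : (100 : ℝ) ^ 2 ≤ x ^ 2 := by gcongr
      have h9 : N ≤ N * x ^ 8 := le_mul_of_one_le_right hN0.le h6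
      rw [h7]
      nlinarith
    rw [le_div_iff₀ (by positivity)]
    have h6 : (t : ℝ) * (κ * x ^ 10) ≤ t * N := by
      calc (t : ℝ) * (κ * x ^ 10) = t * κ * x ^ 10 := by ring
        _ ≤ N * x ^ 10 * x ^ 10 := mul_le_mul_of_nonneg_right (h4.trans h5) (by positivity)
        _ = t * N := by rw [htx]; ring
    exact le_of_mul_le_mul_left h6 ht0
  have hUκ : ∀ U : Finset V, c * #Uᶜ ≤ 3 * d * κ → (#Uᶜ : ℝ) ≤ N / x ^ 7 := by
    intro U hU
    have h1 : c * #Uᶜ ≤ c * (3 * x ^ 2 * κ) := by rw [hdcx] at hU; linarith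
    have h2 := le_of_mul_le_mul_left h1 hc
    calc (#Uᶜ : ℝ) ≤ 3 * x ^ 2 * κ := h2
      _ ≤ 3 * x ^ 2 * (N / x ^ 10) := by gcongr
      _ = 3 * (N / x ^ 8) := by field_simp
      _ ≤ N / x ^ 7 := by have := hNx 7; have : 0 < N / x ^ 7 := by positivity
                          linarith
  have hκexp : 18 * d ^ 2 * κ ≤ c ^ 2 * Fintype.card V := by
    rw [← hNdef, hdcx]
    have h1 : 18 * (x ^ 2 * c) ^ 2 * κ = c ^ 2 * (18 * x ^ 4 * κ) := by ring
    rw [h1]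
    have h2 : 18 * x ^ 4 * κ ≤ N := by
      calc 18 * x ^ 4 * κ ≤ 18 * x ^ 4 * (N / x ^ 10) := by gcongr
        _ = 18 * (N / x ^ 6) := by field_simp
        _ ≤ N := by
          have h3 := hNx 5
          have h4 : N / x ^ 5 ≤ N := div_le_self hN0.le (one_le_pow₀ (by linarith))
          linarith
    gcongr
  have hbad : ∀ U, c * #Uᶜ ≤ 3 * d * κ → ∀ Z, (Z ⊆ X ∨ Z ⊆ Y) →
      (∀ v ∈ Z, degIn G U v < c / 2) → #Z ≤ β := by
    intro U hU Z hZ hZU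
    have h1 : c / 2 * #Z ≤ d / t * (#Uᶜ + δ) := by
      rcases hZ with hZ | hZ
      · refine (card_le_of_degIn_lt ht hc hd0 hd hcv hZ hZU).trans ?_
        gcongr
      · refine (card_le_of_degIn_lt ht hc hd0 hd hcv hZ hZU).trans ?_
        gcongr
    rw [hβ]
    refine Nat.le_floor ?_
    have h2 := hUκ U hU
    have h3 : δ ≤ N / x ^ 7 := hδ.trans_le (hpow 7 29 (by omega))
    have h4 : c / 2 * #Z ≤ c / 2 * (2 * x ^ 2 / x ^ 20 * (2 * (N / x ^ 7))) := by
      calc c / 2 * #Z ≤ d / t * (#Uᶜ + δ) := h1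
        _ ≤ d / t * (N / x ^ 7 + N / x ^ 7) := by gcongr
        _ = c / 2 * (2 * x ^ 2 / x ^ 20 * (2 * (N / x ^ 7))) := by
          rw [htx]
          conv_lhs => rw [hdcx]
          ring
    have h5 := le_of_mul_le_mul_left h4 (by positivity)
    refine h5.trans ?_
    have h6 : 2 * x ^ 2 / x ^ 20 * (2 * (N / x ^ 7)) = 4 * (N / x ^ 5) / x ^ 20 := by
      field_simp; norm_num
    have h7 : N / (x ^ 20 * x ^ 4) = N / x ^ 4 / x ^ 20 := by field_simp
    rw [h6, h7]
    gcongr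
    have := hNx 4
    linarith
  obtain ⟨IX, IY, hub, b, A, Q, hIX, hIY, hIXc, hIYc, hsys, hQ, hQc, hhX, hhY⟩ :=
    exists_isHubSystem (G := G) w₀ (X := X) (Y := Y) hc hcd hd hexp (q := 4 * lam ^ 2)
      (l := lam + 1) (by push_cast; rw [← hxdef, hdcx]; linarith) hl hN (m := m) (B := lam)
      (β := β) (κ := κ) (r := r) (g := g) hm hg
      (by
        rw [hdcx]
        calc 16 * (x ^ 2 * c) * g ≤ 16 * (x ^ 2 * c) * x ^ 9 := by gcongr
          _ = c * (16 * x ^ 11) := by ring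
          _ ≤ c * c := by
            gcongr
            refine le_trans ?_ hc128
            calc 16 * x ^ 11 ≤ x * x ^ 11 := by gcongr; linarith
              _ = x ^ 12 := by ring
              _ ≤ x ^ 128 := pow_le_pow_right₀ (by linarith) (by omega)
          _ = c ^ 2 := by ring) hκexp hκdef.ge hbad
      (by
        rw [← hNdef]
        have h1 : c * m + 3 * d * κ = c * (m + 3 * x ^ 2 * κ) := by rw [hdcx]; ring
        rw [h1]
        gcongr
        have h2 : 3 * x ^ 2 * (κ : ℝ) ≤ N / 2 := by
          calc 3 * x ^ 2 * (κ : ℝ) ≤ 3 * x ^ 2 * (N / x ^ 10) := by gcongr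
            _ = 3 * (N / x ^ 8) := by field_simp
            _ ≤ N / 2 := by
              have h3 := hNx 7
              have h4 : N / x ^ 7 ≤ N := div_le_self hN0.le (one_le_pow₀ (by linarith))
              linarith
        have h3 : (m : ℝ) ≤ N / 2 := by
          have h4 : x ^ 3 ≤ x ^ 128 := pow_le_pow_right₀ (by linarith) (by omega)
          have h5 : x ^ 3 = x * x ^ 2 := by ring
          nlinarith
        linarith) hrX hrY hXY
  -- second sampling
  have hQκ : (#(X ∪ Y ∪ Q) : ℝ) ≤ κ := by
    have : #(X ∪ Y ∪ Q) ≤ κ := hκdef ▸ (card_union_le _ _).trans (Nat.add_le_add_left hQc _)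
    exact_mod_cast this
  -- The layers are sampled only after the hubs are removed, in a set where degrees are still at
  -- least c/2.
  obtain ⟨T, hTQ, hTc, hTexp⟩ := exists_expandsIn_disjoint hc hcd hd hexp (X ∪ Y ∪ Q)
    (le_trans (by gcongr) hκexp)
  have hTu := hUκ T (hTc.trans (by gcongr))
  rw [disjoint_union_right] at hTQ
  have hTdeg : ∀ v ∈ T, c / 2 ≤ degIn G T v := fun v hv => hTexp.le_degIn hN hv
  obtain ⟨A₁, hA₁T, hA₁d, hA₁⟩ := exists_layers (G := G) ht (c := c / 2) (by positivity) hd0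
    (K := x ^ 50) (by positivity) hd T (X ∪ Y) hTQ.1 hTdeg
    (fun v _ => (by linarith [hcv v]))
  replace hA₁ := hA₁.trans (herr (c / 2) le_rfl)
  obtain ⟨E, g', L, hE, hg', hgY, hLT, hLp, hLd, hEc⟩ := exists_long_paths (G := G) (t := t) ht hd0
    hpos hIX hIY hXY hTQ.1 A₁ hA₁T hA₁d
  have hterm : ∀ j < t, discrepancy G T t d (A₁ j) +
      ∑ v ∈ X ∪ Y, |∑ u ∈ A₁ j, pairWeight G univ t d v u - expectedWeight G T v| ≤ δ := by
    intro j hj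
    refine (Finset.single_le_sum (f := fun j => discrepancy G T t d (A₁ j) +
      ∑ v ∈ X ∪ Y, |∑ u ∈ A₁ j, pairWeight G univ t d v u - expectedWeight G T v|)
      (fun i _ => add_nonneg (discrepancy_nonneg _ _ _ _)
        (Finset.sum_nonneg fun _ _ => abs_nonneg _)) (mem_range.2 hj)).trans hA₁
  have hend : ∀ Z, Z ⊆ X ∪ Y → discrepancy G univ t d Z ≤ δ → ∀ j < t,
      t * endDeficiency G t d T Z (A₁ j) ≤ N / x ^ 3 := by
    intro Z hZ hDZ j hj
    have h1 := sum_one_sub_expectedWeight_le ht hc hcd hd hcv T Z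
    have h2 : ∑ v ∈ Z, |∑ u ∈ A₁ j, pairWeight G univ t d v u - expectedWeight G T v| ≤ δ := by
      refine le_trans (Finset.sum_le_sum_of_subset_of_nonneg hZ fun _ _ _ => abs_nonneg _) ?_
      have := hterm j hj
      have := discrepancy_nonneg (G := G) T t d (A₁ j)
      linarith
    have h3 : (1 + d / c) * #Tᶜ ≤ N / x ^ 4 := by
      rw [hdc]
      calc (1 + x ^ 2) * (#Tᶜ : ℝ) ≤ (x ^ 2 + x ^ 2) * (N / x ^ 7) :=
            mul_le_mul (by linarith) hTu (Nat.cast_nonneg _) (by positivity)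
        _ = 2 * (N / x ^ 5) := by field_simp; ring
        _ ≤ N / x ^ 4 := by have := hNx 4; linarith
    have h4 : t * δ ≤ N / x ^ 4 := by
      calc t * δ = N / x ^ 9 := by rw [htx, hδ]; field_simp
        _ ≤ N / x ^ 4 := hpow 4 9 (by omega)
    have h5 : t * endDeficiency G t d T Z (A₁ j) ≤ N / x ^ 4 + δ + t * δ + t * δ := by
      rw [endDeficiency, mul_add, mul_add]
      have h6 : t * ∑ v ∈ Z, |∑ u ∈ A₁ j, pairWeight G univ t d v u - expectedWeight G T v|
        ≤ t * δ := by gcongr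
      have h7 : t * discrepancy G univ t d Z ≤ t * δ := by gcongr
      linarith
    linarith
  have hcA : t * (#(A₁ (t - 1)) : ℝ) ≤ s + δ := by
    have h1 := (abs_le.1 (abs_card_sub_le_discrepancy hd0 hd (T := T) (t := t)
      (fun v hv => lt_of_lt_of_le (by positivity) (hTdeg v hv)) (hA₁T (t - 1)))).2
    have h2 := hterm (t - 1) (by omega)
    have h3 : 0 ≤ ∑ v ∈ X ∪ Y, |∑ u ∈ A₁ (t - 1), pairWeight G univ t d v u
      - expectedWeight G T v| := Finset.sum_nonneg fun _ _ => abs_nonneg _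
    have h4 : ∑ v ∈ T, degIn G T v / d ≤ s := by
      calc ∑ v ∈ T, degIn G T v / d ≤ ∑ v ∈ T, degIn G univ v / d :=
            Finset.sum_le_sum fun v _ => by
              gcongr; exact degIn_mono G (subset_univ T) v
        _ ≤ s := hs ▸ Finset.sum_le_sum_of_subset_of_nonneg (subset_univ T) fun v _ _ =>
            div_nonneg (hpos v).le hd0.le
    linarith
  have hsumA : ∑ j ∈ range t, discrepancy G T t d (A₁ j) ≤ δ := by
    refine le_trans (Finset.sum_le_sum fun j _ => ?_) hA₁
    exact le_add_of_nonneg_right (Finset.sum_nonneg fun _ _ => abs_nonneg _)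
  -- Each loss, multiplied by t, is at most of order N/x³.
  have hEt : s - 5 * (N / x) ≤ t * #E := by
    have h1 := hend X subset_union_left hDX 0 ht
    have h2 := hend Y subset_union_right hDY (t - 1) (by omega)
    have h3 : t * δ ≤ N / x ^ 4 := by
      calc t * δ = N / x ^ 9 := by rw [htx, hδ]; field_simp
        _ ≤ N / x ^ 4 := hpow 4 9 (by omega)
    rw [hIXc, hIYc] at hEc
    push_cast at hEc
    rw [← hxdef] at hEc
    have h4 := mul_le_mul_of_nonneg_left hEc ht0.le
    have h5 : (t : ℝ) * ∑ j ∈ range t, discrepancy G T t d (A₁ j) ≤ t * δ := by gcongr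
    have h6 := hNx 1
    rw [pow_one] at h6
    have h7 : 0 < N / x := by positivity
    linarith
  obtain ⟨𝒮, h𝒮, h𝒮d, E₀, hE₀, hE₀c, hcov⟩ := exists_packing_of_hubs hF hsys
    (disjoint_of_subset_right (union_subset_union hIX hIY) hQ) hhX hhY hE hg' hgY L hLp
    (fun v hv => disjoint_of_subset_left (hLT v hv).1
      (disjoint_of_subset_right (union_subset_union hIX hIY) hTQ.1))
    (fun v hv => disjoint_of_subset_left (hLT v hv).1 hTQ.2) hLd
  refine ⟨𝒮, h𝒮, h𝒮d, ?_⟩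
  have h1 : #(E₀.biUnion L) = #E₀ * t := by
    rw [card_biUnion fun v hv w hw => hLd v (hE₀ hv) w (hE₀ hw)]
    exact Finset.sum_const_nat fun v hv => (hLT v (hE₀ hv)).2
  have h2 : (⋃₀ 𝒮)ᶜ.ncard ≤ #(E₀.biUnion L)ᶜ := by
    rw [← Set.ncard_coe_finset]
    refine Set.ncard_le_ncard ?_ (Set.toFinite _)
    rw [coe_compl, Set.compl_subset_compl]
    intro z hz
    obtain ⟨v, hv, hzv⟩ := mem_biUnion.1 (mem_coe.1 hz)
    exact hcov v hv hzv
  have h3 : (#(E₀.biUnion L)ᶜ : ℝ) = N - t * #E₀ := by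
    rw [card_compl, Nat.cast_sub (card_le_univ _), h1]; push_cast; ring
  have h4 : (#E : ℝ) ≤ #E₀ + 2 * r := by exact_mod_cast hE₀c
  -- At most as many paths as hubs are given up. A hub has `lam` base vertices, so this is about a
  -- fraction 1/x of all paths.
  have h5 : (t : ℝ) * (2 * r) ≤ 4 * (N / x) := by
    have : (t : ℝ) * (2 * r) = 2 * (t * (r * x)) / x := by field_simp
    rw [this, mul_div_assoc']
    exact div_le_div_of_nonneg_right (by linarith) hx0.le
  have h6 : ((⋃₀ 𝒮)ᶜ.ncard : ℝ) ≤ N - t * #E₀ := by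
    rw [← h3]; exact_mod_cast h2
  have h7 := mul_le_mul_of_nonneg_left h4 ht0.le
  have h8 : ∑ v, (1 - degIn G univ v / d) = N - s := by
    rw [Finset.sum_sub_distrib]; simp [hNdef, hs]
  have h9 : 0 < N / x := by positivity
  rw [h8]
  linarith

end Cluster

/-! ### Subdivisions along embeddings -/

theorem HasSubdivisionOn.map {W V V' : Type*} {F : SimpleGraph W} {G : SimpleGraph V}
    {G' : SimpleGraph V'} (f : G ↪g G') {S : Set V} (h : HasSubdivisionOn F G S) :
    HasSubdivisionOn F G' (f '' S) := by
  obtain ⟨K, ⟨b, P, hb, hP, hPr, hav, hdis, hv, he⟩, rfl⟩ := h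
  have hf : Function.Injective f.toHom := f.injective
  refine ⟨K.map f.toHom, ⟨fun w => f.toHom (b w), fun u v h => (P u v h).map f.toHom,
    hf.comp hb, fun u v h => (hP u v h).map hf, ?_, ?_, ?_, ?_, ?_⟩, rfl⟩
  · intro u v h
    change (P v u h.symm).map f.toHom = _
    rw [hPr, SimpleGraph.Walk.reverse_map]
  · intro u v h w hw
    rw [SimpleGraph.Walk.support_map, List.mem_map_of_injective hf] at hw
    exact hav u v h w hw
  · intro u v h u' v' h' hne x hx hx'
    rw [SimpleGraph.Walk.support_map, List.mem_map] at hx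
    obtain ⟨y, hy, rfl⟩ := hx
    rw [SimpleGraph.Walk.support_map, List.mem_map_of_injective hf] at hx'
    obtain ⟨w, hw⟩ := hdis u v h u' v' h' hne y hy hx'
    exact ⟨w, congrArg _ hw⟩
  · intro x
    simp only [SimpleGraph.Subgraph.map_verts, Set.mem_image, hv, SimpleGraph.Walk.support_map,
      List.mem_map, Set.mem_range]
    constructor
    · rintro ⟨y, ⟨w, rfl⟩ | ⟨u, v, h, hy⟩, rfl⟩
      · exact Or.inl ⟨w, rfl⟩
      · exact Or.inr ⟨u, v, h, y, hy, rfl⟩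
    · rintro (⟨w, rfl⟩ | ⟨u, v, h, y, hy, rfl⟩)
      · exact ⟨b w, Or.inl ⟨w, rfl⟩, rfl⟩
      · exact ⟨y, Or.inr ⟨u, v, h, hy⟩, rfl⟩
  · intro x y
    simp only [SimpleGraph.Subgraph.map_adj, Relation.Map, he, SimpleGraph.Walk.edges_map,
      List.mem_map]
    constructor
    · rintro ⟨a, c, ⟨u, v, h, hac⟩, rfl, rfl⟩
      exact ⟨u, v, h, s(a, c), hac, rfl⟩
    · rintro ⟨u, v, h, e, hm, hxy⟩
      induction e using Sym2.ind with
      | _ a c =>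
        rw [Sym2.map_mk, Sym2.eq_iff] at hxy
        rcases hxy with ⟨rfl, rfl⟩ | ⟨rfl, rfl⟩
        · exact ⟨a, c, ⟨u, v, h, hm⟩, rfl, rfl⟩
        · exact ⟨c, a, ⟨u, v, h, Sym2.eq_swap ▸ hm⟩, rfl, rfl⟩

theorem hasSubdivisionOn_range_of_edgeless {W V : Type*} {F : SimpleGraph W} {G : SimpleGraph V}
    (hF : ∀ u v, ¬ F.Adj u v) {b : W → V} (hb : Function.Injective b) :
    HasSubdivisionOn F G (Set.range b) := by
  have := hasSubdivisionOn_of_paths (F := F) (G := G) (fun _ => (∅ : Set V)) hb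
    (fun u v h => absurd h (hF u v)) (fun _ _ _ => id) (fun _ _ _ _ _ => Set.disjoint_empty _)
  simp only [Set.mem_empty_iff_false, and_false, exists_false, or_false] at this
  exact this

/-- If `F` has no edge, then all but fewer than `|W|` vertices can be covered. -/
theorem exists_packing_of_edgeless {W V : Type*} [Fintype W] [Fintype V] [Nonempty W]
    {F : SimpleGraph W} (G : SimpleGraph V) (hF : ∀ u v, ¬ F.Adj u v) :
    ∃ 𝒮 : Set (Set V), (∀ S ∈ 𝒮, HasSubdivisionOn F G S) ∧ 𝒮.Pairwise Disjoint ∧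
      (⋃₀ 𝒮)ᶜ.ncard ≤ Fintype.card W := by
  classical
  let e := Fintype.equivFin V
  let w := Fintype.equivFin W
  set k := Fintype.card W with hk
  have hk0 : 0 < k := Fintype.card_pos
  set n := Fintype.card V with hn
  -- Consecutive blocks of `k` vertices in an arbitrary numbering; only the n mod k last ones
  -- remain.
  let b : Fin (n / k) → W → V := fun i x => e.symm ⟨i * k + w x, by
    have h1 : (i + 1 : ℕ) * k ≤ n / k * k := Nat.mul_le_mul_right _ i.2
    have h2 := Nat.div_mul_le_self n k
    have h3 := (w x).2
    rw [add_mul] at h1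
    omega⟩
  have hbv : ∀ i x, (e (b i x) : ℕ) = i * k + w x := fun i x => by simp [b]
  have hdiv : ∀ i x, (e (b i x) : ℕ) / k = i := fun i x => by
    rw [hbv, add_comm, Nat.add_mul_div_right _ _ hk0, Nat.div_eq_of_lt (w x).2, zero_add]
  refine ⟨Set.range fun i => Set.range (b i), ?_, ?_, ?_⟩
  · rintro _ ⟨i, rfl⟩
    refine hasSubdivisionOn_range_of_edgeless hF fun x y hxy => ?_
    have h1 := hbv i x
    rw [hxy, hbv] at h1
    exact w.injective (Fin.ext (by omega))
  · rintro _ ⟨i, rfl⟩ _ ⟨j, rfl⟩ hij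
    refine Set.disjoint_left.2 ?_
    rintro _ ⟨x, rfl⟩ ⟨y, hxy⟩
    have h1 := hdiv i x
    rw [← hxy, hdiv] at h1
    exact hij (by rw [Fin.ext h1])
  · have h1 : (⋃₀ Set.range fun i => Set.range (b i))ᶜ ⊆
        Set.range fun x : Fin (n % k) => e.symm ⟨n / k * k + x, by
          have := x.2; have := Nat.div_add_mod' n k; omega⟩ := by
      intro v hv
      have h2 : n / k * k ≤ (e v : ℕ) := by
        by_contra hlt
        rw [not_le] at hlt
        refine hv ⟨_, ⟨⟨(e v : ℕ) / k, (Nat.div_lt_iff_lt_mul hk0).2 hlt⟩, rfl⟩,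
          w.symm ⟨(e v : ℕ) % k, Nat.mod_lt _ hk0⟩, ?_⟩
        apply e.injective
        apply Fin.ext
        rw [hbv]
        simp [Nat.div_add_mod']
      have h3 := Nat.div_add_mod' n k
      have h4 := (e v).2
      refine ⟨⟨(e v : ℕ) - n / k * k, by omega⟩, ?_⟩
      rw [Equiv.symm_apply_eq]
      exact Fin.ext (by simp only; omega)
    refine (Set.ncard_le_ncard h1 (Set.toFinite _)).trans ?_
    rw [← Set.image_univ]
    refine (Set.ncard_image_le (Set.toFinite _)).trans ?_
    rw [Set.ncard_univ, Nat.card_fin]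
    exact (Nat.mod_lt _ hk0).le

/-! ### Decomposition into expanders -/

/-- The smaller side at least doubles when merged, gaining one bit per vertex: a log a + a = a
log(2a). -/
theorem mul_logb_add_le {a b : ℕ} (ha : 0 < a) (hab : a ≤ b) :
    a * Real.logb 2 a + b * Real.logb 2 b + a ≤ (a + b : ℕ) * Real.logb 2 (a + b : ℕ) := by
  have ha' : (0 : ℝ) < a := by exact_mod_cast ha
  have hab' : (a : ℝ) ≤ b := by exact_mod_cast hab
  have h1 : Real.logb 2 a + 1 ≤ Real.logb 2 (a + b : ℕ) := by
    have h2 : Real.logb 2 a + 1 = Real.logb 2 (a * 2) := by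
      rw [Real.logb_mul ha'.ne' two_ne_zero, Real.logb_self_eq_one one_lt_two]
    rw [h2]
    refine Real.logb_le_logb_of_le one_lt_two (by positivity) ?_
    push_cast
    linarith
  have h2 : Real.logb 2 b ≤ Real.logb 2 (a + b : ℕ) := by
    refine Real.logb_le_logb_of_le one_lt_two (by linarith) ?_
    push_cast
    linarith
  have h3 := mul_le_mul_of_nonneg_left h1 ha'.le
  have h4 := mul_le_mul_of_nonneg_left h2 (ha'.le.trans hab')
  push_cast at h3 h4 ⊢
  linarith

theorem natCast_mul_logb_nonneg (n : ℕ) : 0 ≤ (n : ℝ) * Real.logb 2 n := by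
  rcases Nat.eq_zero_or_pos n with rfl | hn
  · simp
  · exact mul_nonneg n.cast_nonneg (Real.logb_nonneg one_lt_two (by exact_mod_cast hn))

/-- Every cut edge lowers the degree of both of its ends, whence the factor 2. -/
theorem sum_deficit_split {V : Type*} [DecidableEq V] {G : SimpleGraph V} {d : ℝ} {S C : Finset V} (hS : S ⊆ C) :
    ∑ v ∈ S, (1 - degIn G S v / d) + ∑ v ∈ C \ S, (1 - degIn G (C \ S) v / d) =
      ∑ v ∈ C, (1 - degIn G C v / d) + 2 * ((∑ v ∈ S, degIn G (C \ S) v) / d) := by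
  have hdeg : ∀ v, degIn G C v = degIn G S v + degIn G (C \ S) v := fun v => by
    rw [← degIn_union G disjoint_sdiff, union_sdiff_of_subset hS]
  have h1 : ∑ v ∈ C \ S, degIn G S v = ∑ v ∈ S, degIn G (C \ S) v := sum_degIn_comm _ _ _
  rw [← sum_sdiff hS]
  simp only [hdeg, sum_sub_distrib, add_div, sum_add_distrib, ← sum_div, h1]
  ring

theorem degIn_comap_subtype {V : Type*} (G : SimpleGraph V) (C : Finset V) (T : Finset C) (v : C) :
    degIn (G.comap ((↑) : C → V)) T v = degIn G (T.map (Function.Embedding.subtype _)) v := by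
  rw [degIn, degIn, sum_map]
  rfl

theorem degIn_comap_subtype_univ {V : Type*} (G : SimpleGraph V) (C : Finset V) (v : C) :
    degIn (G.comap ((↑) : C → V)) univ v = degIn G C v := by
  rw [degIn_comap_subtype, univ_eq_attach, attach_map_val]

section Decomposition

variable {V W : Type*} [Fintype V] [Fintype W] [DecidableEq V] {F : SimpleGraph W}
  {G : SimpleGraph V}

/-- `ExpandsIn` measures halves against the whole vertex type, so the argument passes to the graph
induced on the subtype `C` and back. -/
theorem exists_packing_of_expandsIn_subset {w₀ w₁ : W} (hF : F.Adj w₀ w₁) {lam : ℕ}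
    (hlam : 100 ≤ lam) (hW : Fintype.card W ≤ lam) {d : ℝ} (hd130 : (lam : ℝ) ^ 130 ≤ d)
    (hd : ∀ v, degIn G univ v ≤ d) (hl : Fintype.card V ≤ 2 ^ (lam + 1)) {C : Finset V}
    (hC : 2 ≤ #C)
    (hexp : ∀ S ⊆ C, 2 * #S ≤ #C → d / lam ^ 2 * #S ≤ ∑ v ∈ S, degIn G (C \ S) v) :
    ∃ 𝒮 : Set (Set V), (∀ S ∈ 𝒮, HasSubdivisionOn F G S ∧ S ⊆ C) ∧ 𝒮.Pairwise Disjoint ∧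
      (((C : Set V) \ ⋃₀ 𝒮).ncard : ℝ) ≤
        ∑ v ∈ C, (1 - degIn G C v / d) + 10 * (#C / lam) := by
  have hexp' : ExpandsIn (G.comap ((↑) : C → V)) univ (d / lam ^ 2) := by
    intro S _ hS
    have h1 := hexp (S.map (Function.Embedding.subtype _)) (by
      intro v hv
      obtain ⟨x, -, rfl⟩ := mem_map.1 hv
      exact x.2) (by rw [card_map]; simpa using hS)
    rw [card_map, sum_map] at h1
    refine h1.trans_eq (sum_congr rfl fun v _ => ?_)
    rw [degIn_comap_subtype, Finset.map_sdiff, univ_eq_attach, attach_map_val]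
    rfl
  obtain ⟨𝒮, h𝒮, hdis, hcard⟩ := exists_packing_of_expandsIn (G := G.comap ((↑) : C → V)) hF hlam
    hW hd130 (fun v => by
      rw [degIn_comap_subtype_univ]; exact (degIn_mono G (subset_univ _) _).trans (hd v)) hexp'
    (by simpa using hC) (by simpa using (card_le_univ C).trans hl)
  have hinj : Function.Injective ((↑) : C → V) := Subtype.val_injective
  refine ⟨Set.image (↑) '' 𝒮, ?_, ?_, ?_⟩
  · rintro _ ⟨S, hS, rfl⟩
    refine ⟨(h𝒮 S hS).map (SimpleGraph.Embedding.comap ⟨_, hinj⟩ G), ?_⟩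
    rintro _ ⟨x, -, rfl⟩
    exact x.2
  · rintro _ ⟨S, hS, rfl⟩ _ ⟨T, hT, rfl⟩ hST
    exact (Set.disjoint_image_iff hinj).2 (hdis hS hT fun h => hST (by rw [h]))
  · have h1 : (C : Set V) \ ⋃₀ (Set.image (↑) '' 𝒮) = ((↑) : C → V) '' (⋃₀ 𝒮)ᶜ := by
      ext v
      simp only [Set.mem_sdiff, mem_coe, Set.sUnion_image, Set.mem_iUnion, Set.mem_image,
        Set.mem_compl_iff, Set.mem_sUnion, not_exists, not_and]
      constructor
      · rintro ⟨hv, h⟩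
        exact ⟨⟨v, hv⟩, fun S hS hvS => h S hS _ hvS rfl, rfl⟩
      · rintro ⟨x, hx, rfl⟩
        exact ⟨x.2, fun S hS y hy hyx => hx S hS (hinj hyx ▸ hy)⟩
    rw [h1, Set.ncard_image_of_injective _ hinj]
    refine hcard.trans_eq ?_
    simp only [degIn_comap_subtype_univ, Fintype.card_coe]
    rw [← sum_coe_sort C fun v => 1 - degIn G C v / d]

/-- Splitting off a badly expanding `S` raises the total deficit by at most 2|S|/`lam`², which the
drop of at least |S| in the potential |C| log |C| pays for. -/
theorem exists_packing_subset {w₀ w₁ : W} (hF : F.Adj w₀ w₁) {lam : ℕ}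
    (hlam : 100 ≤ lam) (hW : Fintype.card W ≤ lam) {d : ℝ} (hd130 : (lam : ℝ) ^ 130 ≤ d)
    (hd : ∀ v, degIn G univ v ≤ d) (hl : Fintype.card V ≤ 2 ^ (lam + 1)) (C : Finset V) :
    ∃ 𝒮 : Set (Set V), (∀ S ∈ 𝒮, HasSubdivisionOn F G S ∧ S ⊆ C) ∧ 𝒮.Pairwise Disjoint ∧
      (((C : Set V) \ ⋃₀ 𝒮).ncard : ℝ) ≤ ∑ v ∈ C, (1 - degIn G C v / d) +
        2 / lam ^ 2 * (#C * Real.logb 2 #C) + 10 * (#C / lam) := by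
  have hlam0 : (0 : ℝ) < lam := by exact_mod_cast (by omega : 0 < lam)
  have hd0 : 0 < d := lt_of_lt_of_le (by positivity) hd130
  induction C using Finset.strongInduction with
  | H C ih =>
  have hlog := natCast_mul_logb_nonneg #C
  have hlog' : 0 ≤ 2 / (lam : ℝ) ^ 2 * (#C * Real.logb 2 #C) := by positivity
  rcases Nat.lt_or_ge #C 2 with hC | hC
  -- At most one vertex: the deficit is already |C|, so nothing need be covered.
  · refine ⟨∅, by simp, by simp, ?_⟩
    have h1 : ∑ v ∈ C, (1 - degIn G C v / d) = #C := by
      rw [card_eq_sum_ones, Nat.cast_sum]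
      refine sum_congr rfl fun v hv => ?_
      have h2 : degIn G C v = 0 := sum_eq_zero fun u hu => by
        rw [card_le_one.1 (by omega) u hu v hv, adjInd_self]
      simp [h2]
    have h2 : (0 : ℝ) ≤ 10 * (#C / lam) := by positivity
    rw [h1, Set.sUnion_empty, Set.sdiff_empty, Set.ncard_coe_finset]
    linarith
  by_cases hexp : ∀ S ⊆ C, 2 * #S ≤ #C → d / lam ^ 2 * #S ≤ ∑ v ∈ S, degIn G (C \ S) v
  · obtain ⟨𝒮, h𝒮, hdis, hcard⟩ :=
      exists_packing_of_expandsIn_subset hF hlam hW hd130 hd hl hC hexp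
    exact ⟨𝒮, h𝒮, hdis, by linarith⟩
  push Not at hexp
  obtain ⟨S, hSC, hScard, hS⟩ := hexp
  have hS0 : 0 < #S := by
    rw [card_pos, nonempty_iff_ne_empty]
    rintro rfl
    simp at hS
  have hsum : #S + #(C \ S) = #C := by rw [add_comm]; exact card_sdiff_add_card_eq_card hSC
  obtain ⟨𝒮₁, h𝒮₁, hdis₁, hcard₁⟩ := ih S (hSC.ssubset_of_ne (by rintro rfl; omega))
  obtain ⟨𝒮₂, h𝒮₂, hdis₂, hcard₂⟩ := ih (C \ S) (sdiff_subset.ssubset_of_ne fun h => by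
    rw [h] at hsum; omega)
  have hcross : ∀ A ∈ 𝒮₁, ∀ B ∈ 𝒮₂, Disjoint A B := fun A hA B hB =>
    Set.disjoint_of_subset (h𝒮₁ A hA).2 (h𝒮₂ B hB).2 (disjoint_coe.2 disjoint_sdiff)
  refine ⟨𝒮₁ ∪ 𝒮₂, ?_, ?_, ?_⟩
  · rintro A (hA | hA)
    · exact ⟨(h𝒮₁ A hA).1, (h𝒮₁ A hA).2.trans (coe_subset.2 hSC)⟩
    · exact ⟨(h𝒮₂ A hA).1, (h𝒮₂ A hA).2.trans (coe_subset.2 sdiff_subset)⟩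
  · rintro A (hA | hA) B (hB | hB) hAB
    · exact hdis₁ hA hB hAB
    · exact hcross A hA B hB
    · exact (hcross B hB A hA).symm
    · exact hdis₂ hA hB hAB
  · have h1 : (C : Set V) \ ⋃₀ (𝒮₁ ∪ 𝒮₂) ⊆
        ((S : Set V) \ ⋃₀ 𝒮₁) ∪ (((C \ S : Finset V) : Set V) \ ⋃₀ 𝒮₂) := by
      rw [Set.sUnion_union]
      rintro v ⟨hv, hn⟩
      rw [Set.mem_union, not_or] at hn
      by_cases hvS : v ∈ S
      · exact Or.inl ⟨hvS, hn.1⟩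
      · exact Or.inr ⟨mem_coe.2 (mem_sdiff.2 ⟨hv, hvS⟩), hn.2⟩
    have h2 : (((C : Set V) \ ⋃₀ (𝒮₁ ∪ 𝒮₂)).ncard : ℝ) ≤
        ((S : Set V) \ ⋃₀ 𝒮₁).ncard + (((C \ S : Finset V) : Set V) \ ⋃₀ 𝒮₂).ncard := by
      exact_mod_cast (Set.ncard_le_ncard h1 (Set.toFinite _)).trans (Set.ncard_union_le _ _)
    have h3 := sum_deficit_split (G := G) (d := d) hSC
    have h4 : (∑ v ∈ S, degIn G (C \ S) v) / d ≤ #S / lam ^ 2 := by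
      rw [div_le_iff₀ hd0]
      refine hS.le.trans_eq ?_
      ring
    have h5 := mul_logb_add_le hS0 (b := #(C \ S)) (by omega)
    rw [hsum] at h5
    have h6 := mul_le_mul_of_nonneg_left h5 (by positivity : (0 : ℝ) ≤ 2 / lam ^ 2)
    have h7 : (#C : ℝ) = #S + #(C \ S) := by exact_mod_cast hsum.symm
    have h8 : 10 * ((#C : ℝ) / lam) = 10 * (#S / lam) + 10 * (#(C \ S) / lam) := by
      rw [h7]; ring
    have h9 : 2 / (lam : ℝ) ^ 2 * #S = 2 * (#S / lam ^ 2) := by ring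
    linarith

end Decomposition

/-! ### The main theorem -/

theorem exists_isSubdivisionPacking {W V : Type*} {F : SimpleGraph W} {G : SimpleGraph V}
    {𝒮 : Set (Set V)} (h : ∀ S ∈ 𝒮, HasSubdivisionOn F G S) (hdis : 𝒮.Pairwise Disjoint) :
    ∃ 𝒦 : Set G.Subgraph, IsSubdivisionPacking F G 𝒦 ∧ coveredVertices 𝒦 = ⋃₀ 𝒮 := by
  choose K hK hKS using h
  refine ⟨{L | ∃ S, ∃ h : S ∈ 𝒮, L = K S h}, ⟨?_, ?_⟩, ?_⟩
  · rintro _ ⟨S, hS, rfl⟩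
    exact hK S hS
  · rintro _ ⟨S, hS, rfl⟩ _ ⟨T, hT, rfl⟩ hne
    rw [hKS, hKS]
    exact hdis hS hT fun hST => hne (by subst hST; rfl)
  · ext v
    simp only [coveredVertices, Set.mem_iUnion, Set.mem_sUnion, Set.mem_ofPred_eq]
    constructor
    · rintro ⟨_, ⟨S, hS, rfl⟩, hv⟩
      exact ⟨S, hS, hKS S hS ▸ hv⟩
    · rintro ⟨S, hS, hv⟩
      exact ⟨K S hS, ⟨S, hS, rfl⟩, (hKS S hS).symm ▸ hv⟩

/-- The power 1/30 is simply discarded; log y ≤ 2√y and √y ≥ 50 suffice. -/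
theorem rpow_logb_le_div {y : ℝ} (hy : 2500 ≤ y) :
    1 ≤ Real.logb 2 y ^ ((1 : ℝ) / 30) ∧ Real.logb 2 y ^ ((1 : ℝ) / 30) ≤ y / 15 := by
  have hy0 : 0 < y := by linarith
  have h1 : 1 ≤ Real.logb 2 y := by
    rw [← Real.logb_self_eq_one one_lt_two]
    exact Real.logb_le_logb_of_le one_lt_two two_pos (by linarith)
  refine ⟨Real.one_le_rpow h1 (by norm_num), ?_⟩
  refine (Real.rpow_le_rpow_of_exponent_le h1 (by norm_num : (1 : ℝ) / 30 ≤ 1)).trans ?_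
  rw [Real.rpow_one, Real.logb, div_le_iff₀ (Real.log_pos one_lt_two)]
  have h2 : Real.log √y ≤ √y := (Real.log_le_sub_one_of_pos (by positivity)).trans (by linarith)
  rw [Real.log_sqrt hy0.le] at h2
  have h3 : (50 : ℝ) ≤ √y := Real.le_sqrt_of_sq_le (by linarith)
  have h4 : √y * √y = y := Real.mul_self_sqrt hy0.le
  have h5 := Real.log_two_gt_d9
  nlinarith

theorem sq_le_two_pow {k : ℕ} (hk : 4 ≤ k) : k ^ 2 ≤ 2 ^ k := by
  induction k, hk using Nat.le_induction with
  | base => norm_num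
  | succ k hk ih => rw [pow_succ 2 k]; nlinarith

/-- A regular graph starts with deficit zero. The potential contributes 4n/`lam`, since log n ≤
2`lam`, and the expanding parts contribute 10n/`lam`. -/
theorem exists_packing_of_regular {W V : Type*} [Fintype W] [Fintype V] {F : SimpleGraph W}
    {w₀ w₁ : W} (hF : F.Adj w₀ w₁) {G : SimpleGraph V} [DecidableRel G.Adj] {lam d : ℕ}
    (hlam : 100 ≤ lam) (hW : Fintype.card W ≤ lam) (hd130 : lam ^ 130 ≤ d)
    (hd : G.IsRegularOfDegree d) (hV : 0 < Fintype.card V)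
    (hl : Fintype.card V ≤ 2 ^ (lam + 1)) :
    ∃ 𝒮 : Set (Set V), (∀ S ∈ 𝒮, HasSubdivisionOn F G S) ∧ 𝒮.Pairwise Disjoint ∧
      ((⋃₀ 𝒮)ᶜ.ncard : ℝ) ≤ 14 * (Fintype.card V / lam) := by
  classical
  have hdeg : ∀ v, degIn G univ v = d := fun v => by
    rw [degIn_eq_card, ← hd v, ← SimpleGraph.card_neighborFinset_eq_degree]
    congr 2
    ext u
    simp
  have hlam0 : (0 : ℝ) < lam := by exact_mod_cast (by omega : 0 < lam)
  have hd' : (lam : ℝ) ^ 130 ≤ (d : ℝ) := by exact_mod_cast hd130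
  have hd0 : (0 : ℝ) < d := lt_of_lt_of_le (by positivity) hd'
  obtain ⟨𝒮, h𝒮, hdis, hcard⟩ := exists_packing_subset hF hlam hW hd' (fun v => (hdeg v).le)
    hl univ
  refine ⟨𝒮, fun S hS => (h𝒮 S hS).1, hdis, ?_⟩
  simp only [hdeg, div_self hd0.ne', sub_self, sum_const_zero, zero_add, card_univ, coe_univ,
    ← Set.compl_eq_univ_sdiff] at hcard
  have h1 : Real.logb 2 (Fintype.card V) ≤ 2 * lam := by
    calc Real.logb 2 (Fintype.card V) ≤ Real.logb 2 ((2 : ℝ) ^ (lam + 1)) :=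
          Real.logb_le_logb_of_le one_lt_two (by exact_mod_cast hV) (by exact_mod_cast hl)
      _ = lam + 1 := by
        rw [Real.logb_pow, Real.logb_self_eq_one one_lt_two]; push_cast; ring
      _ ≤ 2 * lam := by
        have : (100 : ℝ) ≤ lam := by exact_mod_cast hlam
        linarith
  have h2 : 2 / (lam : ℝ) ^ 2 * (Fintype.card V * Real.logb 2 (Fintype.card V)) ≤
      2 / (lam : ℝ) ^ 2 * (Fintype.card V * (2 * lam)) := by gcongr
  have h3 : 2 / (lam : ℝ) ^ 2 * (Fintype.card V * (2 * lam)) = 4 * (Fintype.card V / lam) := by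
    field_simp; norm_num
  linarith

theorem mainTheorem1 {W : Type*} [Finite W] [Nonempty W] (F : SimpleGraph W) :
    ∃ N : ℕ, ∀ n : ℕ, N ≤ n →
      ∀ (V : Type*) [Fintype V] (G : SimpleGraph V) [DecidableRel G.Adj] (d : ℕ),
        Fintype.card V = n → G.IsRegularOfDegree d → Real.logb 2 n ^ 130 ≤ (d : ℝ) →
          ∃ 𝒦 : Set G.Subgraph, IsSubdivisionPacking F G 𝒦 ∧
            ((coveredVertices 𝒦)ᶜ.ncard : ℝ) ≤
              (n : ℝ) / Real.logb 2 (Real.logb 2 n) ^ ((1 : ℝ) / 30) := by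
  have := Fintype.ofFinite W
  refine ⟨2 ^ (2500 + Fintype.card W), fun n hn V _ G _ d hVn hreg hd => ?_⟩
  have hn0 : n ≠ 0 := (Nat.lt_of_lt_of_le (by positivity) hn).ne'
  set lam := Nat.log 2 n with hlam
  have hlamW : 2500 + Fintype.card W ≤ lam := Nat.le_log_of_pow_le one_lt_two hn
  have hlow : 2 ^ lam ≤ n := Nat.pow_log_le_self 2 hn0
  have hupp : n < 2 ^ (lam + 1) := Nat.lt_pow_succ_log_self one_lt_two n
  set y := Real.logb 2 n with hy
  have hn1 : (0 : ℝ) < n := by exact_mod_cast Nat.pos_of_ne_zero hn0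
  have hly : (lam : ℝ) ≤ y := by
    rw [hy, Real.le_logb_iff_rpow_le one_lt_two hn1, Real.rpow_natCast]
    exact_mod_cast hlow
  have hyl : y ≤ lam + 1 := by
    rw [hy, Real.logb_le_iff_le_rpow one_lt_two hn1]
    exact_mod_cast hupp.le
  have hlam' : (2500 : ℝ) ≤ lam := by exact_mod_cast (by omega : 2500 ≤ lam)
  obtain ⟨hz1, hz⟩ := rpow_logb_le_div (hlam'.trans hly)
  set z := Real.logb 2 y ^ ((1 : ℝ) / 30)
  -- This turns the bound 14n/`lam` into n/z, by (`lam` + 1)/15 ≤ `lam`/14.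
  have hzl : z ≤ lam / 14 := by linarith
  suffices h : ∃ 𝒮 : Set (Set V), (∀ S ∈ 𝒮, HasSubdivisionOn F G S) ∧ 𝒮.Pairwise Disjoint ∧
      ((⋃₀ 𝒮)ᶜ.ncard : ℝ) ≤ n / z by
    obtain ⟨𝒮, h𝒮, hdis, hcard⟩ := h
    obtain ⟨𝒦, h𝒦, hcov⟩ := exists_isSubdivisionPacking h𝒮 hdis
    exact ⟨𝒦, h𝒦, by rwa [hcov]⟩
  by_cases hF : ∃ w₀ w₁, F.Adj w₀ w₁
  · obtain ⟨w₀, w₁, hF⟩ := hF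
    have hd130 : lam ^ 130 ≤ d := by
      have : (lam : ℝ) ^ 130 ≤ d := (pow_le_pow_left₀ (by linarith) hly 130).trans hd
      exact_mod_cast this
    obtain ⟨𝒮, h𝒮, hdis, hcard⟩ := exists_packing_of_regular hF (lam := lam) (by omega) (by omega)
      hd130 hreg (by omega) (by omega)
    refine ⟨𝒮, h𝒮, hdis, hcard.trans ?_⟩
    rw [hVn]
    calc 14 * ((n : ℝ) / lam) = n / (lam / 14) := by field_simp
      _ ≤ n / z := by gcongr
  · push Not at hF
    obtain ⟨𝒮, h𝒮, hdis, hcard⟩ := exists_packing_of_edgeless G hF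
    refine ⟨𝒮, h𝒮, hdis, ?_⟩
    rw [le_div_iff₀ (by linarith)]
    have h1 : ((⋃₀ 𝒮)ᶜ.ncard : ℝ) ≤ lam := by exact_mod_cast (by omega : (⋃₀ 𝒮)ᶜ.ncard ≤ lam)
    calc ((⋃₀ 𝒮)ᶜ.ncard : ℝ) * z ≤ lam * lam := by gcongr; linarith
      _ = ((lam ^ 2 : ℕ) : ℝ) := by push_cast; ring
      _ ≤ n := by exact_mod_cast (sq_le_two_pow (by omega)).trans hlow
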